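/- Let $Q\subseteq\mathbb{R}^N$ be an embedded smooth submanifold, with tangent spaces $T_qQ\subseteq\mathbb{R}^N$ and tangent bundle $TQ\subseteq\mathbb{R}^N\times\mathbb{R}^N$, and put $M:=TQ\times\mathbb{R}\subseteq\mathbb{R}^{2N+1}$. Let $\nabla$ be an affine connection on $Q$, let $Y_0,Y_1,\dots,Y_n$ be smooth vector fields on $Q$, let $R$ be a smooth bundle map over $Q$ (linear maps $R(q)\colon T_qQ\to T_qQ$ depending smoothly on $q$), and let $\psi\colon Q\to\mathbb{R}$ be smooth. Let $\alpha\colon\mathbb{R}\to\mathbb{R}$ be smooth such that $\alpha\alpha'$ is positive and strictly increasing. Let $u=(u^1,\dots,u^n)\colon\mathbb{R}\to\mathbb{R}^n$ be measurable, bounded, $T$-periodic for some $T>0$ and zero-mean, let $U$ be its zero-mean antiderivative, and assume $\frac1T\int_0^TU^i(\tau)U^j(\tau)\,d\tau=\delta_{ij}$ for all $i,j$. Let $\lambda,\mu\in\mathbb{R}^n$ and $h>0$. For $\omega>0$ consider the closed-loop system \[ \nabla_{\dot q}\dot q=Y_0(q)-R(q)\dot q+\sum_{i=1}^n\mu^i(\lambda^i)^2\alpha^2(\psi(q)-\eta)Y_i(q)+\sum_{i=1}^n\omega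 u^i(\omega t)\lambda^i\alpha(\psi(q)-\eta)Y_i(q),\qquad \dot\eta=-h\eta+h\psi(q), \] and the averaged system \begin{align*} \nabla_{\dot q}\dot q&=Y_0(q)-R(q)\dot q+\alpha^2(\psi(q)-\eta)\sum_{i=1}^n(\lambda^i)^2\mu^iY_i(q)-\tfrac12\alpha^2(\psi(q)-\eta)\sum_{i=1}^n(\lambda^i)^2\langle Y_i:Y_i\rangle(q)\\ &\qquad-(\alpha\alpha')(\psi(q)-\eta)\sum_{i=1}^n(\lambda^i)^2(Y_i\psi)(q)Y_i(q),\qquad \dot\eta=-h\eta+h\psi(q), \end{align*} where $\nabla_{\dot q}\dot q$ is the geometric acceleration, $\langle X:Y\rangle=\nabla_YX+\nabla_XY$ is the symmetric product and $Y_i\psi$ is the Lie derivative. With $v=\dot q$ both are regarded as first-order systems for $x=(q,v,\eta)$ on $M$; solutions are locally absolutely continuous curves in $M$ that satisfy the equations for almost every $t$. Let $\phi^\omega_t\colon M\to M$ be the change of variables \[ \phi^\omega_t(q,v,\eta)=\Big(q,\;v-\sum_{i=1}^nU^i(\omega t)\lambda^i\alpha(\psi(q)-\eta)Y_i(q),\;\eta\Big).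 \] For a nonempty compact $K\subseteq M$ let $|x|_K$ be the Euclidean distance of $x$ to $K$, and let $S\subseteq M$ be a neighborhood of $K$ in $M$. For a family of systems $\dot x=f^\omega(t,x)$ and bijections $\phi^\omega_t$ of $M$, $K$ is called $S$-practically uniformly asymptotically stable in the variables $\tilde x=\phi^\omega_t(x)$ if (i) for every $\varepsilon>0$ there are $\omega_0,\delta>0$ such that for all $\omega\ge\omega_0$, $t_0\in\mathbb{R}$ and $\tilde x_0\in M$ with $|\tilde x_0|_K\le\delta$, the maximal solution with $x(t_0)=(\phi^\omega_{t_0})^{-1}(\tilde x_0)$ exists and satisfies $|\phi^\omega_t(x(t))|_K\le\varepsilon$ for all $t\ge t_0$; and (ii) for all $r,\varepsilon>0$ there are $\omega_0,\Delta,\rho>0$ such that for all $\omega\ge\omega_0$, $t_0\in\mathbb{R}$ and $\tilde x_0\in S$ with $|\tilde x_0|_K\le r$, the maximal solution with $x(t_0)=(\phi^\omega_{t_0})^{-1}(\tilde x_0)$ exists and satisfies $|\phi^\omega_t(x(t))|_K\le\rho$ for all $t\ge t_0$, and $|\phi^\omega_t(x(t))|_K\le\varepsilon$ for all $t\ge t_0+\Delta$.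 If $f^\omega=\bar f$ does not depend on $\omega$ and $\phi^\omega_t=\mathrm{id}$, then $K$ is called $S$-uniformly asymptotically stable for $\dot x=\bar f(t,x)$. Assume that $Q$ is closed in $\mathbb{R}^N$ or, more generally, only that for every $r>0$ the solutions of the averaged system that start in $S$ at distance at most $r$ from $K$ stay, for all later times, in a common compact subset of $M$. Then, for every nonempty compact $K\subseteq M$ and every neighborhood $S$ of $K$ in $M$ as above: if $K$ is $S$-uniformly asymptotically stable for the averaged system, then $K$ is $S$-practically uniformly asymptotically stable for the closed-loop system in the variables $\tilde x=\phi^\omega_t(x)$. -/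

import Mathlib

open MeasureTheory Set Filter Topology
open scoped ContDiff

noncomputable section

namespace ExtremumSeeking

/-! ### Submanifolds of Euclidean space -/

/-- The ambient Euclidean space `ℝ^N`. -/
abbrev Euc (N : ℕ) : Type := EuclideanSpace ℝ (Fin N)

/-- `Q ⊆ ℝ^N` is an embedded smooth submanifold (of some codimension `k`): near each of its points,
`Q` is the zero set of a smooth submersion into `ℝ^k`. The set `Q` need not be closed. -/
def IsEmbeddedSubmanifold {N : ℕ} (Q : Set (Euc N)) : Prop :=
  ∃ k : ℕ, ∀ q ∈ Q, ∃ (O : Set (Euc N)) (g : Euc N → Euc k),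
    IsOpen O ∧ q ∈ O ∧ ContDiffOn ℝ ∞ g O ∧ (∀ p ∈ O, p ∈ Q ↔ g p = 0) ∧
      ∀ p ∈ O, Function.Surjective (fderiv ℝ g p)

/-- The tangent space `T_q Q` as a linear subspace of `ℝ^N`. (If `Q` is an embedded submanifold and
`q ∈ Q`, then the tangent cone is already the tangent space; the span only makes the
definition total.) -/
def tangentSpaceAt {N : ℕ} (Q : Set (Euc N)) (q : Euc N) : Submodule ℝ (Euc N) :=
  Submodule.span ℝ (tangentConeAt ℝ Q q)

/-- The derivative at `q` of a function `f`, defined on `Q`, in the direction of a tangent vector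
`v ∈ T_q Q`. Only the values of `f` on `Q` matter, and derivatives of `f` within `Q`
agree on tangent vectors. -/
def dirDeriv {N : ℕ} {G : Type*} [NormedAddCommGroup G] [NormedSpace ℝ G]
    (Q : Set (Euc N)) (f : Euc N → G) (q v : Euc N) : G :=
  fderivWithin ℝ f Q q v

/-- Smooth vector fields on `Q`; only the restriction of `X` to `Q` is relevant. -/
def IsSmoothVectorField {N : ℕ} (Q : Set (Euc N)) (X : Euc N → Euc N) : Prop :=
  ContDiffOn ℝ ∞ X Q ∧ ∀ q ∈ Q, X q ∈ tangentSpaceAt Q q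

/-- Smooth bundle maps over `Q`: `R q` restricts to a linear map `T_q Q → T_q Q`, and `(q, v) ↦ R q v`
is smooth on `TQ`. Only the restrictions of the maps `R q` to `T_q Q`, `q ∈ Q`, are relevant. -/
def IsSmoothBundleMap {N : ℕ} (Q : Set (Euc N)) (R : Euc N → Euc N →ₗ[ℝ] Euc N) : Prop :=
  (∀ q ∈ Q, ∀ v ∈ tangentSpaceAt Q q, R q v ∈ tangentSpaceAt Q q) ∧
    ContDiffOn ℝ ∞ (fun p : Euc N × Euc N => R p.1 p.2)
      {p | p.1 ∈ Q ∧ p.2 ∈ tangentSpaceAt Q p.1}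

/-- Affine connections on `Q`: `nabla X Y` is `∇_X Y`. -/
structure AffineConnection {N : ℕ} (Q : Set (Euc N)) where
  /-- the covariant derivative `∇_X Y` -/
  nabla : (Euc N → Euc N) → (Euc N → Euc N) → Euc N → Euc N
  /-- `∇_X Y` depends only on the vector fields on `Q` -/
  congr : ∀ X X' Y Y', EqOn X X' Q → EqOn Y Y' Q → EqOn (nabla X Y) (nabla X' Y') Q
  smooth : ∀ X Y, IsSmoothVectorField Q X → IsSmoothVectorField Q Y →
    IsSmoothVectorField Q (nabla X Y)
  add_left : ∀ X X' Y, IsSmoothVectorField Q X → IsSmoothVectorField Q X' →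
    IsSmoothVectorField Q Y → ∀ q ∈ Q,
      nabla (fun p => X p + X' p) Y q = nabla X Y q + nabla X' Y q
  add_right : ∀ X Y Y', IsSmoothVectorField Q X → IsSmoothVectorField Q Y →
    IsSmoothVectorField Q Y' → ∀ q ∈ Q,
      nabla X (fun p => Y p + Y' p) q = nabla X Y q + nabla X Y' q
  smul_left : ∀ (χ : Euc N → ℝ) (X Y), ContDiffOn ℝ ∞ χ Q → IsSmoothVectorField Q X →
    IsSmoothVectorField Q Y → ∀ q ∈ Q,
      nabla (fun p => χ p • X p) Y q = χ q • nabla X Y q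
  leibniz : ∀ (χ : Euc N → ℝ) (X Y), ContDiffOn ℝ ∞ χ Q → IsSmoothVectorField Q X →
    IsSmoothVectorField Q Y → ∀ q ∈ Q,
      nabla X (fun p => χ p • Y p) q = χ q • nabla X Y q + dirDeriv Q χ q (X q) • Y q

/-- The symmetric product `⟨X : Y⟩ = ∇_Y X + ∇_X Y`. -/
def AffineConnection.symProd {N : ℕ} {Q : Set (Euc N)} (C : AffineConnection Q)
    (X Y : Euc N → Euc N) (q : Euc N) : Euc N :=
  C.nabla Y X q + C.nabla X Y q

/-- A smooth vector field on `Q` whose value at `q` is `v ∈ T_q Q`: the orthogonal projection of the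
constant vector `v` to the tangent spaces of `Q`. -/
def extend {N : ℕ} (Q : Set (Euc N)) (v : Euc N) (p : Euc N) : Euc N :=
  (tangentSpaceAt Q p).starProjection v

/-- The geometric acceleration `∇_{q̇} q̇` of a curve `q` in `Q` is
`q̈ - D X(q)[q̇] + (∇_X X)(q)`, where `X` is any smooth vector field on `Q` with `X(q) = q̇`; the value
does not depend on `X`. In local coordinates it is `q̈^i + Γ^i_{jk} q̇^j q̇^k`.
The following vector is `D X(q)[v] - (∇_X X)(q)` with `v = q̇`, so that `∇_{q̇} q̇ = F` if and only if
`q̈ = spray q q̇ + F`. -/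
def AffineConnection.spray {N : ℕ} {Q : Set (Euc N)} (C : AffineConnection Q)
    (q v : Euc N) : Euc N :=
  dirDeriv Q (extend Q v) q v - C.nabla (extend Q v) (extend Q v) q

/-! ### Solutions and practical stability -/

section Stability

variable {F : Type*} [NormedAddCommGroup F] [InnerProductSpace ℝ F]

/-- `x` is a (Carathéodory) solution of `ẋ = f(t, x)` in `M` on the interval `I ∋ t₀`, that is, a
locally absolutely continuous curve in `M` which satisfies the equation almost everywhere. -/
def IsSolutionOn (M : Set F) (f : ℝ → F → F) (t₀ : ℝ) (I : Set ℝ) (x : ℝ → F) : Prop :=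
  ∀ t ∈ I, x t ∈ M ∧ IntervalIntegrable (fun s => f s (x s)) volume t₀ t ∧
    x t = x t₀ + ∫ s in t₀..t, f s (x s)

/-- The unique maximal solution of `ẋ = f(t, x)` in `M` with `x(t₀) = x₀` is defined on
`[t₀, ∞)` and satisfies `P t (x t)` for every `t ≥ t₀`. -/
def MaximalSolutionSatisfies (M : Set F) (f : ℝ → F → F) (t₀ : ℝ) (x₀ : F)
    (P : ℝ → F → Prop) : Prop :=
  ∃ x : ℝ → F, IsSolutionOn M f t₀ (Ici t₀) x ∧ x t₀ = x₀ ∧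
    (∀ (t₁ : ℝ) (y : ℝ → F), IsSolutionOn M f t₀ (Icc t₀ t₁) y → y t₀ = x₀ →
      EqOn y x (Icc t₀ t₁)) ∧
    ∀ t, t₀ ≤ t → P t (x t)

/-- `K` is practically uniformly stable for `ẋ = f ω (t, x)` in the variables `x̃ = φ ω t x`. -/
def PracticallyUniformlyStable (M : Set F) (f : ℝ → ℝ → F → F) (φ : ℝ → ℝ → F → F)
    (K : Set F) : Prop :=
  ∀ ε > 0, ∃ om₀ > 0, ∃ δ > 0, ∀ om ≥ om₀, ∀ t₀ : ℝ, ∀ y₀ ∈ M, Metric.infDist y₀ K ≤ δ →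
    MaximalSolutionSatisfies M (f om) t₀ (Function.invFunOn (φ om t₀) M y₀)
      (fun t x => Metric.infDist (φ om t x) K ≤ ε)

/-- `K` is `S`-practically uniformly attractive for `ẋ = f ω (t, x)` in the variables
`x̃ = φ ω t x`. -/
def PracticallyUniformlyAttractive (M : Set F) (f : ℝ → ℝ → F → F) (φ : ℝ → ℝ → F → F)
    (K S : Set F) : Prop :=
  ∀ r > 0, ∀ ε > 0, ∃ om₀ > 0, ∃ Δ > 0, ∃ ρ > 0, ∀ om ≥ om₀, ∀ t₀ : ℝ, ∀ y₀ ∈ S,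
    Metric.infDist y₀ K ≤ r →
    MaximalSolutionSatisfies M (f om) t₀ (Function.invFunOn (φ om t₀) M y₀)
      (fun t x => Metric.infDist (φ om t x) K ≤ ρ ∧
        (t₀ + Δ ≤ t → Metric.infDist (φ om t x) K ≤ ε))

/-- `K` is `S`-practically uniformly asymptotically stable for `ẋ = f ω (t, x)` in the variables
`x̃ = φ ω t x`. -/
def PracticallyUniformlyAsymptoticallyStable (M : Set F) (f : ℝ → ℝ → F → F)
    (φ : ℝ → ℝ → F → F) (K S : Set F) : Prop :=
  PracticallyUniformlyStable M f φ K ∧ PracticallyUniformlyAttractive M f φ K S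

/-- `K` is `S`-uniformly asymptotically stable for the parameter-free system `ẋ = g(t, x)`. -/
def UniformlyAsymptoticallyStable (M : Set F) (g : ℝ → F → F) (K S : Set F) : Prop :=
  PracticallyUniformlyAsymptoticallyStable M (fun _ => g) (fun _ _ x => x) K S

/-- `S` is a neighborhood of `K` in `M`. -/
def IsNeighborhoodIn (M K S : Set F) : Prop :=
  S ⊆ M ∧ ∃ O : Set F, IsOpen O ∧ K ⊆ O ∧ O ∩ M ⊆ S

/-- For every `r > 0`, the solutions of `ẋ = g(t, x)` which start in `S` at distance at most `r`
from `K` stay in a common compact subset of `M`. -/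
def MotionsRelativelyCompact (M : Set F) (g : ℝ → F → F) (K S : Set F) : Prop :=
  ∀ r > 0, ∃ C ⊆ M, IsCompact C ∧ ∀ t₀ : ℝ, ∀ x₀ ∈ S, Metric.infDist x₀ K ≤ r →
    MaximalSolutionSatisfies M g t₀ x₀ (fun _ x => x ∈ C)

end Stability

/-! ### The extremum seeking system -/

/-- `ℝ^N × ℝ^N × ℝ` with the Euclidean norm; its points are triples `(q, v, η)`. -/
abbrev State (N : ℕ) : Type := WithLp 2 (Euc N × WithLp 2 (Euc N × ℝ))

/-- The triple `(q, v, η)`. -/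
def mkState {N : ℕ} (q v : Euc N) (η : ℝ) : State N :=
  WithLp.toLp 2 (q, WithLp.toLp 2 (v, η))

/-- The product `TQ × ℝ`. -/
def tangentBundleProd {N : ℕ} (Q : Set (Euc N)) : Set (State N) :=
  {x | x.fst ∈ Q ∧ x.snd.fst ∈ tangentSpaceAt Q x.fst}

/-- The zero-mean antiderivative of a `T`-periodic zero-mean function. -/
def zeroMeanAntideriv (T : ℝ) (w : ℝ → ℝ) (τ : ℝ) : ℝ :=
  (∫ s in (0 : ℝ)..τ, w s) - (1 / T) * ∫ σ in (0 : ℝ)..T, ∫ s in (0 : ℝ)..σ, w s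

/-- Admissible dither signals `u = (u^1, …, u^n)` of period `T`. -/
structure IsDither {n : ℕ} (T : ℝ) (u : ℝ → Fin n → ℝ) : Prop where
  period_pos : 0 < T
  measurable : Measurable u
  bounded : ∃ B : ℝ, ∀ τ i, |u τ i| ≤ B
  periodic : Function.Periodic u T
  zero_mean : ∀ i, ∫ τ in (0 : ℝ)..T, u τ i = 0
  orthonormal : ∀ i j,
    (1 / T) * (∫ τ in (0 : ℝ)..T,
      zeroMeanAntideriv T (fun s => u s i) τ * zeroMeanAntideriv T (fun s => u s j) τ) =
      if i = j then 1 else 0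

/-- The closed-loop system
`∇_{q̇} q̇ = Y₀ - R q̇ + ∑ μ^i (λ^i)² α²(ψ - η) Y_i + ∑ ω u^i(ω t) λ^i α(ψ - η) Y_i`,
`η̇ = -h η + h ψ`, as a first-order system for `x = (q, v, η)` on `TQ × ℝ`. -/
def closedLoop {N n : ℕ} {Q : Set (Euc N)} (C : AffineConnection Q)
    (Y₀ : Euc N → Euc N) (Y : Fin n → Euc N → Euc N) (R : Euc N → Euc N →ₗ[ℝ] Euc N)
    (ψ : Euc N → ℝ) (α : ℝ → ℝ) (u : ℝ → Fin n → ℝ) (lam mu : Fin n → ℝ) (h : ℝ)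
    (om t : ℝ) (x : State N) : State N :=
  let q := x.fst
  let v := x.snd.fst
  let η := x.snd.snd
  mkState v
    (C.spray q v + (Y₀ q - R q v
      + ∑ i, (mu i * lam i ^ 2 * α (ψ q - η) ^ 2) • Y i q
      + ∑ i, (om * u (om * t) i * lam i * α (ψ q - η)) • Y i q))
    (-h * η + h * ψ q)

/-- The averaged system
`∇_{q̇} q̇ = Y₀ - R q̇ + α² ∑ (λ^i)² μ^i Y_i - ½ α² ∑ (λ^i)² ⟨Y_i : Y_i⟩
- α α' ∑ (λ^i)² (Y_i ψ) Y_i`, `η̇ = -h η + h ψ`, with `α`, `α'` evaluated at `ψ - η`, as a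
first-order system for `x = (q, v, η)` on `TQ × ℝ`. -/
def averagedSystem {N n : ℕ} {Q : Set (Euc N)} (C : AffineConnection Q)
    (Y₀ : Euc N → Euc N) (Y : Fin n → Euc N → Euc N) (R : Euc N → Euc N →ₗ[ℝ] Euc N)
    (ψ : Euc N → ℝ) (α : ℝ → ℝ) (lam mu : Fin n → ℝ) (h : ℝ)
    (_t : ℝ) (x : State N) : State N :=
  let q := x.fst
  let v := x.snd.fst
  let η := x.snd.snd
  mkState v
    (C.spray q v + (Y₀ q - R q v
      + α (ψ q - η) ^ 2 • ∑ i, (lam i ^ 2 * mu i) • Y i q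
      - ((1 / 2 : ℝ) * α (ψ q - η) ^ 2) • ∑ i, lam i ^ 2 • C.symProd (Y i) (Y i) q
      - (α (ψ q - η) * deriv α (ψ q - η)) •
          ∑ i, (lam i ^ 2 * dirDeriv Q ψ q (Y i q)) • Y i q))
    (-h * η + h * ψ q)

/-- The change of variables `(q, v, η) ↦ (q, v - ∑ U^i(ω t) λ^i α(ψ - η) Y_i, η)`, where `U` is the
zero-mean antiderivative of the dither `u`. -/
def shiftVelocity {N n : ℕ} (Y : Fin n → Euc N → Euc N) (ψ : Euc N → ℝ) (α : ℝ → ℝ)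
    (T : ℝ) (u : ℝ → Fin n → ℝ) (lam : Fin n → ℝ) (om t : ℝ) (x : State N) : State N :=
  let q := x.fst
  let v := x.snd.fst
  let η := x.snd.snd
  mkState q
    (v - ∑ i, (zeroMeanAntideriv T (fun s => u s i) (om * t) * lam i * α (ψ q - η)) • Y i q)
    η

end ExtremumSeeking

end

open ExtremumSeeking

/-! A force of size `ω` and frequency `ω` makes the velocity oscillate with bounded amplitude, and
the change of variables subtracts this oscillation `∑ U^i(ωt) λ^i α(ψ - η) Y_i`. Differentiating the
subtracted term along a solution produces `ω u^i(ωt)`, which cancels the large force. What remains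
is `transformedField`, which depends on time only through the periodic, continuous signal `U(ωt)`
and is bounded on compact sets uniformly in `ω` (`closedLoop_sub_transformedField`,
`integral_closedLoop_sub`).

The geodesic spray is quadratic in the velocity and the derivative of the subtracted term is affine
in it, so the transformed field is a quadratic polynomial in `U`. Since `U` has zero mean and
orthonormal components, averaging over a period keeps the constant term and the diagonal quadratic
terms. In the latter the ordinary derivatives of `Y_i` along `Y_i` cancel, which leaves `-∇_{Y_i}
Y_i = -½⟨Y_i : Y_i⟩` and the `α α'` terms: this is the averaged system (`averagedSystem_eq`).

The rest is first-order averaging. On compact sets and bounded time intervals the two flows differ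
by `O(1/ω)` (`exists_averaging_estimate`), and the oscillating solution exists as long as the
averaged one stays in a compact set (`exists_solution_near_average`). Attractivity of the averaged
system contracts a `δ`-neighborhood of `K` into a `δ/2`-neighborhood in some time `Δ`; for large `ω`
the oscillating system then returns to the `δ`-neighborhood after each `Δ`, and this is iterated
forever (`exists_global_solution_near`). The compactness hypothesis serves only the transient from
distance `r`.

All of this is extrinsic. Smooth local retractions onto `Q` and `TQ × ℝ` replace charts;
differential equations are solved in the ambient space, and their solutions stay on the manifold
because the field is tangent to it (`transformedField_mem_tangentConeAt`). -/

namespace ExtremumSeeking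

/-! ### Smooth local retractions onto submanifolds. -/

section Retract

variable {F : Type*} [NormedAddCommGroup F] [NormedSpace ℝ F]

/-- Every point of `M` has an open neighborhood `O` with a smooth retraction of `O` onto `M ∩ O`. -/
def IsLocalRetract (M : Set F) : Prop :=
  ∀ p ∈ M, ∃ (O : Set F) (r : F → F), IsOpen O ∧ p ∈ O ∧ ContDiffOn ℝ ∞ r O ∧
    MapsTo r O (M ∩ O) ∧ ∀ x ∈ M ∩ O, r x = x

/-- With `A = Dg(p)` and a right inverse `B`, the map `Φ = 1 - BA + B ∘ g` satisfies `A ∘ Φ = g` and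
`DΦ(p) = 1`. It is thus a local diffeomorphism that straightens `Q` to `ker A`, and `Φ⁻¹ ∘ (1 - BA)
∘ Φ` is the retraction. -/
theorem IsEmbeddedSubmanifold.isLocalRetract {N : ℕ} {Q : Set (Euc N)}
    (hQ : IsEmbeddedSubmanifold Q) : IsLocalRetract Q := by
  obtain ⟨k, hQ⟩ := hQ
  intro p hp
  obtain ⟨O, g, hO, hpO, hg, hgQ, hsurj⟩ := hQ p hp
  set A := fderiv ℝ g p with hA
  obtain ⟨B, hB⟩ := A.exists_rightInverse_of_surjective
    (LinearMap.range_eq_top.2 (hsurj p hpO))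
  have hAB : ∀ y, A (B y) = y := fun y => by
    simpa using congrArg (fun L : Euc k →L[ℝ] Euc k => L y) hB
  set Φ : Euc N → Euc N := fun x => x - B (A x) + B (g x) with hΦ
  have hΦs : ContDiffOn ℝ ∞ Φ O := by
    have h1 : ContDiffOn ℝ ∞ (fun x => B (g x)) O := B.contDiff.comp_contDiffOn hg
    have h2 : ContDiff ℝ ∞ (fun x : Euc N => x - B (A x)) :=
      contDiff_id.sub (B.contDiff.comp A.contDiff)
    exact h2.contDiffOn.add h1
  have hAΦ : ∀ x, A (Φ x) = g x := fun x => by simp [hΦ, hAB]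
  have hgd : DifferentiableAt ℝ g p :=
    (hg.contDiffAt (hO.mem_nhds hpO)).differentiableAt (by simp)
  have hΦd : HasFDerivAt Φ ((ContinuousLinearEquiv.refl ℝ (Euc N) : Euc N →L[ℝ] Euc N)) p := by
    have h1 := ((hasFDerivAt_id (𝕜 := ℝ) p).sub (B.comp A).hasFDerivAt).add
      ((B.hasFDerivAt (x := g p)).comp p hgd.hasFDerivAt)
    have h2 : (ContinuousLinearEquiv.refl ℝ (Euc N) : Euc N →L[ℝ] Euc N) =
        ContinuousLinearMap.id ℝ (Euc N) - B.comp A + B.comp (fderiv ℝ g p) := by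
      ext x; simp [hA]
    rw [h2]
    exact h1
  have hΦc : ContDiffAt ℝ ∞ Φ p := hΦs.contDiffAt (hO.mem_nhds hpO)
  set e := hΦc.toOpenPartialHomeomorph Φ hΦd (by simp) with he
  have heΦ : ∀ x, e x = Φ x := fun x => rfl
  -- Smoothness of the inverse is wanted on a whole open set, so the domain is cut down to points
  -- where `DΦ` is invertible.
  set O₁ : Set (Euc N) := O ∩ fderiv ℝ Φ ⁻¹' range ((↑) : (Euc N ≃L[ℝ] Euc N) → Euc N →L[ℝ] Euc N)
    with hO₁
  have hO₁o : IsOpen O₁ :=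
    (hΦs.continuousOn_fderiv_of_isOpen hO (by simp)).isOpen_inter_preimage hO
      ContinuousLinearEquiv.isOpen
  have hpO₁ : p ∈ O₁ := ⟨hpO, by rw [mem_preimage, hΦd.fderiv]; exact ⟨_, rfl⟩⟩
  have hpe : p ∈ e.source := hΦc.mem_toOpenPartialHomeomorph_source hΦd (by simp)
  set V : Set (Euc N) := e.target ∩ e.symm ⁻¹' O₁ with hV
  have hVo : IsOpen V := e.symm.isOpen_inter_preimage hO₁o
  have hes : ContDiffOn ℝ ∞ e.symm V := by
    intro y hy
    obtain ⟨L, hL⟩ := hy.2.2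
    have hc : ContDiffAt ℝ ∞ Φ (e.symm y) := hΦs.contDiffAt (hO.mem_nhds hy.2.1)
    refine (e.contDiffAt_symm (f₀' := L) hy.1 ?_ hc).contDiffWithinAt
    rw [hL]
    exact (hc.differentiableAt (by simp)).hasFDerivAt
  set S : Euc N → Euc N := fun x => Φ x - B (A (Φ x)) with hS
  have hSs : ContDiffOn ℝ ∞ S O := hΦs.sub ((B.comp A).contDiff.comp_contDiffOn hΦs)
  have hSQ : ∀ x ∈ O, x ∈ Q → S x = Φ x := fun x hx hxQ => by
    have : g x = 0 := (hgQ x hx).1 hxQ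
    simp [hS, hAΦ, this]
  set O₂ : Set (Euc N) := (O ∩ e.source) ∩ S ⁻¹' V with hO₂
  have hO₂o : IsOpen O₂ :=
    (hSs.continuousOn.mono inter_subset_left).isOpen_inter_preimage (hO.inter e.open_source) hVo
  have hr : ContDiffOn ℝ ∞ (fun x => e.symm (S x)) O₂ :=
    hes.comp (hSs.mono fun x hx => hx.1.1) fun x hx => hx.2
  have hrQ : ∀ x ∈ O₂, e.symm (S x) ∈ Q := fun x hx => by
    rw [hgQ _ hx.2.2.1, ← hAΦ, ← heΦ, e.right_inv hx.2.1]
    simp [hS, hAB]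
  have hid : ∀ x ∈ Q, x ∈ O → x ∈ e.source → e.symm (S x) = x := fun x hx hxO hxe => by
    rw [hSQ x hxO hx, ← heΦ, e.left_inv hxe]
  have hpO₂ : p ∈ O₂ := by
    refine ⟨⟨hpO, hpe⟩, ?_⟩
    have h1 : S p = e p := hSQ p hpO hp
    rw [mem_preimage, h1]
    refine ⟨e.map_source hpe, ?_⟩
    rw [mem_preimage, e.left_inv hpe]
    exact hpO₁
  -- The retraction must map its domain into itself. Intersecting with the preimage of `O₂`
  -- suffices: the image of such a point lies in `Q ∩ O₂`, hence is a fixed point.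
  refine ⟨O₂ ∩ (fun x => e.symm (S x)) ⁻¹' O₂, fun x => e.symm (S x),
    hr.continuousOn.isOpen_inter_preimage hO₂o hO₂o, ⟨hpO₂, ?_⟩, hr.mono inter_subset_left, ?_, ?_⟩
  · rw [mem_preimage, hid p hp hpO hpe]; exact hpO₂
  · intro x hx
    refine ⟨hrQ x hx.1, hx.2, ?_⟩
    have := hid _ (hrQ x hx.1) hx.2.1.1 hx.2.1.2
    rw [mem_preimage, this]
    exact hx.2
  · exact fun x hx => hid x hx.1 hx.2.1.1.1 hx.2.1.1.2

/-- In `O`, a limit point of `M` is a fixed point of the retraction by continuity, and the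
retraction takes values in `M`. -/
theorem IsLocalRetract.isLocallyClosed {M : Set F} (hM : IsLocalRetract M) :
    IsLocallyClosed M := by
  refine ((isLocallyClosed_tfae M).out 0 3).2 fun p hp => ?_
  obtain ⟨O, r, hO, hpO, hr, hrM, hid⟩ := hM p hp
  refine ⟨O, hpO, hO, fun x hx => ?_⟩
  have hfix : r x = x := by
    have hx' : x ∈ closure (M ∩ O) := by
      rw [inter_comm]; exact hO.inter_closure hx
    have hc : ContinuousAt r x := hr.continuousOn.continuousAt (hO.mem_nhds hx.1)
    have : (𝓝[M ∩ O] x).NeBot := mem_closure_iff_nhdsWithin_neBot.1 hx'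
    refine tendsto_nhds_unique (hc.tendsto.mono_left nhdsWithin_le_nhds : Tendsto r (𝓝[M ∩ O] x) _)
      ((tendsto_id.mono_left nhdsWithin_le_nhds).congr' ?_)
    filter_upwards [self_mem_nhdsWithin] with y hy using (hid y hy).symm
  rw [← hfix]
  exact (hrM hx.1).1

/-- A compact subset of a locally closed set has a compact closed thickening in that set. -/
theorem _root_.IsLocallyClosed.exists_isCompact_cthickening {X : Type*} [PseudoMetricSpace X]
    [ProperSpace X] {M K : Set X}
    (hM : IsLocallyClosed M) (hK : IsCompact K) (hKM : K ⊆ M) :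
    ∃ ε > 0, ∀ ε' ≤ ε, IsCompact (M ∩ Metric.cthickening ε' K) := by
  obtain ⟨U, Z, hU, hZ, rfl⟩ := hM
  obtain ⟨ε, hε, hεU⟩ := hK.exists_cthickening_subset_open hU (hKM.trans inter_subset_left)
  refine ⟨ε, hε, fun ε' hε' => ?_⟩
  have h1 : U ∩ Z ∩ Metric.cthickening ε' K = Z ∩ Metric.cthickening ε' K := by
    ext x
    constructor
    · exact fun hx => ⟨hx.1.2, hx.2⟩
    · exact fun hx => ⟨⟨hεU (Metric.cthickening_mono hε' K hx.2), hx.1⟩, hx.2⟩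
  rw [h1]
  exact hK.cthickening.inter_left hZ

/-- A smooth retraction acts as the identity on tangent vectors. -/
theorem fderiv_retraction_apply_of_mem_tangentConeAt {M O : Set F} {r : F → F} (hO : IsOpen O)
    (hr : ContDiffOn ℝ ∞ r O) (hid : ∀ x ∈ M ∩ O, r x = x) {x w : F} (hx : x ∈ M ∩ O)
    (hw : w ∈ tangentConeAt ℝ M x) : fderiv ℝ r x w = w := by
  have h1 : HasFDerivWithinAt r (fderiv ℝ r x) (M ∩ O) x :=
    ((hr.contDiffAt (hO.mem_nhds hx.2)).differentiableAt (by simp)).hasFDerivAt.hasFDerivWithinAt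
  have h2 : HasFDerivWithinAt r (ContinuousLinearMap.id ℝ F) (M ∩ O) x :=
    (hasFDerivWithinAt_id x _).congr hid (hid x hx)
  have h3 : w ∈ tangentConeAt ℝ (M ∩ O) x := by
    rwa [tangentConeAt_inter_nhds (hO.mem_nhds hx.2)]
  exact h1.unique_on h2 h3

/-- The derivative carries the tangent cone of the open set `O`, which is the whole space, into that
of the image of `O`, which lies in `M`. -/
theorem fderiv_retraction_mem_tangentConeAt {M O : Set F} {r : F → F} (hO : IsOpen O)
    (hr : ContDiffOn ℝ ∞ r O) (hrM : MapsTo r O (M ∩ O)) (hid : ∀ x ∈ M ∩ O, r x = x) {x : F}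
    (hx : x ∈ M ∩ O) (w : F) : fderiv ℝ r x w ∈ tangentConeAt ℝ M x := by
  have h1 : HasFDerivWithinAt r (fderiv ℝ r x) O x :=
    ((hr.contDiffAt (hO.mem_nhds hx.2)).differentiableAt (by simp)).hasFDerivAt.hasFDerivWithinAt
  have h2 : w ∈ tangentConeAt ℝ O x := by
    rw [tangentConeAt_of_mem_nhds (hO.mem_nhds hx.2)]
    trivial
  have h3 := h1.mapsTo_tangent_cone h2
  rw [hid x hx] at h3
  exact tangentConeAt_mono ((image_subset_iff.2 hrM).trans inter_subset_left) h3

/-- Maps which are continuously differentiable on a local retract are locally Lipschitz there. -/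
theorem IsLocalRetract.locallyLipschitzOn {H G : Type*} [NormedAddCommGroup H] [NormedSpace ℝ H]
    [NormedAddCommGroup G] [NormedSpace ℝ G] {M : Set F} (hM : IsLocalRetract M)
    {f : H × F → G} (hf : ContDiffOn ℝ 1 f (univ ×ˢ M)) : LocallyLipschitzOn (univ ×ˢ M) f := by
  rintro ⟨h, p⟩ ⟨-, hp⟩
  obtain ⟨O, r, hO, hpO, hr, hrM, hid⟩ := hM p hp
  -- Precomposition with the retraction extends `f` to an open set, where continuous
  -- differentiability gives a local Lipschitz constant.
  have h1 : ContDiffOn ℝ 1 (fun y : H × F => f (y.1, r y.2)) (univ ×ˢ O) := by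
    refine hf.comp (contDiff_fst.contDiffOn.prodMk ?_) fun y hy => ⟨trivial, (hrM hy.2).1⟩
    exact (hr.of_le (by simp)).comp contDiff_snd.contDiffOn fun y hy => hy.2
  have h2 : ContDiffAt ℝ 1 (fun y : H × F => f (y.1, r y.2)) (h, p) :=
    h1.contDiffAt ((isOpen_univ.prod hO).mem_nhds ⟨trivial, hpO⟩)
  obtain ⟨L, t, ht, hL⟩ := h2.exists_lipschitzOnWith
  refine ⟨L, t ∩ univ ×ˢ (M ∩ O), ?_, ?_⟩
  · have h3 : (univ ×ˢ M) ∩ (t ∩ univ ×ˢ O) ∈ 𝓝[univ ×ˢ M] (h, p) :=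
      inter_mem_nhdsWithin _ (inter_mem ht ((isOpen_univ.prod hO).mem_nhds ⟨trivial, hpO⟩))
    filter_upwards [h3] with y hy
    exact ⟨hy.2.1, trivial, hy.1.2, hy.2.2.2⟩
  · intro y hy z hz
    have := hL hy.1 hz.1
    simpa only [hid _ hy.2.2, hid _ hz.2.2] using this

end Retract

/-! ### Two integral estimates: Grönwall and fast oscillation. -/

/-- Grönwall's inequality in integral form. -/
theorem le_mul_exp_of_le_add_integral {y : ℝ → ℝ} {a b c L : ℝ} (hc : 0 ≤ c) (hL : 0 ≤ L)
    (hy : ContinuousOn y (Icc a b)) (hy0 : ∀ t ∈ Icc a b, 0 ≤ y t)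
    (hle : ∀ t ∈ Icc a b, y t ≤ c + L * ∫ s in a..t, y s) :
    ∀ t ∈ Icc a b, y t ≤ c * Real.exp (L * (t - a)) := by
  intro t ht
  have hab : a ≤ b := ht.1.trans ht.2
  have hint : IntervalIntegrable y volume a b := (hy.mono (by rw [uIcc_of_le hab])).intervalIntegrable
  have hI0 : ∀ s ∈ Icc a b, 0 ≤ ∫ σ in a..s, y σ := fun s hs =>
    intervalIntegral.integral_nonneg hs.1 fun σ hσ => hy0 σ ⟨hσ.1, hσ.2.trans hs.2⟩
  have hY0 : ∀ s ∈ Icc a b, 0 ≤ c + L * ∫ σ in a..s, y σ := fun s hs =>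
    add_nonneg hc (mul_nonneg hL (hI0 s hs))
  have hd : ∀ s ∈ Icc a b, HasDerivWithinAt (fun s => c + L * ∫ σ in a..s, y σ) (L * y s)
      (Icc a b) s := by
    intro s hs
    have := Fact.mk hs
    have h1 : HasDerivWithinAt (fun s => ∫ σ in a..s, y σ) (y s) (Icc a b) s := by
      refine intervalIntegral.integral_hasDerivWithinAt_right
        (hint.mono_set (uIcc_subset_uIcc left_mem_uIcc (by rw [uIcc_of_le hab]; exact hs)))
        (hy.stronglyMeasurableAtFilter_nhdsWithin measurableSet_Icc s) (hy s hs)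
    exact (h1.const_mul L).const_add c
  -- Grönwall's inequality in differential form is applied to the right-hand side `c + L ∫ y`, since
  -- `y` itself need not be differentiable.
  have key := norm_le_gronwallBound_of_norm_deriv_right_le (δ := c) (K := L) (ε := 0)
    (fun s hs => (hd s hs).continuousWithinAt)
    (fun s hs => (hd s ⟨hs.1, hs.2.le⟩).mono_of_mem_nhdsWithin (Icc_mem_nhdsGE_of_mem hs))
    (by simp [abs_of_nonneg hc]) (fun s hs => by
      have hs' : s ∈ Icc a b := ⟨hs.1, hs.2.le⟩
      rw [add_zero, Real.norm_of_nonneg (mul_nonneg hL (hy0 s hs')),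
        Real.norm_of_nonneg (hY0 s hs')]
      exact mul_le_mul_of_nonneg_left (hle s hs') hL) t ht
  rw [gronwallBound_ε0, Real.norm_of_nonneg (hY0 t ht)] at key
  exact (hle t ht).trans key

/-- Integrals of rapidly oscillating periodic functions with zero mean along a Lipschitz curve
are small. -/
theorem norm_integral_periodic_le {E G : Type*} [NormedAddCommGroup E]
    [NormedAddCommGroup G] [NormedSpace ℝ G] [CompleteSpace G]
    {D : ℝ → E → G} {A : Set E} {T L B B' om a b : ℝ} {x : ℝ → E} (hT : 0 < T) (hom : 0 < om)
    (hL : 0 ≤ L) (hB' : 0 ≤ B')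
    (hper : ∀ τ, ∀ y ∈ A, D (τ + T) y = D τ y)
    (hcont : ∀ y ∈ A, Continuous fun τ => D τ y)
    (hmean : ∀ y ∈ A, ∫ τ in (0 : ℝ)..T, D τ y = 0)
    (hlip : ∀ τ, ∀ y ∈ A, ∀ z ∈ A, ‖D τ y - D τ z‖ ≤ L * ‖y - z‖)
    (hbd : ∀ τ, ∀ y ∈ A, ‖D τ y‖ ≤ B)
    (hxA : ∀ s ∈ Icc a b, x s ∈ A)
    (hx : ∀ s ∈ Icc a b, ∀ t ∈ Icc a b, ‖x s - x t‖ ≤ B' * |s - t|)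
    (hcx : ContinuousOn (fun s => D (om * s) (x s)) (Icc a b)) :
    ∀ t ∈ Icc a b, ‖∫ s in a..t, D (om * s) (x s)‖ ≤ (L * B' * T * (b - a) + B * T) / om := by
  intro t ht
  have hint : ∀ s ∈ Icc a b, ∀ t ∈ Icc a b,
      IntervalIntegrable (fun s => D (om * s) (x s)) volume s t := fun s hs t ht =>
    (hcx.mono (by
      rcases le_total s t with h | h
      · rw [uIcc_of_le h]; exact Icc_subset_Icc hs.1 ht.2
      · rw [uIcc_of_ge h]; exact Icc_subset_Icc ht.1 hs.2)).intervalIntegrable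
  set θ := T / om with hθ
  have hθ0 : 0 < θ := div_pos hT hom
  have hB : 0 ≤ B := (norm_nonneg _).trans (hbd 0 _ (hxA t ht))
  have hzero : ∀ s, ∀ y ∈ A, ∫ σ in s..(s + θ), D (om * σ) y = 0 := by
    intro s y hy
    rw [intervalIntegral.integral_comp_mul_left (fun σ => D σ y) hom.ne', mul_add,
      show om * θ = T by rw [hθ]; field_simp]
    have : Function.Periodic (fun τ => D τ y) T := fun τ => hper τ y hy
    rw [this.intervalIntegral_add_eq (om * s) 0, zero_add, hmean y hy, smul_zero]
  -- Over one period `θ = T / om` the curve is frozen at its initial point. The frozen integral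
  -- vanishes, and the error is at most `L * (B' * θ)` pointwise.
  have hblock : ∀ s, a ≤ s → s + θ ≤ b →
      ‖∫ σ in s..(s + θ), D (om * σ) (x σ)‖ ≤ L * B' * θ * θ := by
    intro s hs hsb
    have hsI : s ∈ Icc a b := ⟨hs, by linarith⟩
    have hci : IntervalIntegrable (fun σ => D (om * σ) (x s)) volume s (s + θ) :=
      ((hcont _ (hxA s hsI)).comp (continuous_const_mul om)).intervalIntegrable _ _
    have h1 : ∫ σ in s..(s + θ), D (om * σ) (x σ) =
        ∫ σ in s..(s + θ), (D (om * σ) (x σ) - D (om * σ) (x s)) := by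
      rw [intervalIntegral.integral_sub (hint _ hsI _ ⟨by linarith, hsb⟩) hci,
        hzero s _ (hxA s hsI), sub_zero]
    rw [h1]
    refine (intervalIntegral.norm_integral_le_of_norm_le_const (C := L * B' * θ)
      fun σ hσ => ?_).trans (by rw [add_sub_cancel_left, abs_of_pos hθ0])
    rw [uIoc_of_le (by linarith)] at hσ
    have hσI : σ ∈ Icc a b := ⟨by linarith [hσ.1], hσ.2.trans hsb⟩
    calc ‖D (om * σ) (x σ) - D (om * σ) (x s)‖ ≤ L * ‖x σ - x s‖ :=
          hlip _ _ (hxA σ hσI) _ (hxA s hsI)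
      _ ≤ L * (B' * θ) := by
          refine mul_le_mul_of_nonneg_left ((hx σ hσI s hsI).trans ?_) hL
          refine mul_le_mul_of_nonneg_left ?_ hB'
          rw [abs_of_nonneg (by linarith [hσ.1])]
          linarith [hσ.2]
      _ = L * B' * θ := by ring
  have hind : ∀ k : ℕ, a + k * θ ≤ b →
      ‖∫ s in a..(a + k * θ), D (om * s) (x s)‖ ≤ k * (L * B' * θ * θ) := by
    intro k
    induction k with
    | zero => simp
    | succ k ih =>
      intro hk
      push_cast at hk ⊢
      have hk' : a + k * θ + θ ≤ b := by linarith
      have hkθ : 0 ≤ (k : ℝ) * θ := by positivity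
      have e1 : a + (k + 1) * θ = a + k * θ + θ := by ring
      rw [e1, ← intervalIntegral.integral_add_adjacent_intervals (b := a + k * θ)
        (hint _ ⟨le_rfl, by linarith⟩ _ ⟨by linarith, by linarith⟩)
        (hint _ ⟨by linarith, by linarith⟩ _ ⟨by linarith, by linarith⟩)]
      refine (norm_add_le _ _).trans ?_
      linarith [ih (by linarith), hblock (a + k * θ) (by linarith) hk']
  -- There are `k ≤ (b - a) / θ` complete periods, each with an error of order `θ²`; the incomplete
  -- last period contributes at most `B * θ`.
  set k := ⌊(t - a) / θ⌋₊ with hk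
  have hk1 : (k : ℝ) * θ ≤ t - a := by
    rw [← le_div_iff₀ hθ0]
    exact Nat.floor_le (div_nonneg (by linarith [ht.1]) hθ0.le)
  have hk2 : t - a ≤ k * θ + θ := by
    have := (Nat.lt_floor_add_one ((t - a) / θ)).le
    rw [div_le_iff₀ hθ0] at this
    linarith
  have hkθ : 0 ≤ (k : ℝ) * θ := by positivity
  have hmid : a + k * θ ∈ Icc a b := ⟨by linarith, by linarith [ht.2]⟩
  rw [← intervalIntegral.integral_add_adjacent_intervals (b := a + k * θ)
    (hint _ ⟨le_rfl, ht.1.trans ht.2⟩ _ hmid) (hint _ hmid _ ht)]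
  have h2 : ‖∫ s in (a + k * θ)..t, D (om * s) (x s)‖ ≤ B * θ := by
    refine (intervalIntegral.norm_integral_le_of_norm_le_const (C := B) fun σ hσ => ?_).trans ?_
    · rw [uIoc_of_le (by linarith)] at hσ
      exact hbd _ _ (hxA σ ⟨by linarith [hσ.1, hmid.1], hσ.2.trans ht.2⟩)
    · rw [abs_of_nonneg (by linarith)]
      exact mul_le_mul_of_nonneg_left (by linarith) hB
  have h3 : (k : ℝ) * (L * B' * θ * θ) ≤ L * B' * θ * (b - a) := by
    have : (L * B' * θ) * (k * θ) ≤ (L * B' * θ) * (b - a) :=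
      mul_le_mul_of_nonneg_left (by linarith [ht.2]) (by positivity)
    linarith
  calc _ ≤ (k : ℝ) * (L * B' * θ * θ) + B * θ := (norm_add_le _ _).trans
        (add_le_add (hind k hmid.2) h2)
    _ ≤ L * B' * θ * (b - a) + B * θ := by linarith
    _ = (L * B' * T * (b - a) + B * T) / om := by rw [hθ]; ring

/-! ### Carathéodory solutions: restriction, concatenation, local existence. -/

section Solutions

variable {F : Type*} [NormedAddCommGroup F] [InnerProductSpace ℝ F] {M : Set F} {f : ℝ → F → F}
  {t₀ t₁ t₂ : ℝ} {x y : ℝ → F}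

theorem IsSolutionOn.mono {I J : Set ℝ} (hx : IsSolutionOn M f t₀ I x) (h : J ⊆ I) :
    IsSolutionOn M f t₀ J x := fun t ht => hx t (h ht)

theorem IsSolutionOn.congr (hx : IsSolutionOn M f t₀ (Icc t₀ t₁) x)
    (hxy : EqOn x y (Icc t₀ t₁)) : IsSolutionOn M f t₀ (Icc t₀ t₁) y := by
  intro t ht
  obtain ⟨h1, h2, h3⟩ := hx t ht
  have hsub : uIcc t₀ t ⊆ Icc t₀ t₁ := by
    rw [uIcc_of_le ht.1]; exact Icc_subset_Icc le_rfl ht.2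
  have he : EqOn (fun s => f s (x s)) (fun s => f s (y s)) (uIcc t₀ t) := fun s hs => by
    simp only [hxy (hsub hs)]
  refine ⟨hxy ht ▸ h1, h2.congr (he.mono uIoc_subset_uIcc), ?_⟩
  rw [← hxy ht, ← hxy (hsub left_mem_uIcc), ← intervalIntegral.integral_congr he]
  exact h3

theorem IsSolutionOn.continuousOn [CompleteSpace F] (hx : IsSolutionOn M f t₀ (Icc t₀ t₁) x) :
    ContinuousOn x (Icc t₀ t₁) := by
  rcases lt_or_ge t₁ t₀ with h | h
  · rw [Icc_eq_empty (not_le.2 h)]; exact continuousOn_empty _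
  have h1 := (hx t₁ ⟨h, le_rfl⟩).2.1
  have h2 := intervalIntegral.continuousOn_primitive_interval' h1 left_mem_uIcc
  rw [uIcc_of_le h] at h2
  exact (continuousOn_const.add h2).congr fun t ht => (hx t ht).2.2

/-- Solutions can be concatenated. -/
theorem IsSolutionOn.append (h01 : t₀ ≤ t₁) (hx : IsSolutionOn M f t₀ (Icc t₀ t₁) x)
    (hy : IsSolutionOn M f t₁ (Icc t₁ t₂) y) (hxy : y t₁ = x t₁) :
    IsSolutionOn M f t₀ (Icc t₀ t₂) (fun t => if t ≤ t₁ then x t else y t) := by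
  set z : ℝ → F := fun t => if t ≤ t₁ then x t else y t with hz
  have hzx : EqOn x z (Icc t₀ t₁) := fun t ht => by simp [hz, ht.2]
  have hzy : EqOn y z (Icc t₁ t₂) := fun t ht => by
    rcases ht.1.eq_or_lt with h | h
    · simp [hz, ← h, hxy]
    · simp [hz, not_le.2 h]
  have hx' := hx.congr hzx
  have hy' := hy.congr hzy
  intro t ht
  rcases le_total t t₁ with h | h
  · exact hx' t ⟨ht.1, h⟩
  · have h1 := hx' t₁ ⟨h01, le_rfl⟩
    have h2 := hy' t ⟨h, ht.2⟩
    refine ⟨h2.1, h1.2.1.trans h2.2.1, ?_⟩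
    rw [h2.2.2, h1.2.2, add_assoc, intervalIntegral.integral_add_adjacent_intervals h1.2.1 h2.2.1]

theorem IsSolutionOn.Ici_of_forall (hx : ∀ t₁, IsSolutionOn M f t₀ (Icc t₀ t₁) x) :
    IsSolutionOn M f t₀ (Ici t₀) x := fun t ht => hx t t ⟨ht, le_rfl⟩

end Solutions

/-- The Picard–Lindelöf theorem in integral form, with a solution that stays in the ball on which
the vector field is controlled. -/
theorem _root_.IsPicardLindelof.exists_eq_integral_mem_closedBall {E : Type*}
    [NormedAddCommGroup E] [NormedSpace ℝ E] [CompleteSpace E] {f : ℝ → E → E} {tmin tmax : ℝ}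
    {t₀ : Icc tmin tmax} {x₀ x : E} {a r L K : NNReal} (hf : IsPicardLindelof f t₀ x₀ a r L K)
    (hx : x ∈ Metric.closedBall x₀ r) :
    ∃ z : ℝ → E, Continuous z ∧ (∀ t, z t ∈ Metric.closedBall x₀ a) ∧
      ∀ t ∈ Icc tmin tmax, z t = x + ∫ s in (t₀ : ℝ)..t, f s (z s) := by
  obtain ⟨α, hα⟩ := ODE.FunSpace.exists_isFixedPt_next hf hx
  refine ⟨α.compProj, α.continuous_compProj, fun t => α.compProj_mem_closedBall hf.mul_max_le,
    fun t ht => ?_⟩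
  rw [ODE.FunSpace.compProj_of_mem ht]
  exact (ODE.FunSpace.isFixedPt_next_iff hf hx).1 hα ⟨t, ht⟩

/-! ### Well-posedness of oscillating systems on a local retract. -/

section Oscillating

variable {F : Type*} [NormedAddCommGroup F] [InnerProductSpace ℝ F]
  {H : Type*} [NormedAddCommGroup H] [NormedSpace ℝ H]

/-- A family of vector fields `Γ (h, ·)` on the local retract `M`, driven by a continuous periodic
signal `θ`. -/
structure IsOscillatingField (M : Set F) (Γ : H × F → F) (θ : ℝ → H) (T : ℝ) : Prop where
  isLocalRetract : IsLocalRetract M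
  contDiffOn : ContDiffOn ℝ 1 Γ (univ ×ˢ M)
  tangent : ∀ h, ∀ x ∈ M, Γ (h, x) ∈ tangentConeAt ℝ M x
  continuous : Continuous θ
  period_pos : 0 < T
  periodic : Function.Periodic θ T

variable {M : Set F} {Γ : H × F → F} {θ : ℝ → H} {T : ℝ}

namespace IsOscillatingField

theorem isCompact_range (hΓ : IsOscillatingField M Γ θ T) : IsCompact (range θ) :=
  hΓ.periodic.compact_of_continuous hΓ.period_pos.ne' hΓ.continuous

theorem exists_lipschitz (hΓ : IsOscillatingField M Γ θ T) {C : Set F} (hC : IsCompact C)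
    (hCM : C ⊆ M) : ∃ L : ℝ, 0 ≤ L ∧ ∀ τ, ∀ x ∈ C, ∀ y ∈ C,
      ‖Γ (θ τ, x) - Γ (θ τ, y)‖ ≤ L * ‖x - y‖ := by
  obtain ⟨L, hL⟩ := ((hΓ.isLocalRetract.locallyLipschitzOn hΓ.contDiffOn).mono
    (prod_mono (subset_univ (range θ)) hCM)).exists_lipschitzOnWith_of_compact
    (hΓ.isCompact_range.prod hC)
  refine ⟨L, L.2, fun τ x hx y hy => ?_⟩
  have := hL.dist_le_mul (θ τ, x) ⟨mem_range_self τ, hx⟩ (θ τ, y) ⟨mem_range_self τ, hy⟩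
  simpa [Prod.dist_eq, dist_eq_norm] using this

theorem exists_bound (hΓ : IsOscillatingField M Γ θ T) {C : Set F} (hC : IsCompact C)
    (hCM : C ⊆ M) : ∃ B : ℝ, 0 ≤ B ∧ ∀ τ, ∀ x ∈ C, ‖Γ (θ τ, x)‖ ≤ B := by
  obtain ⟨B, hB⟩ := (hΓ.isCompact_range.prod hC).exists_bound_of_continuousOn
    (hΓ.contDiffOn.continuousOn.mono (prod_mono (subset_univ _) hCM))
  exact ⟨max B 0, le_max_right _ _, fun τ x hx =>
    (hB (θ τ, x) ⟨mem_range_self τ, hx⟩).trans (le_max_left _ _)⟩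

theorem continuousOn_comp (hΓ : IsOscillatingField M Γ θ T) {x : ℝ → F} {I : Set ℝ} (om : ℝ)
    (hx : ContinuousOn x I) (hxM : MapsTo x I M) :
    ContinuousOn (fun s => Γ (θ (om * s), x s)) I :=
  hΓ.contDiffOn.continuousOn.comp
    ((hΓ.continuous.comp (continuous_const_mul om)).continuousOn.prodMk hx)
    fun _ hs => ⟨trivial, hxM hs⟩

/-- Solutions which start at the same point of `M` coincide. -/
theorem eqOn_of_isSolutionOn [CompleteSpace F] (hΓ : IsOscillatingField M Γ θ T) {om t₀ t₁ : ℝ}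
    {x y : ℝ → F} (hx : IsSolutionOn M (fun t x => Γ (θ (om * t), x)) t₀ (Icc t₀ t₁) x)
    (hy : IsSolutionOn M (fun t x => Γ (θ (om * t), x)) t₀ (Icc t₀ t₁) y) (hxy : x t₀ = y t₀) :
    EqOn x y (Icc t₀ t₁) := by
  have hxc := hx.continuousOn
  have hyc := hy.continuousOn
  -- Both trajectories together form a compact subset of `M`, so a single Lipschitz constant serves
  -- Grönwall's inequality with initial error `0`.
  obtain ⟨L, hL0, hL⟩ := hΓ.exists_lipschitz (C := x '' Icc t₀ t₁ ∪ y '' Icc t₀ t₁)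
    ((isCompact_Icc.image_of_continuousOn hxc).union (isCompact_Icc.image_of_continuousOn hyc))
    (union_subset (image_subset_iff.2 fun t ht => (hx t ht).1)
      (image_subset_iff.2 fun t ht => (hy t ht).1))
  intro t ht
  have key := le_mul_exp_of_le_add_integral (y := fun s => ‖x s - y s‖) (a := t₀) (b := t₁)
    le_rfl hL0 (hxc.sub hyc).norm (fun _ _ => norm_nonneg _) (fun s hs => ?_) t ht
  · rw [zero_mul] at key
    exact sub_eq_zero.1 (norm_le_zero_iff.1 key)
  · have hsub : uIcc t₀ s ⊆ Icc t₀ t₁ := by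
      rw [uIcc_of_le hs.1]; exact Icc_subset_Icc le_rfl hs.2
    rw [(hx s hs).2.2, (hy s hs).2.2, hxy, add_sub_add_left_eq_sub,
      ← intervalIntegral.integral_sub (hx s hs).2.1 (hy s hs).2.1, zero_add,
      ← intervalIntegral.integral_const_mul]
    refine intervalIntegral.norm_integral_le_of_norm_le hs.1 (Eventually.of_forall fun σ hσ => ?_)
      (((hxc.sub hyc).norm.mono hsub).intervalIntegrable.const_mul L)
    have hσ' : σ ∈ Icc t₀ t₁ := ⟨hσ.1.le, hσ.2.trans hs.2⟩
    exact hL _ _ (Or.inl (mem_image_of_mem x hσ')) _ (Or.inr (mem_image_of_mem y hσ'))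

/-- Local existence of solutions in `M`, uniformly in the initial value and in time. -/
theorem exists_local_solution [FiniteDimensional ℝ F] (hΓ : IsOscillatingField M Γ θ T) {p : F}
    (hp : p ∈ M) {η : ℝ} (hη : 0 < η) :
    ∃ ρ > 0, ∃ τ₀ > 0, ∀ om t₀ : ℝ, ∀ x ∈ M, dist x p ≤ ρ → ∃ z : ℝ → F, z t₀ = x ∧
      IsSolutionOn M (fun t x => Γ (θ (om * t), x)) t₀ (Icc t₀ (t₀ + τ₀)) z ∧
      ∀ t ∈ Icc t₀ (t₀ + τ₀), dist (z t) p ≤ η := by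
  have : ProperSpace F := FiniteDimensional.proper ℝ F
  have : CompleteSpace F := FiniteDimensional.complete ℝ F
  obtain ⟨O, r, hO, hpO, hr, hrM, hid⟩ := hΓ.isLocalRetract p hp
  obtain ⟨s, hs, hsO⟩ := Metric.nhds_basis_closedBall.mem_iff.1 (hO.mem_nhds hpO)
  have hrc : ContinuousAt r p := hr.continuousOn.continuousAt (hO.mem_nhds hpO)
  -- On a small ball both `x` and `r x` lie in the closed ball of radius `s`, which is contained in
  -- `O` and convex; there the derivative of `r` will be Lipschitz.
  have hmem : r ⁻¹' Metric.closedBall p s ∩ Metric.closedBall p (min s η) ∈ 𝓝 p := by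
    refine inter_mem (hrc ?_) (Metric.closedBall_mem_nhds p (lt_min hs hη))
    rw [hid p ⟨hp, hpO⟩]
    exact Metric.closedBall_mem_nhds p hs
  obtain ⟨s', hs', hss'⟩ := Metric.nhds_basis_closedBall.mem_iff.1 hmem
  have hsub : Metric.closedBall p s' ⊆ O := fun x hx =>
    hsO (Metric.closedBall_subset_closedBall (min_le_left _ _) (hss' hx).2)
  -- the extended vector field
  have hV : ContDiffOn ℝ 1 (fun y : H × F => Γ (y.1, r y.2)) (univ ×ˢ O) :=
    hΓ.contDiffOn.comp (contDiff_fst.contDiffOn.prodMk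
      ((hr.of_le (by simp)).comp contDiff_snd.contDiffOn fun y hy => hy.2))
      fun y hy => ⟨trivial, (hrM hy.2).1⟩
  have hVl : LocallyLipschitzOn (univ ×ˢ O) (fun y : H × F => Γ (y.1, r y.2)) := by
    intro y hy
    obtain ⟨L, t, ht, hL⟩ := (hV.contDiffAt
      ((isOpen_univ.prod hO).mem_nhds hy)).exists_lipschitzOnWith
    exact ⟨L, t, mem_nhdsWithin_of_mem_nhds ht, hL⟩
  have hsub' : range θ ×ˢ Metric.closedBall p s' ⊆ univ ×ˢ O :=
    prod_mono (subset_univ _) hsub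
  have hcomp := hΓ.isCompact_range.prod (isCompact_closedBall p s')
  obtain ⟨L, hL⟩ := (hVl.mono hsub').exists_lipschitzOnWith_of_compact hcomp
  obtain ⟨B₀, hB₀⟩ := hcomp.exists_bound_of_continuousOn (hV.continuousOn.mono hsub')
  obtain ⟨B, hB, hB0⟩ : ∃ B : NNReal, (∀ τ, ∀ x ∈ Metric.closedBall p s', ‖Γ (θ τ, r x)‖ ≤ B) ∧
      (0 : ℝ) < B :=
    ⟨⟨max B₀ 1, le_max_of_le_right zero_le_one⟩, fun τ x hx =>
      (hB₀ (θ τ, x) ⟨mem_range_self τ, hx⟩).trans (le_max_left _ _),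
      lt_max_of_lt_right zero_lt_one⟩
  -- the derivative of the retraction is Lipschitz
  have hdr : ContDiffOn ℝ 1 (fderiv ℝ r) O := hr.fderiv_of_isOpen hO (by norm_cast)
  obtain ⟨LD, hLD⟩ := (hdr.mono hsO).exists_lipschitzOnWith (by simp)
    (convex_closedBall p s) (isCompact_closedBall p s)
  -- At speed at most `B`, a solution that starts within `s' / 2` of `p` stays within `s'` during
  -- this time.
  set τ₀ : ℝ := s' / 2 / B with hτ₀
  have hτ₀0 : 0 < τ₀ := by positivity
  refine ⟨s' / 2, by positivity, τ₀, hτ₀0, fun om t₀ x hxM hxp => ?_⟩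
  set v : ℝ → F → F := fun t y => Γ (θ (om * t), r y) with hv
  have hpl : IsPicardLindelof v (⟨t₀, le_rfl, by linarith⟩ : Icc t₀ (t₀ + τ₀)) p
      ⟨s', hs'.le⟩ ⟨s' / 2, by positivity⟩ B L := by
    refine ⟨fun t _ => ?_, fun y hy => ?_, fun t _ y hy => hB _ y hy, ?_⟩
    · refine LipschitzOnWith.of_dist_le_mul fun y hy z hz => ?_
      have := hL.dist_le_mul (θ (om * t), y) ⟨mem_range_self _, hy⟩ (θ (om * t), z)
        ⟨mem_range_self _, hz⟩
      simpa [Prod.dist_eq] using this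
    · exact hV.continuousOn.comp ((hΓ.continuous.comp
        (continuous_const_mul om)).prodMk continuous_const).continuousOn
        fun t _ => ⟨trivial, hsub hy⟩
    · change (B : ℝ) * max (t₀ + τ₀ - t₀) (t₀ - t₀) ≤ s' - s' / 2
      rw [add_sub_cancel_left, sub_self, max_eq_left hτ₀0.le, hτ₀]
      field_simp
      linarith
  obtain ⟨z, hzc, hzb, hzi⟩ := hpl.exists_eq_integral_mem_closedBall (x := x) hxp
  replace hzb : ∀ t, z t ∈ Metric.closedBall p s' := hzb
  replace hzi : ∀ t ∈ Icc t₀ (t₀ + τ₀), z t = x + ∫ σ in t₀..t, v σ (z σ) := hzi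
  have hz0 : z t₀ = x := by
    rw [hzi t₀ ⟨le_rfl, by linarith⟩]; simp
  have hvc : Continuous fun t => v t (z t) :=
    hV.continuousOn.comp_continuous ((hΓ.continuous.comp (continuous_const_mul om)).prodMk
      hzc) fun t => ⟨trivial, hsub (hzb t)⟩
  have hzd : ∀ t ∈ Ico t₀ (t₀ + τ₀), HasDerivWithinAt z (v t (z t)) (Ici t) t := by
    intro t ht
    have h1 : HasDerivAt (fun t => x + ∫ σ in t₀..t, v σ (z σ)) (v t (z t)) t :=
      (intervalIntegral.integral_hasDerivAt_right (hvc.intervalIntegrable _ _)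
        (hvc.stronglyMeasurableAtFilter _ _) hvc.continuousAt).const_add x
    refine (h1.hasDerivWithinAt (s := Icc t₀ (t₀ + τ₀)) |>.congr hzi
      (hzi t ⟨ht.1, ht.2.le⟩)).mono_of_mem_nhdsWithin (Icc_mem_nhdsGE_of_mem ht)
  -- The ambient solution stays in `M`. The extended field at `z` is tangent to `M` at `r z`, hence
  -- fixed by the derivative of `r` at `r z`. So the derivative of `z - r z` is governed by the
  -- difference of the derivatives of `r` at `r z` and at `z`, which is at most `LD * ‖z - r z‖`,
  -- and Grönwall's inequality gives `z = r z`.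
  have hzr : ∀ t ∈ Icc t₀ (t₀ + τ₀), z t - r (z t) = 0 := by
    refine eq_zero_of_abs_deriv_le_mul_abs_self_of_eq_zero_right (K := LD * B)
      (f' := fun t => v t (z t) - fderiv ℝ r (z t) (v t (z t))) ?_ ?_ ?_ ?_
    · exact (hzc.sub (hr.continuousOn.comp_continuous hzc fun t => hsub (hzb t))).continuousOn
    · intro t ht
      have h1 : HasFDerivAt r (fderiv ℝ r (z t)) (z t) :=
        ((hr.contDiffAt (hO.mem_nhds (hsub (hzb t)))).differentiableAt (by simp)).hasFDerivAt
      exact (hzd t ht).sub (h1.comp_hasDerivWithinAt t (hzd t ht))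
    · rw [hz0, hid x ⟨hxM, hsub ?_⟩, sub_self]
      rw [← hz0]; exact hzb t₀
    · intro t ht
      have hzO := hsub (hzb t)
      have h1 : fderiv ℝ r (r (z t)) (v t (z t)) = v t (z t) :=
        fderiv_retraction_apply_of_mem_tangentConeAt hO hr hid (hrM hzO)
          (hΓ.tangent _ _ (hrM hzO).1)
      have h2 := hLD.dist_le_mul (r (z t)) (hss' (hzb t)).1 (z t)
        (Metric.closedBall_subset_closedBall (min_le_left _ _) (hss' (hzb t)).2)
      rw [dist_eq_norm, dist_comm, dist_eq_norm] at h2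
      calc ‖v t (z t) - fderiv ℝ r (z t) (v t (z t))‖
          = ‖(fderiv ℝ r (r (z t)) - fderiv ℝ r (z t)) (v t (z t))‖ := by
            rw [sub_apply, h1]
        _ ≤ LD * ‖z t - r (z t)‖ * B :=
            (ContinuousLinearMap.le_opNorm _ _).trans (mul_le_mul h2 (hB _ _ (hzb t))
              (norm_nonneg _) (by positivity))
        _ = LD * B * ‖z t - r (z t)‖ := by ring
  have hzM : ∀ t ∈ Icc t₀ (t₀ + τ₀), r (z t) = z t := fun t ht => (sub_eq_zero.1 (hzr t ht)).symm
  refine ⟨z, hz0, fun t ht => ?_, fun t ht =>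
    (hss' (hzb t)).2.trans (min_le_right _ _)⟩
  have he : EqOn (fun σ => v σ (z σ)) (fun σ => Γ (θ (om * σ), z σ)) (uIcc t₀ t) := fun σ hσ => by
    rw [uIcc_of_le ht.1] at hσ
    simp only [hv, hzM σ ⟨hσ.1, hσ.2.trans ht.2⟩]
  refine ⟨?_, (hvc.intervalIntegrable _ _).congr (he.mono uIoc_subset_uIcc), ?_⟩
  · rw [← hzM t ht]; exact (hrM (hsub (hzb t))).1
  · rw [hz0, ← intervalIntegral.integral_congr he]
    exact hzi t ht

/-- Local existence of solutions, uniformly on compact sets. -/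
theorem exists_uniform_local_solution [FiniteDimensional ℝ F] (hΓ : IsOscillatingField M Γ θ T)
    {C : Set F} (hC : IsCompact C) (hCM : C ⊆ M) {η : ℝ} (hη : 0 < η) :
    ∃ τ₀ > 0, ∀ om t₀ : ℝ, ∀ x ∈ C, ∃ z : ℝ → F, z t₀ = x ∧
      IsSolutionOn M (fun t x => Γ (θ (om * t), x)) t₀ (Icc t₀ (t₀ + τ₀)) z ∧
      ∀ t ∈ Icc t₀ (t₀ + τ₀), dist (z t) x ≤ η := by
  refine hC.induction_on (p := fun C' => ∃ τ₀ > 0, ∀ om t₀ : ℝ, ∀ x ∈ C', ∃ z : ℝ → F, z t₀ = x ∧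
      IsSolutionOn M (fun t x => Γ (θ (om * t), x)) t₀ (Icc t₀ (t₀ + τ₀)) z ∧
      ∀ t ∈ Icc t₀ (t₀ + τ₀), dist (z t) x ≤ η) ⟨1, one_pos, fun _ _ _ h => h.elim⟩ ?_ ?_ ?_
  · rintro s t hst ⟨τ₀, h0, h⟩
    exact ⟨τ₀, h0, fun om t₀ x hx => h om t₀ x (hst hx)⟩
  · rintro s t ⟨τ₁, h1, hs⟩ ⟨τ₂, h2, ht⟩
    refine ⟨min τ₁ τ₂, lt_min h1 h2, fun om t₀ x hx => ?_⟩
    rcases hx with hx | hx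
    · obtain ⟨z, hz0, hz, hzd⟩ := hs om t₀ x hx
      have hsub : Icc t₀ (t₀ + min τ₁ τ₂) ⊆ Icc t₀ (t₀ + τ₁) :=
        Icc_subset_Icc le_rfl (by gcongr; exact min_le_left _ _)
      exact ⟨z, hz0, hz.mono hsub, fun t ht => hzd t (hsub ht)⟩
    · obtain ⟨z, hz0, hz, hzd⟩ := ht om t₀ x hx
      have hsub : Icc t₀ (t₀ + min τ₁ τ₂) ⊆ Icc t₀ (t₀ + τ₂) :=
        Icc_subset_Icc le_rfl (by gcongr; exact min_le_right _ _)
      exact ⟨z, hz0, hz.mono hsub, fun t ht => hzd t (hsub ht)⟩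
  · intro p hp
    obtain ⟨ρ, hρ, τ₀, hτ₀, h⟩ := hΓ.exists_local_solution (hCM hp) (half_pos hη)
    refine ⟨C ∩ Metric.closedBall p (min ρ (η / 2)),
      inter_mem_nhdsWithin _ (Metric.closedBall_mem_nhds p (lt_min hρ (half_pos hη))), τ₀, hτ₀,
      fun om t₀ x hx => ?_⟩
    obtain ⟨z, hz0, hz, hzd⟩ := h om t₀ x (hCM hx.1) (hx.2.trans (min_le_left _ _))
    refine ⟨z, hz0, hz, fun t ht => ?_⟩
    have h1 := hzd t ht
    have h2 : dist x p ≤ η / 2 := hx.2.trans (min_le_right _ _)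
    linarith [dist_triangle_right (z t) x p]

end IsOscillatingField

end Oscillating

/-! ### First-order averaging on bounded time intervals. -/

section Averaging

variable {F : Type*} [NormedAddCommGroup F] [InnerProductSpace ℝ F]
  {H : Type*} [NormedAddCommGroup H] [NormedSpace ℝ H]
  {M : Set F} {Γ : H × F → F} {θ : ℝ → H} {T : ℝ} {g : F → F}

theorem IsSolutionOn.norm_sub_le {f : ℝ → F → F} {t₀ t₁ B : ℝ} {x : ℝ → F}
    (hx : IsSolutionOn M f t₀ (Icc t₀ t₁) x) (hB : ∀ s ∈ Icc t₀ t₁, ‖f s (x s)‖ ≤ B)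
    {s t : ℝ} (hs : s ∈ Icc t₀ t₁) (ht : t ∈ Icc t₀ t₁) : ‖x s - x t‖ ≤ B * |s - t| := by
  rw [(hx s hs).2.2, (hx t ht).2.2, add_sub_add_left_eq_sub,
    intervalIntegral.integral_interval_sub_left (hx s hs).2.1 (hx t ht).2.1]
  refine intervalIntegral.norm_integral_le_of_norm_le_const fun σ hσ => hB σ ?_
  have := uIoc_subset_uIcc hσ
  rw [mem_uIcc] at this
  rcases this with h | h
  · exact ⟨ht.1.trans h.1, h.2.trans hs.2⟩
  · exact ⟨hs.1.trans h.1, h.2.trans ht.2⟩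

namespace IsOscillatingField

theorem continuous_apply (hΓ : IsOscillatingField M Γ θ T) {x : F} (hx : x ∈ M) :
    Continuous fun τ => Γ (θ τ, x) :=
  hΓ.contDiffOn.continuousOn.comp_continuous (hΓ.continuous.prodMk continuous_const)
    fun _ => ⟨trivial, hx⟩

theorem norm_average_sub_le (hΓ : IsOscillatingField M Γ θ T)
    (hg : ∀ x ∈ M, g x = (1 / T) • ∫ τ in (0 : ℝ)..T, Γ (θ τ, x)) {x y : F} (hx : x ∈ M)
    (hy : y ∈ M) {c : ℝ} (hc : ∀ τ, ‖Γ (θ τ, x) - Γ (θ τ, y)‖ ≤ c) : ‖g x - g y‖ ≤ c := by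
  have hT := hΓ.period_pos
  rw [hg x hx, hg y hy, ← smul_sub, ← intervalIntegral.integral_sub
    ((hΓ.continuous_apply hx).intervalIntegrable _ _)
    ((hΓ.continuous_apply hy).intervalIntegrable _ _), norm_smul,
    Real.norm_of_nonneg (by positivity)]
  have h1 := intervalIntegral.norm_integral_le_of_norm_le_const (a := 0) (b := T) (C := c)
    (f := fun τ => Γ (θ τ, x) - Γ (θ τ, y)) fun τ _ => hc τ
  rw [sub_zero, abs_of_pos hT] at h1
  calc 1 / T * _ ≤ 1 / T * (c * T) := mul_le_mul_of_nonneg_left h1 (by positivity)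
    _ = c := by field_simp

theorem norm_average_le (hΓ : IsOscillatingField M Γ θ T)
    (hg : ∀ x ∈ M, g x = (1 / T) • ∫ τ in (0 : ℝ)..T, Γ (θ τ, x)) {x : F} (hx : x ∈ M)
    {c : ℝ} (hc : ∀ τ, ‖Γ (θ τ, x)‖ ≤ c) : ‖g x‖ ≤ c := by
  have hT := hΓ.period_pos
  rw [hg x hx, norm_smul, Real.norm_of_nonneg (by positivity)]
  have h1 := intervalIntegral.norm_integral_le_of_norm_le_const (a := 0) (b := T) (C := c)
    (f := fun τ => Γ (θ τ, x)) fun τ _ => hc τ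
  rw [sub_zero, abs_of_pos hT] at h1
  calc 1 / T * _ ≤ 1 / T * (c * T) := mul_le_mul_of_nonneg_left h1 (by positivity)
    _ = c := by field_simp

/-- On a compact set, solutions of the oscillating system are `O(1 / ω)`-close to solutions of the
averaged system. -/
theorem exists_averaging_estimate [CompleteSpace F] (hΓ : IsOscillatingField M Γ θ T)
    (hg : ∀ x ∈ M, g x = (1 / T) • ∫ τ in (0 : ℝ)..T, Γ (θ τ, x)) {C : Set F} (hC : IsCompact C)
    (hCM : C ⊆ M) {Δ : ℝ} (hΔ : 0 ≤ Δ) :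
    ∃ c : ℝ, 0 ≤ c ∧ ∀ om > 0, ∀ t₀ t₁ : ℝ, t₁ ≤ t₀ + Δ → ∀ x z : ℝ → F,
      IsSolutionOn M (fun _ => g) t₀ (Icc t₀ t₁) x →
      IsSolutionOn M (fun t x => Γ (θ (om * t), x)) t₀ (Icc t₀ t₁) z → z t₀ = x t₀ →
      (∀ t ∈ Icc t₀ t₁, x t ∈ C) → (∀ t ∈ Icc t₀ t₁, z t ∈ C) →
      ∀ t ∈ Icc t₀ t₁, dist (z t) (x t) ≤ c / om := by
  obtain ⟨L, hL0, hL⟩ := hΓ.exists_lipschitz hC hCM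
  obtain ⟨B, hB0, hB⟩ := hΓ.exists_bound hC hCM
  have hT := hΓ.period_pos
  have hgL : ∀ x ∈ C, ∀ y ∈ C, ‖g x - g y‖ ≤ L * ‖x - y‖ := fun x hx y hy =>
    hΓ.norm_average_sub_le hg (hCM hx) (hCM hy) fun τ => hL τ x hx y hy
  have hgB : ∀ x ∈ C, ‖g x‖ ≤ B := fun x hx =>
    hΓ.norm_average_le hg (hCM hx) fun τ => hB τ x hx
  have hgc : ContinuousOn g C := by
    refine (LipschitzOnWith.of_dist_le_mul (K := ⟨L, hL0⟩) fun x hx y hy => ?_).continuousOn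
    rw [dist_eq_norm, dist_eq_norm]
    exact hgL x hx y hy
  have hc0 : 0 ≤ (L + L) * B * T * Δ + (B + B) * T := by positivity
  refine ⟨((L + L) * B * T * Δ + (B + B) * T) * Real.exp (L * Δ), by positivity, ?_⟩
  intro om hom t₀ t₁ h01 x z hx hz hzx hxC hzC t ht
  have hxc := hx.continuousOn
  have hzc := hz.continuousOn
  have hsub : ∀ s ∈ Icc t₀ t₁, uIcc t₀ s ⊆ Icc t₀ t₁ := fun s hs => by
    rw [uIcc_of_le hs.1]; exact Icc_subset_Icc le_rfl hs.2
  have hΓx : ContinuousOn (fun s => Γ (θ (om * s), x s)) (Icc t₀ t₁) :=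
    hΓ.continuousOn_comp om hxc fun s hs => hCM (hxC s hs)
  have hΓz : ContinuousOn (fun s => Γ (θ (om * s), z s)) (Icc t₀ t₁) :=
    hΓ.continuousOn_comp om hzc fun s hs => hCM (hzC s hs)
  have hgx : ContinuousOn (fun s => g (x s)) (Icc t₀ t₁) := hgc.comp hxc hxC
  -- The deviation `Γ - g` of the field from its mean has zero mean. It is integrated along the
  -- averaged solution, whose speed is at most `B` for every frequency.
  have hosc := norm_integral_periodic_le (D := fun τ y => Γ (θ τ, y) - g y) (A := C) (x := x)
    (a := t₀) (b := t₁) (om := om) (L := L + L) (B := B + B) (B' := B) hT hom (by positivity) hB0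
    (fun τ y _ => by simp only [hΓ.periodic τ])
    (fun y hy => (hΓ.continuous_apply (hCM hy)).sub continuous_const)
    (fun y hy => by
      rw [intervalIntegral.integral_sub
        ((hΓ.continuous_apply (hCM hy)).intervalIntegrable _ _) intervalIntegrable_const,
        intervalIntegral.integral_const, hg y (hCM hy), sub_zero, smul_smul,
        mul_one_div_cancel hT.ne', one_smul, sub_self])
    (fun τ y hy w hw => by
      rw [sub_sub_sub_comm, add_mul]
      exact (norm_sub_le _ _).trans (add_le_add (hL τ y hy w hw) (hgL y hy w hw)))
    (fun τ y hy => (norm_sub_le _ _).trans (add_le_add (hB τ y hy) (hgB y hy)))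
    hxC (fun s hs t ht => hx.norm_sub_le (fun σ hσ => hgB _ (hxC σ hσ)) hs ht)
    (hΓx.sub hgx)
  have key := le_mul_exp_of_le_add_integral (y := fun s => ‖z s - x s‖) (a := t₀) (b := t₁)
    (c := ((L + L) * B * T * Δ + (B + B) * T) / om) (div_nonneg hc0 hom.le) hL0 (hzc.sub hxc).norm
    (fun _ _ => norm_nonneg _) (fun s hs => ?_) t ht
  · rw [dist_eq_norm]
    refine key.trans ?_
    rw [div_mul_eq_mul_div]
    have : L * (t - t₀) ≤ L * Δ := mul_le_mul_of_nonneg_left (by linarith [ht.2]) hL0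
    gcongr
  · have hii : ∀ {w : ℝ → F}, ContinuousOn w (Icc t₀ t₁) → IntervalIntegrable w volume t₀ s :=
      fun hw => (hw.mono (hsub s hs)).intervalIntegrable
    -- The first integral compares the same field along the two solutions and is absorbed by
    -- Grönwall's inequality; the second is the oscillatory one, of order `1 / om`.
    have e1 : z s - x s = (∫ σ in t₀..s, (Γ (θ (om * σ), z σ) - Γ (θ (om * σ), x σ))) +
        ∫ σ in t₀..s, (Γ (θ (om * σ), x σ) - g (x σ)) := by
      rw [intervalIntegral.integral_sub (hii hΓz) (hii hΓx),
        intervalIntegral.integral_sub (hii hΓx) (hii hgx), (hz s hs).2.2, (hx s hs).2.2, hzx]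
      abel
    have h1 : ‖∫ σ in t₀..s, (Γ (θ (om * σ), z σ) - Γ (θ (om * σ), x σ))‖ ≤
        L * ∫ σ in t₀..s, ‖z σ - x σ‖ := by
      rw [← intervalIntegral.integral_const_mul]
      refine intervalIntegral.norm_integral_le_of_norm_le hs.1
        (Eventually.of_forall fun σ hσ => ?_)
        ((((hzc.sub hxc).norm).mono (hsub s hs)).intervalIntegrable.const_mul L)
      have hσ' : σ ∈ Icc t₀ t₁ := ⟨hσ.1.le, hσ.2.trans hs.2⟩
      exact hL _ _ (hzC σ hσ') _ (hxC σ hσ')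
    have h2 : ((L + L) * B * T * (t₁ - t₀) + (B + B) * T) / om ≤
        ((L + L) * B * T * Δ + (B + B) * T) / om := by
      have : t₁ - t₀ ≤ Δ := by linarith
      gcongr
    simp only [e1]
    linarith [norm_add_le (∫ σ in t₀..s, (Γ (θ (om * σ), z σ) - Γ (θ (om * σ), x σ)))
      (∫ σ in t₀..s, (Γ (θ (om * σ), x σ) - g (x σ))), hosc s hs]

/-- Solutions of the oscillating system exist as long as the averaged solution stays in a compact
set, and are close to it. -/
theorem exists_solution_near_average [FiniteDimensional ℝ F] (hΓ : IsOscillatingField M Γ θ T)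
    (hg : ∀ x ∈ M, g x = (1 / T) • ∫ τ in (0 : ℝ)..T, Γ (θ τ, x)) {C : Set F} (hC : IsCompact C)
    (hCM : C ⊆ M) {Δ ε : ℝ} (hΔ : 0 < Δ) (hε : 0 < ε) :
    ∃ om₀ > 0, ∀ om ≥ om₀, ∀ (t₀ : ℝ) (x : ℝ → F),
      IsSolutionOn M (fun _ => g) t₀ (Icc t₀ (t₀ + Δ)) x →
      (∀ t ∈ Icc t₀ (t₀ + Δ), x t ∈ C) →
      ∃ z : ℝ → F, z t₀ = x t₀ ∧
        IsSolutionOn M (fun t x => Γ (θ (om * t), x)) t₀ (Icc t₀ (t₀ + Δ)) z ∧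
        ∀ t ∈ Icc t₀ (t₀ + Δ), dist (z t) (x t) ≤ ε := by
  have : ProperSpace F := FiniteDimensional.proper ℝ F
  have : CompleteSpace F := FiniteDimensional.complete ℝ F
  obtain ⟨ε₀, hε₀, hcpt⟩ :=
    hΓ.isLocalRetract.isLocallyClosed.exists_isCompact_cthickening hC hCM
  set ε₁ := min ε ε₀ with hε₁
  have hε₁0 : 0 < ε₁ := lt_min hε hε₀
  have hC₁ := hcpt ε₁ (min_le_right _ _)
  have hC₂ := hcpt (ε₁ / 2) (by linarith [min_le_right ε ε₀])
  obtain ⟨τ₀, hτ₀, hloc⟩ := hΓ.exists_uniform_local_solution hC₂ inter_subset_left (half_pos hε₁0)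
  obtain ⟨c, hc0, hest⟩ := hΓ.exists_averaging_estimate hg hC₁ inter_subset_left hΔ.le
  obtain ⟨m, hm⟩ := exists_nat_gt (Δ / τ₀)
  have hm0 : (0 : ℝ) < m := (div_pos hΔ hτ₀).trans hm
  set τ := Δ / m with hτ
  have hτ0 : 0 < τ := div_pos hΔ hm0
  have hττ₀ : τ ≤ τ₀ := by
    rw [hτ, div_le_iff₀ hm0]
    rw [div_lt_iff₀ hτ₀] at hm
    linarith
  have hmτ : m * τ = Δ := by rw [hτ]; field_simp
  have hmem : ∀ {y w : F} {δ : ℝ}, w ∈ C → y ∈ M → dist y w ≤ δ → y ∈ M ∩ Metric.cthickening δ C :=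
    fun hw hy hd => ⟨hy, Metric.mem_cthickening_of_dist_le _ _ _ _ hw hd⟩
  -- This threshold makes the averaging error `c / om` at most `ε₁ / 2`.
  refine ⟨2 * c / ε₁ + 1, by positivity, fun om hom t₀ x hx hxC => ?_⟩
  have hom0 : 0 < om := lt_of_lt_of_le (by positivity) hom
  have hcom : c / om ≤ ε₁ / 2 := by
    rw [div_le_iff₀ hom0]
    have : 2 * c / ε₁ ≤ om := by linarith
    rw [div_le_iff₀ hε₁0] at this
    linarith
  -- Continuation in steps of length `τ ≤ τ₀`. On a new piece the crude bound `ε₁ / 2 + ε₁ / 2`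
  -- keeps the solution in the compact `ε₁`-thickening of `C`. The averaging estimate, always taken
  -- from the initial time `t₀`, then restores `ε₁ / 2`, so errors do not accumulate.
  have hind : ∀ k : ℕ, k ≤ m → ∃ z : ℝ → F, z t₀ = x t₀ ∧
      IsSolutionOn M (fun t x => Γ (θ (om * t), x)) t₀ (Icc t₀ (t₀ + k * τ)) z ∧
      ∀ t ∈ Icc t₀ (t₀ + k * τ), dist (z t) (x t) ≤ ε₁ / 2 := by
    intro k
    induction k with
    | zero =>
      refine fun _ => ⟨x, rfl, fun t ht => ?_, fun t ht => by rw [dist_self]; positivity⟩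
      have : t = t₀ := le_antisymm (by simpa using ht.2) ht.1
      subst this
      exact ⟨(hx t ⟨le_rfl, by linarith⟩).1, by simp, by simp⟩
    | succ k ih =>
      intro hk
      obtain ⟨z, hz0, hz, hzd⟩ := ih (Nat.le_of_succ_le hk)
      have hkτ : (0 : ℝ) ≤ k * τ := by positivity
      have hk' : ((k : ℝ) + 1) * τ ≤ Δ := by
        rw [← hmτ]
        have : ((k : ℝ) + 1) ≤ m := by exact_mod_cast hk
        gcongr
      have hsub : Icc t₀ (t₀ + ((k : ℝ) + 1) * τ) ⊆ Icc t₀ (t₀ + Δ) :=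
        Icc_subset_Icc le_rfl (by linarith)
      set t₁ := t₀ + k * τ with ht₁
      have h01 : t₀ ≤ t₁ := by linarith
      have hend : t₀ + ((k : ℝ) + 1) * τ = t₁ + τ := by rw [ht₁]; ring
      have ht₁m : t₁ ∈ Icc t₀ t₁ := ⟨h01, le_rfl⟩
      have hxt₁ := hxC t₁ (hsub ⟨h01, by rw [hend]; linarith⟩)
      have hzC₂ : z t₁ ∈ M ∩ Metric.cthickening (ε₁ / 2) C :=
        hmem hxt₁ (hz t₁ ht₁m).1 (hzd t₁ ht₁m)
      obtain ⟨w, hw0, hw, hwd⟩ := hloc om t₁ (z t₁) hzC₂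
      have hw' := hw.mono (Icc_subset_Icc le_rfl (by linarith : t₁ + τ ≤ t₁ + τ₀))
      have happ := hz.append h01 hw' hw0
      push_cast
      rw [hend] at hsub ⊢
      refine ⟨_, ?_, happ, ?_⟩
      · simp only [h01, if_true, hz0]
      · have hnear : ∀ t ∈ Icc t₀ (t₁ + τ),
            (if t ≤ t₁ then z t else w t) ∈ M ∩ Metric.cthickening ε₁ C := by
          intro t ht
          refine ⟨(happ t ht).1, ?_⟩
          split_ifs with h
          · exact (hmem (hxC t (hsub ht)) (hz t ⟨ht.1, h⟩).1
              ((hzd t ⟨ht.1, h⟩).trans (by linarith))).2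
          · have h1 := hwd t ⟨(not_le.1 h).le, by linarith [ht.2]⟩
            have h2 := hzd t₁ ht₁m
            refine Metric.mem_cthickening_of_dist_le _ _ _ _ hxt₁ ?_
            linarith [dist_triangle (w t) (z t₁) (x t₁)]
        have hxnear : ∀ t ∈ Icc t₀ (t₁ + τ), x t ∈ M ∩ Metric.cthickening ε₁ C := fun t ht =>
          ⟨(hx t (hsub ht)).1, Metric.self_subset_cthickening C (hxC t (hsub ht))⟩
        intro t ht
        exact (hest om hom0 t₀ (t₁ + τ) (by linarith) x _ (hx.mono hsub) happ
          (by simp only [h01, if_true, hz0]) hxnear hnear t ht).trans hcom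
  obtain ⟨z, hz0, hz, hzd⟩ := hind m le_rfl
  rw [hmτ] at hz hzd
  exact ⟨z, hz0, hz, fun t ht => (hzd t ht).trans (by linarith [min_le_left ε ε₀])⟩

end IsOscillatingField

end Averaging

/-! ### From stability of the averaged system to practical stability. -/

section PracticalStability

variable {F : Type*} [NormedAddCommGroup F] [InnerProductSpace ℝ F]
  {H : Type*} [NormedAddCommGroup H] [NormedSpace ℝ H]
  {M : Set F} {Γ : H × F → F} {θ : ℝ → H} {T : ℝ} {g : F → F}

/-- The stability definitions pull initial values back with `Function.invFunOn`; this removes it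
when the change of variables is the identity. -/
theorem invFunOn_self_apply {X : Type*} [Nonempty X] {M : Set X} {y : X} (hy : y ∈ M) :
    Function.invFunOn (fun x : X => x) M y = y :=
  Function.invFunOn_eq (f := fun x : X => x) ⟨y, hy, rfl⟩

/-- Nonemptiness matters because `Metric.infDist` to the empty set takes the default value `0`. -/
theorem mem_cthickening_of_infDist_le {X : Type*} [PseudoMetricSpace X] {K : Set X}
    (hK : K.Nonempty) {x : X} {δ : ℝ}
    (h : Metric.infDist x K ≤ δ) : x ∈ Metric.cthickening δ K := by
  rw [Metric.mem_cthickening_iff]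
  rw [← ENNReal.ofReal_toReal (Metric.infEDist_ne_top hK)]
  exact ENNReal.ofReal_le_ofReal h

namespace IsOscillatingField

variable [FiniteDimensional ℝ F]

/-- A solution on `[t₀, ∞)` is the unique maximal solution. -/
theorem maximalSolutionSatisfies (hΓ : IsOscillatingField M Γ θ T) {om t₀ : ℝ} {z : ℝ → F}
    {P : ℝ → F → Prop}
    (hz : ∀ t₁, IsSolutionOn M (fun t x => Γ (θ (om * t), x)) t₀ (Icc t₀ t₁) z)
    (hP : ∀ t, t₀ ≤ t → P t (z t)) :
    MaximalSolutionSatisfies M (fun t x => Γ (θ (om * t), x)) t₀ (z t₀) P := by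
  have : CompleteSpace F := FiniteDimensional.complete ℝ F
  exact ⟨z, IsSolutionOn.Ici_of_forall hz, rfl,
    fun t₁ y hy hy0 => hΓ.eqOn_of_isSolutionOn hy (hz t₁) hy0, hP⟩

/-- If solutions which start in `A` exist on time intervals of length `Δ`, and end in `A`, then they
exist globally. -/
theorem exists_global_solution (hΓ : IsOscillatingField M Γ θ T) {om Δ : ℝ} (hΔ : 0 < Δ)
    {A B : Set F}
    (hstep : ∀ t₀ : ℝ, ∀ x ∈ A, ∃ z : ℝ → F, z t₀ = x ∧
      IsSolutionOn M (fun t x => Γ (θ (om * t), x)) t₀ (Icc t₀ (t₀ + Δ)) z ∧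
      (∀ t ∈ Icc t₀ (t₀ + Δ), z t ∈ B) ∧ z (t₀ + Δ) ∈ A) (t₀ : ℝ) {x : F} (hx : x ∈ A) :
    ∃ z : ℝ → F, z t₀ = x ∧
      (∀ t₁, IsSolutionOn M (fun t x => Γ (θ (om * t), x)) t₀ (Icc t₀ t₁) z) ∧
      ∀ t, t₀ ≤ t → z t ∈ B := by
  have : CompleteSpace F := FiniteDimensional.complete ℝ F
  have hind : ∀ k : ℕ, ∃ z : ℝ → F, z t₀ = x ∧
      IsSolutionOn M (fun t x => Γ (θ (om * t), x)) t₀ (Icc t₀ (t₀ + k * Δ)) z ∧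
      (∀ t ∈ Icc t₀ (t₀ + k * Δ), z t ∈ B) ∧ z (t₀ + k * Δ) ∈ A := by
    intro k
    induction k with
    | zero =>
      obtain ⟨z, hz0, hz, hzB, -⟩ := hstep t₀ x hx
      have hsub : Icc t₀ (t₀ + ((0 : ℕ) : ℝ) * Δ) ⊆ Icc t₀ (t₀ + Δ) :=
        Icc_subset_Icc le_rfl (by simp [hΔ.le])
      exact ⟨z, hz0, hz.mono hsub, fun t ht => hzB t (hsub ht), by simpa [hz0] using hx⟩
    | succ k ih =>
      obtain ⟨z, hz0, hz, hzB, hzA⟩ := ih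
      obtain ⟨w, hw0, hw, hwB, hwA⟩ := hstep _ _ hzA
      have h01 : t₀ ≤ t₀ + k * Δ := by
        have : 0 ≤ (k : ℝ) * Δ := by positivity
        linarith
      have hend : t₀ + ((k + 1 : ℕ) : ℝ) * Δ = t₀ + k * Δ + Δ := by push_cast; ring
      rw [hend]
      refine ⟨_, ?_, hz.append h01 hw hw0, fun t ht => ?_, ?_⟩
      · simp only [h01, if_true, hz0]
      · split_ifs with h
        · exact hzB t ⟨ht.1, h⟩
        · exact hwB t ⟨(not_le.1 h).le, ht.2⟩
      · have : ¬ t₀ + k * Δ + Δ ≤ t₀ + k * Δ := by linarith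
        simp only [this, if_false]
        exact hwA
  choose Z hZ0 hZ hZB _ using hind
  have hle : ∀ t : ℝ, t ≤ t₀ + (⌈(t - t₀) / Δ⌉₊ : ℝ) * Δ := fun t => by
    have := Nat.le_ceil ((t - t₀) / Δ)
    rw [div_le_iff₀ hΔ] at this
    linarith
  -- At time `t` the value is taken from the first solution whose interval reaches `t`; uniqueness
  -- makes these choices agree.
  refine ⟨fun t => Z ⌈(t - t₀) / Δ⌉₊ t, by simp only [hZ0], fun t₁ => ?_, fun t ht =>
    hZB _ t ⟨ht, hle t⟩⟩
  refine ((hZ ⌈(t₁ - t₀) / Δ⌉₊).mono (Icc_subset_Icc le_rfl (hle t₁))).congr fun t ht => ?_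
  have hk : ⌈(t - t₀) / Δ⌉₊ ≤ ⌈(t₁ - t₀) / Δ⌉₊ := by
    have := ht.2
    gcongr
  have hk' : t₀ + (⌈(t - t₀) / Δ⌉₊ : ℝ) * Δ ≤ t₀ + (⌈(t₁ - t₀) / Δ⌉₊ : ℝ) * Δ := by gcongr
  exact hΓ.eqOn_of_isSolutionOn ((hZ _).mono (Icc_subset_Icc le_rfl hk')) (hZ _)
    (by rw [hZ0, hZ0]) ⟨ht.1, hle t⟩

variable {K S : Set F}

/-- Solutions of the oscillating system which start close to `K` exist globally and stay close
to `K`. -/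
theorem exists_global_solution_near (hΓ : IsOscillatingField M Γ θ T)
    (hg : ∀ x ∈ M, g x = (1 / T) • ∫ τ in (0 : ℝ)..T, Γ (θ τ, x))
    (hK_ne : K.Nonempty) (hK : IsCompact K) (hKM : K ⊆ M) (hS : IsNeighborhoodIn M K S)
    (havg : UniformlyAsymptoticallyStable M (fun _ => g) K S) {ε : ℝ} (hε : 0 < ε) :
    ∃ om₀ > 0, ∃ δ > 0, ∀ om ≥ om₀, ∀ t₀ : ℝ, ∀ y₀ ∈ M, Metric.infDist y₀ K ≤ δ →
      ∃ z : ℝ → F, z t₀ = y₀ ∧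
        (∀ t₁, IsSolutionOn M (fun t x => Γ (θ (om * t), x)) t₀ (Icc t₀ t₁) z) ∧
        ∀ t, t₀ ≤ t → Metric.infDist (z t) K ≤ ε := by
  have : ProperSpace F := FiniteDimensional.proper ℝ F
  obtain ⟨-, O, hO, hKO, hOS⟩ := hS
  obtain ⟨ε₀, hε₀, hcpt⟩ :=
    hΓ.isLocalRetract.isLocallyClosed.exists_isCompact_cthickening hK hKM
  obtain ⟨ε₁, hε₁, hε₁O⟩ := hK.exists_cthickening_subset_open hO hKO
  set ε₂ := min (ε / 2) (min ε₀ ε₁) with hε₂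
  have hε₂0 : 0 < ε₂ := lt_min (half_pos hε) (lt_min hε₀ hε₁)
  have hε₂ε : ε₂ ≤ ε / 2 := min_le_left _ _
  have hε₂₀ : ε₂ ≤ ε₀ := (min_le_right _ _).trans (min_le_left _ _)
  have hε₂₁ : ε₂ ≤ ε₁ := (min_le_right _ _).trans (min_le_right _ _)
  obtain ⟨oma, -, δa, hδa, hstab⟩ := havg.1 ε₂ hε₂0
  set δ := min δa ε₂ with hδ
  have hδ0 : 0 < δ := lt_min hδa hε₂0
  -- After time `Δ` averaged solutions have come from distance `δ` to distance `δ / 2`. An averaging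
  -- error of at most `δ / 2` then brings the oscillating solution back to the set `infDist ≤ δ`,
  -- and the argument can restart.
  obtain ⟨omb, -, Δ, hΔ, ρ, -, hattr⟩ := havg.2 δ hδ0 (δ / 2) (half_pos hδ0)
  obtain ⟨om₀, hom₀, hnear⟩ := hΓ.exists_solution_near_average hg (hcpt ε₂ hε₂₀) inter_subset_left
    hΔ (half_pos hδ0)
  refine ⟨om₀, hom₀, δ, hδ0, fun om hom t₀ y₀ hy₀ hyK => ?_⟩
  refine hΓ.exists_global_solution hΔ (A := {x | x ∈ M ∧ Metric.infDist x K ≤ δ})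
    (B := {x | Metric.infDist x K ≤ ε}) (fun t₁ x hx => ?_) t₀ ⟨hy₀, hyK⟩
  obtain ⟨hxM, hxK⟩ := hx
  have hxS : x ∈ S := hOS ⟨hε₁O (mem_cthickening_of_infDist_le hK_ne
    (hxK.trans ((min_le_right _ _).trans hε₂₁))), hxM⟩
  -- The averaged system does not depend on the frequency, so the thresholds `oma` and `omb`
  -- themselves are inserted as frequencies.
  obtain ⟨X, hX, hX0, hXu, hXK⟩ := hstab oma le_rfl t₁ x hxM (hxK.trans (min_le_left _ _))
  obtain ⟨Y, hY, hY0, -, hYK⟩ := hattr omb le_rfl t₁ x hxS hxK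
  rw [invFunOn_self_apply hxM] at hX0 hY0 hXu
  have hXI : IsSolutionOn M (fun _ => g) t₁ (Icc t₁ (t₁ + Δ)) X := hX.mono Icc_subset_Ici_self
  -- Stability and attractivity each supply their own solution; the uniqueness clause identifies the
  -- two.
  have hYX : Y (t₁ + Δ) = X (t₁ + Δ) :=
    hXu (t₁ + Δ) Y (hY.mono Icc_subset_Ici_self) hY0 ⟨by linarith, le_rfl⟩
  obtain ⟨z, hz0, hz, hzX⟩ := hnear om hom t₁ X hXI fun t ht =>
    ⟨(hX t ht.1).1, mem_cthickening_of_infDist_le hK_ne (hXK t ht.1)⟩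
  refine ⟨z, hz0.trans hX0, hz, fun t ht => ?_, (hz _ ⟨by linarith, le_rfl⟩).1, ?_⟩
  · have h1 := Metric.infDist_le_infDist_add_dist (s := K) (x := z t) (y := X t)
    have h2 := hXK t ht.1
    have h3 := hzX t ht
    have h4 : δ ≤ ε₂ := min_le_right _ _
    change Metric.infDist (z t) K ≤ ε
    linarith
  · have h1 := Metric.infDist_le_infDist_add_dist (s := K) (x := z (t₁ + Δ)) (y := X (t₁ + Δ))
    have h2 := (hYK (t₁ + Δ) (by linarith)).2 le_rfl
    have h3 := hzX (t₁ + Δ) ⟨by linarith, le_rfl⟩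
    rw [hYX] at h2
    linarith

/-- Uniform asymptotic stability of the averaged system implies practical uniform asymptotic
stability of the oscillating system. -/
theorem practicallyUniformlyAsymptoticallyStable (hΓ : IsOscillatingField M Γ θ T)
    (hg : ∀ x ∈ M, g x = (1 / T) • ∫ τ in (0 : ℝ)..T, Γ (θ τ, x))
    (hK_ne : K.Nonempty) (hK : IsCompact K) (hKM : K ⊆ M) (hS : IsNeighborhoodIn M K S)
    (hcpt : MotionsRelativelyCompact M (fun _ => g) K S)
    (havg : UniformlyAsymptoticallyStable M (fun _ => g) K S) :
    PracticallyUniformlyAsymptoticallyStable M (fun om t x => Γ (θ (om * t), x))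
      (fun _ _ x => x) K S := by
  constructor
  · intro ε hε
    obtain ⟨om₀, hom₀, δ, hδ, h⟩ := hΓ.exists_global_solution_near hg hK_ne hK hKM hS havg hε
    refine ⟨om₀, hom₀, δ, hδ, fun om hom t₀ y₀ hy₀ hyK => ?_⟩
    obtain ⟨z, hz0, hz, hzK⟩ := h om hom t₀ y₀ hy₀ hyK
    rw [invFunOn_self_apply hy₀, ← hz0]
    exact hΓ.maximalSolutionSatisfies hz hzK
  · intro r hr ε hε
    obtain ⟨om₀, hom₀, δ, hδ, h⟩ := hΓ.exists_global_solution_near hg hK_ne hK hKM hS havg hε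
    obtain ⟨omb, -, Δ, hΔ, ρ, hρ, hattr⟩ := havg.2 r hr (δ / 2) (half_pos hδ)
    -- The bound `ρ` on the distance to `K` would not be enough here: when `M` is not closed, a
    -- bounded motion need not stay in a compact subset of `M`.
    obtain ⟨C, hCM, hC, hmot⟩ := hcpt r hr
    obtain ⟨om₁, -, hnear⟩ := hΓ.exists_solution_near_average hg hC hCM hΔ (half_pos hδ)
    -- Up to time `t₀ + Δ` the solution follows the averaged one, at distance at most `ρ + δ / 2`
    -- from `K`. It arrives within `δ`, and from then on the bound `ε` holds.
    refine ⟨max om₀ om₁, lt_max_of_lt_left hom₀, Δ, hΔ, max (ρ + δ / 2) ε, lt_max_of_lt_right hε,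
      fun om hom t₀ y₀ hy₀ hyK => ?_⟩
    have hy₀M := hS.1 hy₀
    obtain ⟨X, hX, hX0, -, hXC⟩ := hmot t₀ y₀ hy₀ hyK
    obtain ⟨Y, hY, hY0, hYu, hYK⟩ := hattr omb le_rfl t₀ y₀ hy₀ hyK
    rw [invFunOn_self_apply hy₀M] at hY0 hYu
    have hXI : IsSolutionOn M (fun _ => g) t₀ (Icc t₀ (t₀ + Δ)) X := hX.mono Icc_subset_Ici_self
    have hXY : EqOn X Y (Icc t₀ (t₀ + Δ)) := hYu (t₀ + Δ) X hXI hX0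
    obtain ⟨z, hz0, hz, hzX⟩ := hnear om ((le_max_right _ _).trans hom) t₀ X hXI
      fun t ht => hXC t ht.1
    have htΔ : t₀ + Δ ∈ Icc t₀ (t₀ + Δ) := ⟨by linarith, le_rfl⟩
    have hzK : ∀ t ∈ Icc t₀ (t₀ + Δ), Metric.infDist (z t) K ≤ Metric.infDist (Y t) K + δ / 2 := by
      intro t ht
      have h1 := Metric.infDist_le_infDist_add_dist (s := K) (x := z t) (y := X t)
      rw [hXY ht] at h1
      have h3 := hzX t ht
      rw [hXY ht] at h3
      linarith
    have hend : Metric.infDist (z (t₀ + Δ)) K ≤ δ := by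
      linarith [hzK _ htΔ, (hYK (t₀ + Δ) htΔ.1).2 le_rfl]
    obtain ⟨w, hw0, hw, hwK⟩ := h om ((le_max_left _ _).trans hom) (t₀ + Δ) _ (hz _ htΔ).1 hend
    have happ := fun t₁ => hz.append htΔ.1 (hw t₁) hw0
    rw [invFunOn_self_apply hy₀M]
    have hstart : (fun t => if t ≤ t₀ + Δ then z t else w t) t₀ = y₀ := by
      simp only [htΔ.1, if_true, hz0, hX0]
    rw [← hstart]
    refine hΓ.maximalSolutionSatisfies happ fun t ht => ?_
    rcases lt_trichotomy t (t₀ + Δ) with h1 | h1 | h1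
    · simp only [h1.le, if_true]
      refine ⟨le_max_of_le_left ?_, fun h2 => absurd h1 (not_lt.2 h2)⟩
      linarith [hzK t ⟨ht, h1.le⟩, (hYK t ht).1]
    · have h2 := hwK t h1.ge
      rw [h1, hw0] at h2
      subst h1
      simp only [le_refl, if_true]
      exact ⟨le_max_of_le_right h2, fun _ => h2⟩
    · simp only [not_le.2 h1, if_false]
      exact ⟨le_max_of_le_right (hwK t h1.le), fun _ => hwK t h1.le⟩

end IsOscillatingField

end PracticalStability

/-! ### A formula for the orthogonal projection to the range of an idempotent. -/

section Projection

variable {E : Type*} [NormedAddCommGroup E] [InnerProductSpace ℝ E] [CompleteSpace E]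

theorem contDiff_adjoint {n : WithTop ℕ∞} :
    ContDiff ℝ n (fun D : E →L[ℝ] E => ContinuousLinearMap.adjoint D) := by
  have h : IsBoundedLinearMap ℝ (fun D : E →L[ℝ] E => ContinuousLinearMap.adjoint D) :=
    { map_add := fun x y => map_add _ x y
      map_smul := fun c x => by simp
      bound := ⟨1, one_pos, fun x => by simp⟩ }
  exact h.contDiff

/-- In finite dimension injectivity is enough. If `D x + D* x = x`, then `‖D x‖² = ⟨D x, x - D* x⟩ =
⟨D x, x⟩ - ⟨D (D x), x⟩ = 0`; hence `x = D* x` and `‖x‖² = ⟨D x, x⟩ = 0`. -/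
theorem isUnit_add_adjoint_sub_one [FiniteDimensional ℝ E] {D : E →L[ℝ] E} (hD : ∀ x, D (D x) = D x) :
    IsUnit (D + ContinuousLinearMap.adjoint D - 1) := by
  rw [ContinuousLinearMap.isUnit_iff_bijective]
  have hinj : Function.Injective (D + ContinuousLinearMap.adjoint D - 1 : E →L[ℝ] E) := by
    rw [injective_iff_map_eq_zero]
    intro x hx
    replace hx : D x + ContinuousLinearMap.adjoint D x - x = 0 := hx
    have h1 : D x = x - ContinuousLinearMap.adjoint D x := by
      rw [sub_eq_zero] at hx; rw [eq_sub_iff_add_eq, hx]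
    have h2 : D x = 0 := by
      rw [← inner_self_eq_zero (𝕜 := ℝ)]
      nth_rw 2 [h1]
      rw [inner_sub_right, ContinuousLinearMap.adjoint_inner_right, hD, sub_self]
    have h3 : x = ContinuousLinearMap.adjoint D x := by
      rw [h2] at h1; exact sub_eq_zero.1 h1.symm
    rw [← inner_self_eq_zero (𝕜 := ℝ)]
    nth_rw 2 [h3]
    rw [ContinuousLinearMap.adjoint_inner_right, h2, inner_zero_left]
  exact ⟨hinj, LinearMap.injective_iff_surjective.1 hinj⟩

/-- The orthogonal projection to the range of an idempotent map. -/
theorem starProjection_eq_mul_inverse [FiniteDimensional ℝ E] {D : E →L[ℝ] E} {W : Submodule ℝ E}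
    (hW : ∀ x, D x ∈ W) (hD : ∀ x ∈ W, D x = x) :
    W.starProjection = D * Ring.inverse (D + ContinuousLinearMap.adjoint D - 1) := by
  have hu := isUnit_add_adjoint_sub_one (D := D) fun x => hD _ (hW x)
  have h1 : D * W.starProjection = W.starProjection := by
    ext x
    exact hD _ (Submodule.starProjection_apply_mem _ _)
  have h2 : W.starProjection * D = D := by
    ext x
    exact Submodule.starProjection_eq_self_iff.2 (hW x)
  have h3 : W.starProjection * ContinuousLinearMap.adjoint D = W.starProjection := by
    have h := congrArg ContinuousLinearMap.adjoint h1
    have hs : ContinuousLinearMap.adjoint W.starProjection = W.starProjection :=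
      (isSelfAdjoint_starProjection W).adjoint_eq
    rw [ContinuousLinearMap.mul_def, ContinuousLinearMap.adjoint_comp, hs] at h
    exact h
  -- For the projection `P` to `W`, `P D = D`, and taking the adjoint of `D P = P` gives `P D* = P`;
  -- so `P (D + D* - 1) = D`.
  have h4 : W.starProjection * (D + ContinuousLinearMap.adjoint D - 1) = D := by
    rw [mul_sub, mul_add, h2, h3, mul_one, add_sub_cancel_right]
  rw [← h4, mul_assoc, h4, Ring.mul_inverse_cancel _ hu, mul_one]

end Projection

/-! ### Smoothness of tangential projections and derivatives along `Q`. -/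

section Geometry

variable {N : ℕ} {Q : Set (Euc N)}

theorem fderiv_retraction_apply_of_mem_tangentSpaceAt {O : Set (Euc N)} {r : Euc N → Euc N}
    (hO : IsOpen O) (hr : ContDiffOn ℝ ∞ r O) (hid : ∀ x ∈ Q ∩ O, r x = x) {q w : Euc N}
    (hq : q ∈ Q ∩ O) (hw : w ∈ tangentSpaceAt Q q) : fderiv ℝ r q w = w := by
  have h : tangentSpaceAt Q q ≤
      LinearMap.eqLocus (fderiv ℝ r q : Euc N →ₗ[ℝ] Euc N) LinearMap.id :=
    Submodule.span_le.2 fun w hw =>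
      fderiv_retraction_apply_of_mem_tangentConeAt hO hr hid hq hw
  exact h hw

theorem fderiv_retraction_mem_tangentSpaceAt {O : Set (Euc N)} {r : Euc N → Euc N}
    (hO : IsOpen O) (hr : ContDiffOn ℝ ∞ r O) (hrQ : MapsTo r O (Q ∩ O))
    (hid : ∀ x ∈ Q ∩ O, r x = x) {q : Euc N} (hq : q ∈ Q ∩ O) (w : Euc N) :
    fderiv ℝ r q w ∈ tangentSpaceAt Q q :=
  Submodule.subset_span (fderiv_retraction_mem_tangentConeAt hO hr hrQ hid hq w)

theorem extend_mem (Q : Set (Euc N)) (v p : Euc N) : extend Q v p ∈ tangentSpaceAt Q p :=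
  Submodule.starProjection_apply_mem _ _

theorem extend_of_mem {v p : Euc N} (hv : v ∈ tangentSpaceAt Q p) : extend Q v p = v :=
  Submodule.starProjection_eq_self_iff.2 hv

theorem mem_tangentSpaceAt_iff {v p : Euc N} : v ∈ tangentSpaceAt Q p ↔ extend Q v p = v :=
  Submodule.starProjection_eq_self_iff.symm

/-- The vector fields `extend Q v` depend linearly on `v`. -/
theorem extend_eq_sum (Q : Set (Euc N)) (v p : Euc N) :
    extend Q v p = ∑ a, v a • extend Q (EuclideanSpace.single a 1) p := by
  have h : v = ∑ a, v a • EuclideanSpace.single a (1 : ℝ) := by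
    ext j; simp [Finset.sum_apply, Pi.single_apply]
  unfold extend
  conv_lhs => rw [h]
  simp only [map_sum, map_smul]

/-- The derivative of a local retraction at a point of `Q` is an idempotent with range the tangent
space. `starProjection_eq_mul_inverse` expresses the projection through it by smooth operations,
including inversion of operators. -/
theorem isSmoothVectorField_extend (hQ : IsLocalRetract Q) (v : Euc N) :
    IsSmoothVectorField Q (extend Q v) := by
  refine ⟨fun q hq => ?_, fun q _ => extend_mem Q v q⟩
  obtain ⟨O, r, hO, hqO, hr, hrQ, hid⟩ := hQ q hq
  set A : Euc N → (Euc N →L[ℝ] Euc N) := fun p =>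
    fderiv ℝ r p + ContinuousLinearMap.adjoint (fderiv ℝ r p) - 1 with hA
  have hD : ContDiffOn ℝ ∞ (fderiv ℝ r) (Q ∩ O) :=
    (hr.fderiv_of_isOpen hO (by simp)).mono inter_subset_right
  have hAs : ContDiffOn ℝ ∞ A (Q ∩ O) :=
    (hD.add (contDiff_adjoint.comp_contDiffOn hD)).sub contDiffOn_const
  have hmem : ∀ p ∈ Q ∩ O, ∀ x, fderiv ℝ r p x ∈ tangentSpaceAt Q p := fun p hp x =>
    fderiv_retraction_mem_tangentSpaceAt hO hr hrQ hid hp x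
  have hfix : ∀ p ∈ Q ∩ O, ∀ x ∈ tangentSpaceAt Q p, fderiv ℝ r p x = x := fun p hp x hx =>
    fderiv_retraction_apply_of_mem_tangentSpaceAt hO hr hid hp hx
  have hinv : ContDiffOn ℝ ∞ (fun p => Ring.inverse (A p)) (Q ∩ O) := by
    intro p hp
    obtain ⟨a, ha⟩ := isUnit_add_adjoint_sub_one fun x => hfix p hp _ (hmem p hp x)
    have h1 := contDiffAt_ringInverse (n := ∞) ℝ a
    rw [ha] at h1
    exact ContDiffAt.comp_contDiffWithinAt p h1 (hAs p hp)
  have hs : ContDiffOn ℝ ∞ (fun p => fderiv ℝ r p (Ring.inverse (A p) v)) (Q ∩ O) :=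
    hD.clm_apply (hinv.clm_apply contDiffOn_const)
  have he : ContDiffOn ℝ ∞ (extend Q v) (Q ∩ O) := hs.congr fun p hp => by
    unfold extend
    rw [starProjection_eq_mul_inverse (hmem p hp) (hfix p hp)]
    rfl
  exact (contDiffWithinAt_inter (hO.mem_nhds hqO)).1 (he q ⟨hq, hqO⟩)

section DirDeriv

variable {G : Type*} [NormedAddCommGroup G] [NormedSpace ℝ G]

/-- Derivatives within `Q` are not unique as linear maps on `ℝ^N`, but any two of them agree on the
tangent cone and hence on its span. -/
theorem dirDeriv_eq {f : Euc N → G} {f' : Euc N →L[ℝ] G} {q w : Euc N}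
    (hf : HasFDerivWithinAt f f' Q q) (hw : w ∈ tangentSpaceAt Q q) : dirDeriv Q f q w = f' w := by
  have h : tangentSpaceAt Q q ≤
      LinearMap.eqLocus (fderivWithin ℝ f Q q : Euc N →ₗ[ℝ] G) (f' : Euc N →ₗ[ℝ] G) :=
    Submodule.span_le.2 fun w hw =>
      hf.differentiableWithinAt.hasFDerivWithinAt.unique_on hf hw
  exact h hw

theorem hasFDerivWithinAt_of_contDiffOn {f : Euc N → G} (hf : ContDiffOn ℝ ∞ f Q) {q : Euc N}
    (hq : q ∈ Q) : HasFDerivWithinAt f (fderivWithin ℝ f Q q) Q q :=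
  ((hf.differentiableOn (by simp)) q hq).hasFDerivWithinAt

theorem dirDeriv_congr {f f' : Euc N → G} (hf : ContDiffOn ℝ ∞ f Q) (hff' : EqOn f f' Q)
    {q w : Euc N} (hq : q ∈ Q) (hw : w ∈ tangentSpaceAt Q q) :
    dirDeriv Q f' q w = dirDeriv Q f q w :=
  dirDeriv_eq ((hasFDerivWithinAt_of_contDiffOn hf hq).congr (fun _ hx => (hff' hx).symm)
    (hff' hq).symm) hw

theorem dirDeriv_const (c : G) (q w : Euc N) : dirDeriv Q (fun _ => c) q w = 0 := by
  simp [dirDeriv]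

theorem dirDeriv_smul {χ : Euc N → ℝ} {f : Euc N → G} (hχ : ContDiffOn ℝ ∞ χ Q)
    (hf : ContDiffOn ℝ ∞ f Q) {q w : Euc N} (hq : q ∈ Q) (hw : w ∈ tangentSpaceAt Q q) :
    dirDeriv Q (fun p => χ p • f p) q w =
      χ q • dirDeriv Q f q w + dirDeriv Q χ q w • f q := by
  rw [dirDeriv_eq ((hasFDerivWithinAt_of_contDiffOn hχ hq).fun_smul
    (hasFDerivWithinAt_of_contDiffOn hf hq)) hw]
  simp [dirDeriv]

theorem dirDeriv_sum {ι : Type*} (s : Finset ι) {f : ι → Euc N → G}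
    (hf : ∀ i ∈ s, ContDiffOn ℝ ∞ (f i) Q) {q w : Euc N} (hq : q ∈ Q)
    (hw : w ∈ tangentSpaceAt Q q) :
    dirDeriv Q (fun p => ∑ i ∈ s, f i p) q w = ∑ i ∈ s, dirDeriv Q (f i) q w := by
  rw [dirDeriv_eq (HasFDerivWithinAt.fun_sum
    fun i hi => hasFDerivWithinAt_of_contDiffOn (hf i hi) hq) hw]
  simp [dirDeriv]

theorem dirDeriv_sum_smul {ι : Type*} (s : Finset ι) {χ : ι → Euc N → ℝ} {f : ι → Euc N → G}
    (hχ : ∀ i ∈ s, ContDiffOn ℝ ∞ (χ i) Q) (hf : ∀ i ∈ s, ContDiffOn ℝ ∞ (f i) Q) {q w : Euc N}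
    (hq : q ∈ Q) (hw : w ∈ tangentSpaceAt Q q) :
    dirDeriv Q (fun p => ∑ i ∈ s, χ i p • f i p) q w =
      ∑ i ∈ s, (χ i q • dirDeriv Q (f i) q w + dirDeriv Q (χ i) q w • f i q) := by
  rw [dirDeriv_sum s (f := fun i p => χ i p • f i p) (fun i hi => (hχ i hi).smul (hf i hi)) hq hw]
  exact Finset.sum_congr rfl fun i hi => dirDeriv_smul (hχ i hi) (hf i hi) hq hw

theorem dirDeriv_clm {G' : Type*} [NormedAddCommGroup G'] [NormedSpace ℝ G'] (L : G →L[ℝ] G')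
    {f : Euc N → G} (hf : ContDiffOn ℝ ∞ f Q) {q w : Euc N} (hq : q ∈ Q)
    (hw : w ∈ tangentSpaceAt Q q) :
    dirDeriv Q (fun p => L (f p)) q w = L (dirDeriv Q f q w) :=
  dirDeriv_eq (L.hasFDerivAt.comp_hasFDerivWithinAt q (hasFDerivWithinAt_of_contDiffOn hf hq)) hw

theorem dirDeriv_coord {f : Euc N → Euc N} (hf : ContDiffOn ℝ ∞ f Q) {q w : Euc N} (hq : q ∈ Q)
    (hw : w ∈ tangentSpaceAt Q q) (a : Fin N) :
    dirDeriv Q (fun p => f p a) q w = dirDeriv Q f q w a :=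
  dirDeriv_clm (EuclideanSpace.proj (𝕜 := ℝ) a) hf hq hw

/-- Replaces the derivative within `Q` by an ordinary derivative of the extension `f ∘ r`, which is
manifestly smooth in the base point. -/
theorem dirDeriv_eq_fderiv_comp {f : Euc N → G} (hf : ContDiffOn ℝ ∞ f Q) {O : Set (Euc N)}
    {r : Euc N → Euc N} (hO : IsOpen O) (hr : ContDiffOn ℝ ∞ r O) (hrQ : MapsTo r O (Q ∩ O))
    (hid : ∀ x ∈ Q ∩ O, r x = x) {q w : Euc N} (hq : q ∈ Q ∩ O) (hw : w ∈ tangentSpaceAt Q q) :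
    dirDeriv Q f q w = fderiv ℝ (fun x => f (r x)) q w := by
  have hfr : ContDiffOn ℝ ∞ (fun x => f (r x)) O := hf.comp hr fun x hx => (hrQ hx).1
  have h1 : HasFDerivWithinAt (fun x => f (r x)) (fderiv ℝ (fun x => f (r x)) q) (Q ∩ O) q :=
    ((hfr.contDiffAt (hO.mem_nhds hq.2)).differentiableAt
      (by simp)).hasFDerivAt.hasFDerivWithinAt
  exact dirDeriv_eq ((hasFDerivWithinAt_inter (hO.mem_nhds hq.2)).1
    (h1.congr (fun x hx => congrArg f (hid x hx).symm) (congrArg f (hid q hq).symm))) hw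

/-- Directional derivatives of smooth functions are smooth on the tangent bundle. -/
theorem contDiffOn_dirDeriv (hQ : IsLocalRetract Q) {f : Euc N → G} (hf : ContDiffOn ℝ ∞ f Q) :
    ContDiffOn ℝ ∞ (fun p : Euc N × Euc N => dirDeriv Q f p.1 p.2)
      {p | p.1 ∈ Q ∧ p.2 ∈ tangentSpaceAt Q p.1} := by
  rintro ⟨q, v⟩ ⟨hq, hv⟩
  obtain ⟨O, r, hO, hqO, hr, hrQ, hid⟩ := hQ q hq
  have hfr : ContDiffOn ℝ ∞ (fun x => f (r x)) O := hf.comp hr fun x hx => (hrQ hx).1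
  have hd : ContDiffOn ℝ ∞ (fun p : Euc N × Euc N => fderiv ℝ (fun x => f (r x)) p.1 p.2)
      (O ×ˢ univ) :=
    ((hfr.fderiv_of_isOpen hO (by simp)).comp contDiff_fst.contDiffOn fun p hp => hp.1).clm_apply
      contDiff_snd.contDiffOn
  have hOn : O ×ˢ univ ∈ 𝓝 (q, v) := (hO.prod isOpen_univ).mem_nhds ⟨hqO, trivial⟩
  rw [← contDiffWithinAt_inter hOn]
  exact ((hd.mono inter_subset_right).congr fun p hp =>
    dirDeriv_eq_fderiv_comp hf hO hr hrQ hid ⟨hp.1.1, hp.2.1⟩ hp.1.2) _ ⟨⟨hq, hv⟩, hqO, trivial⟩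

end DirDeriv

theorem dirDeriv_extend_eq_sum (hQ : IsLocalRetract Q) (v : Euc N) {q w : Euc N} (hq : q ∈ Q)
    (hw : w ∈ tangentSpaceAt Q q) : dirDeriv Q (extend Q v) q w =
      ∑ a, v a • dirDeriv Q (extend Q (EuclideanSpace.single a 1)) q w := by
  have hE := fun a => (isSmoothVectorField_extend hQ (EuclideanSpace.single a (1 : ℝ))).1
  have h1 : extend Q v = fun p => ∑ a, v a • extend Q (EuclideanSpace.single a 1) p :=
    funext (extend_eq_sum Q v)
  rw [h1, dirDeriv_sum_smul _ (χ := fun a _ => v a) (fun a _ => contDiffOn_const)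
    (fun a _ => hE a) hq hw]
  simp only [dirDeriv_const, zero_smul, add_zero]

/-- The derivative of a vector field is, up to its tangential part, the derivative of the
projections of its value. -/
theorem IsSmoothVectorField.dirDeriv_eq_add (hQ : IsLocalRetract Q) {X : Euc N → Euc N}
    (hX : IsSmoothVectorField Q X) {q w : Euc N} (hq : q ∈ Q) (hw : w ∈ tangentSpaceAt Q q) :
    dirDeriv Q X q w =
      extend Q (dirDeriv Q X q w) q + dirDeriv Q (extend Q (X q)) q w := by
  have hE := fun a => (isSmoothVectorField_extend hQ (EuclideanSpace.single a (1 : ℝ))).1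
  have hc : ∀ a, ContDiffOn ℝ ∞ (fun p => X p a) Q := fun a =>
    (EuclideanSpace.proj (𝕜 := ℝ) a).contDiff.comp_contDiffOn hX.1
  -- On `Q` the field is a combination of the projected basis vectors with its own coordinates as
  -- coefficients. In the product rule, derivatives of the coefficients form the tangential term,
  -- and derivatives of the projections form the other.
  have h1 : EqOn X (fun p => ∑ a, X p a • extend Q (EuclideanSpace.single a 1) p) Q :=
    fun p hp => by
      dsimp only
      rw [← extend_eq_sum, extend_of_mem (hX.2 p hp)]
  have h2 := dirDeriv_congr hX.1 h1 hq hw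
  rw [dirDeriv_sum_smul _ (fun a _ => hc a) (fun a _ => hE a) hq hw] at h2
  nth_rw 1 [← h2]
  rw [extend_eq_sum, dirDeriv_extend_eq_sum hQ _ hq hw, add_comm, ← Finset.sum_add_distrib]
  refine Finset.sum_congr rfl fun a _ => ?_
  rw [dirDeriv_coord hX.1 hq hw]

/-- The preceding decomposition for `X = extend Q v` has the same derivative on both sides, so its
tangential term vanishes: projections vary in normal directions on tangent vectors. -/
theorem extend_dirDeriv_extend (hQ : IsLocalRetract Q) {v q w : Euc N} (hq : q ∈ Q)
    (hv : v ∈ tangentSpaceAt Q q) (hw : w ∈ tangentSpaceAt Q q) :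
    extend Q (dirDeriv Q (extend Q v) q w) q = 0 := by
  have h := (isSmoothVectorField_extend hQ v).dirDeriv_eq_add hQ hq hw
  rw [extend_of_mem hv] at h
  simpa using h

end Geometry

/-! ### The spray as a quadratic form in the velocity. -/

section Spray

variable {N : ℕ} {Q : Set (Euc N)}

theorem IsSmoothVectorField.smul {χ : Euc N → ℝ} {X : Euc N → Euc N} (hχ : ContDiffOn ℝ ∞ χ Q)
    (hX : IsSmoothVectorField Q X) : IsSmoothVectorField Q fun p => χ p • X p :=
  ⟨hχ.smul hX.1, fun q hq => Submodule.smul_mem _ _ (hX.2 q hq)⟩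

theorem isSmoothVectorField_sum_smul {ι : Type*} (s : Finset ι) {χ : ι → Euc N → ℝ}
    {X : ι → Euc N → Euc N} (hχ : ∀ i, ContDiffOn ℝ ∞ (χ i) Q)
    (hX : ∀ i, IsSmoothVectorField Q (X i)) :
    IsSmoothVectorField Q fun p => ∑ i ∈ s, χ i p • X i p :=
  ⟨ContDiffOn.sum fun i _ => (hχ i).smul (hX i).1,
    fun q hq => Submodule.sum_mem _ fun i _ => Submodule.smul_mem _ _ ((hX i).2 q hq)⟩

namespace AffineConnection

variable (C : AffineConnection Q)

theorem nabla_sum_smul_left {ι : Type*} [DecidableEq ι] (s : Finset ι) {χ : ι → Euc N → ℝ}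
    {X : ι → Euc N → Euc N} {Y : Euc N → Euc N} (hχ : ∀ i, ContDiffOn ℝ ∞ (χ i) Q)
    (hX : ∀ i, IsSmoothVectorField Q (X i)) (hY : IsSmoothVectorField Q Y) {q : Euc N}
    (hq : q ∈ Q) :
    C.nabla (fun p => ∑ i ∈ s, χ i p • X i p) Y q = ∑ i ∈ s, χ i q • C.nabla (X i) Y q := by
  induction s using Finset.induction_on with
  | empty =>
    -- The empty sum is the zero field, which is `0 • Y`.
    have := C.smul_left (fun _ => 0) Y Y contDiffOn_const hY hY q hq
    simpa using this
  | insert a s ha ih =>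
    simp only [Finset.sum_insert ha]
    rw [C.add_left (fun p => χ a p • X a p) (fun p => ∑ i ∈ s, χ i p • X i p) Y ((hX a).smul (hχ a))
      (isSmoothVectorField_sum_smul s hχ hX) hY q hq, ih,
      C.smul_left (χ a) (X a) Y (hχ a) (hX a) hY q hq]

theorem nabla_sum_smul_right {ι : Type*} [DecidableEq ι] (s : Finset ι) {χ : ι → Euc N → ℝ}
    {X : Euc N → Euc N} {Y : ι → Euc N → Euc N} (hχ : ∀ i, ContDiffOn ℝ ∞ (χ i) Q)
    (hX : IsSmoothVectorField Q X) (hY : ∀ i, IsSmoothVectorField Q (Y i)) {q : Euc N}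
    (hq : q ∈ Q) :
    C.nabla X (fun p => ∑ i ∈ s, χ i p • Y i p) q =
      ∑ i ∈ s, (χ i q • C.nabla X (Y i) q + dirDeriv Q (χ i) q (X q) • Y i q) := by
  induction s using Finset.induction_on with
  | empty =>
    have := C.leibniz (fun _ => 0) X X contDiffOn_const hX hX q hq
    rw [dirDeriv_const] at this
    simpa using this
  | insert a s ha ih =>
    simp only [Finset.sum_insert ha]
    rw [C.add_right X (fun p => χ a p • Y a p) (fun p => ∑ i ∈ s, χ i p • Y i p) hX
      ((hY a).smul (hχ a)) (isSmoothVectorField_sum_smul s hχ hY) q hq, ih,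
      C.leibniz (χ a) X (Y a) (hχ a) hX (hY a) q hq]

/-- The coefficients of the spray with respect to the projections of the standard basis. -/
noncomputable def sprayCoeff (a b : Fin N) (q : Euc N) : Euc N :=
  dirDeriv Q (extend Q (EuclideanSpace.single a 1)) q (extend Q (EuclideanSpace.single b 1) q) -
    C.nabla (extend Q (EuclideanSpace.single a 1)) (extend Q (EuclideanSpace.single b 1)) q

/-- A bilinear map whose restriction to the diagonal is the spray. -/
noncomputable def sprayBilin (q : Euc N) : Euc N →ₗ[ℝ] Euc N →ₗ[ℝ] Euc N :=
  LinearMap.mk₂ ℝ (fun v w => ∑ a, ∑ b, (v a * w b) • C.sprayCoeff a b q)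
    (fun v v' w => by simp only [PiLp.add_apply, add_mul, add_smul, Finset.sum_add_distrib])
    (fun c v w => by
      simp only [PiLp.smul_apply, smul_eq_mul, Finset.smul_sum, smul_smul, mul_assoc])
    (fun v w w' => by simp only [PiLp.add_apply, mul_add, add_smul, Finset.sum_add_distrib])
    (fun c v w => by
      simp only [PiLp.smul_apply, smul_eq_mul, Finset.smul_sum, smul_smul, mul_left_comm])

theorem sprayBilin_apply (q v w : Euc N) :
    C.sprayBilin q v w = ∑ a, ∑ b, (v a * w b) • C.sprayCoeff a b q := rfl

variable {C}

/-- The spray at the value of a vector field `X` can be computed with `X` itself. -/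
theorem sprayBilin_vectorField (hQ : IsLocalRetract Q) {X : Euc N → Euc N}
    (hX : IsSmoothVectorField Q X) {q : Euc N} (hq : q ∈ Q) :
    C.sprayBilin q (X q) (X q) = dirDeriv Q X q (X q) - C.nabla X X q := by
  set E : Fin N → Euc N → Euc N := fun a => extend Q (EuclideanSpace.single a 1) with hE
  have hEs : ∀ a, IsSmoothVectorField Q (E a) := fun a => isSmoothVectorField_extend hQ _
  have hc : ∀ a, ContDiffOn ℝ ∞ (fun p => X p a) Q := fun a =>
    (EuclideanSpace.proj (𝕜 := ℝ) a).contDiff.comp_contDiffOn hX.1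
  have hXq : X q = ∑ a, X q a • E a q := by
    rw [hE, ← extend_eq_sum, extend_of_mem (hX.2 q hq)]
  have hXE : EqOn X (fun p => ∑ a, X p a • E a p) Q := fun p hp => by
    dsimp only [hE]
    rw [← extend_eq_sum, extend_of_mem (hX.2 p hp)]
  have hlin : ∀ {f : Euc N → Euc N}, dirDeriv Q f q (X q) = ∑ b, X q b • dirDeriv Q f q (E b q) := by
    intro f
    conv_lhs => rw [hXq]
    simp only [dirDeriv, map_sum, map_smul]
  have hlin' : ∀ {f : Euc N → ℝ}, dirDeriv Q f q (X q) = ∑ b, X q b • dirDeriv Q f q (E b q) := by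
    intro f
    conv_lhs => rw [hXq]
    simp only [dirDeriv, map_sum, map_smul]
  have h1 : dirDeriv Q X q (X q) = ∑ a, (X q a • dirDeriv Q (E a) q (X q) +
      dirDeriv Q (fun p => X p a) q (X q) • E a q) := by
    rw [← dirDeriv_congr hX.1 hXE hq (hX.2 q hq)]
    exact dirDeriv_sum_smul _ (fun a _ => hc a) (fun a _ => (hEs a).1) hq (hX.2 q hq)
  have h2 : C.nabla X X q = ∑ a, X q a • ∑ b, (X q b • C.nabla (E a) (E b) q +
      dirDeriv Q (fun p => X p b) q (E a q) • E b q) := by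
    rw [C.congr X (fun p => ∑ a, X p a • E a p) X X hXE (fun _ _ => rfl) hq,
      C.nabla_sum_smul_left _ hc hEs hX hq]
    refine Finset.sum_congr rfl fun a _ => ?_
    rw [C.congr (E a) (E a) X (fun p => ∑ b, X p b • E b p) (fun _ _ => rfl) hXE hq,
      C.nabla_sum_smul_right _ hc (hEs a) hEs hq]
  -- The derivatives of the coefficients of `X` occur identically in the ordinary and in the
  -- covariant derivative. They cancel in the difference, which therefore depends only on the value
  -- of `X` at `q`.
  have h3 : ∑ a, dirDeriv Q (fun p => X p a) q (X q) • E a q =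
      ∑ a, X q a • ∑ b, dirDeriv Q (fun p => X p b) q (E a q) • E b q := by
    simp only [hlin', Finset.sum_smul, Finset.smul_sum, smul_eq_mul, mul_smul]
    rw [Finset.sum_comm]
  rw [h1, h2, sprayBilin_apply]
  simp only [Finset.sum_add_distrib, smul_add]
  rw [h3, add_sub_add_right_eq_sub]
  simp only [hlin, sprayCoeff, hE, Finset.smul_sum, smul_sub, Finset.sum_sub_distrib, smul_smul]

/-- The definition of the spray uses a vector field that varies with `v`. The bilinear form gives
smoothness in `(q, v)` and lets the spray be expanded at a shifted velocity. -/
theorem spray_eq_sprayBilin (hQ : IsLocalRetract Q) {q v : Euc N} (hq : q ∈ Q)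
    (hv : v ∈ tangentSpaceAt Q q) : C.spray q v = C.sprayBilin q v v := by
  have h := sprayBilin_vectorField (C := C) hQ (isSmoothVectorField_extend hQ v) hq
  rw [extend_of_mem hv] at h
  exact h.symm

theorem contDiffOn_sprayCoeff (hQ : IsLocalRetract Q) (a b : Fin N) :
    ContDiffOn ℝ ∞ (C.sprayCoeff a b) Q := by
  have hE := fun a => isSmoothVectorField_extend hQ (EuclideanSpace.single a (1 : ℝ))
  refine ContDiffOn.sub ?_ (C.smooth _ _ (hE a) (hE b)).1
  exact (contDiffOn_dirDeriv hQ (hE a).1).comp (contDiffOn_id.prodMk (hE b).1)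
    fun q hq => ⟨hq, (hE b).2 q hq⟩

theorem contDiffOn_spray (hQ : IsLocalRetract Q) :
    ContDiffOn ℝ ∞ (fun p : Euc N × Euc N => C.spray p.1 p.2)
      {p | p.1 ∈ Q ∧ p.2 ∈ tangentSpaceAt Q p.1} := by
  have h : ContDiffOn ℝ ∞ (fun p : Euc N × Euc N => ∑ a, ∑ b, (p.2 a * p.2 b) • C.sprayCoeff a b p.1)
      {p | p.1 ∈ Q ∧ p.2 ∈ tangentSpaceAt Q p.1} := by
    have hc : ∀ a : Fin N, ContDiff ℝ ∞ fun p : Euc N × Euc N => p.2 a := fun a =>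
      (EuclideanSpace.proj (𝕜 := ℝ) a).contDiff.comp contDiff_snd
    refine ContDiffOn.sum fun a _ => ContDiffOn.sum fun b _ => ContDiffOn.smul
      ((hc a).mul (hc b)).contDiffOn ?_
    exact (contDiffOn_sprayCoeff hQ a b).comp contDiff_fst.contDiffOn fun p hp => hp.1
  exact h.congr fun p hp => spray_eq_sprayBilin hQ hp.1 hp.2

/-- The tangential and the normal part of the spray. -/
theorem extend_spray_add (hQ : IsLocalRetract Q) {q v : Euc N} (hq : q ∈ Q)
    (hv : v ∈ tangentSpaceAt Q q) :
    extend Q (C.spray q v) q + dirDeriv Q (extend Q v) q v = C.spray q v := by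
  have h1 := extend_dirDeriv_extend hQ hq hv hv
  have hE := isSmoothVectorField_extend hQ v
  have h2 := extend_of_mem ((C.smooth _ _ hE hE).2 q hq)
  have h3 : extend Q (C.spray q v) q = - C.nabla (extend Q v) (extend Q v) q := by
    unfold spray extend at *
    rw [map_sub, h1, h2, zero_sub]
  rw [h3]
  unfold spray
  abel

end AffineConnection

end Spray

/-! ### The manifold `TQ × ℝ` and its tangent vectors. -/

section TangentBundle

variable {N : ℕ} {Q : Set (Euc N)}

/-- `mkState` as a continuous linear map. -/
noncomputable def mkStateL (N : ℕ) : Euc N × Euc N × ℝ →L[ℝ] State N :=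
  ((WithLp.prodContinuousLinearEquiv 2 ℝ (Euc N) (WithLp 2 (Euc N × ℝ))).symm :
    Euc N × WithLp 2 (Euc N × ℝ) →L[ℝ] State N) ∘L
  ((ContinuousLinearMap.id ℝ (Euc N)).prodMap
    ((WithLp.prodContinuousLinearEquiv 2 ℝ (Euc N) ℝ).symm :
      Euc N × ℝ →L[ℝ] WithLp 2 (Euc N × ℝ)))

theorem mkStateL_apply (q v : Euc N) (η : ℝ) : mkStateL N (q, v, η) = mkState q v η := rfl

/-- The position `q` of `(q, v, η)`. -/
noncomputable def posL (N : ℕ) : State N →L[ℝ] Euc N := WithLp.fstL 2 ℝ _ _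

/-- The velocity `v` of `(q, v, η)`. -/
noncomputable def velL (N : ℕ) : State N →L[ℝ] Euc N :=
  (WithLp.fstL 2 ℝ (Euc N) ℝ) ∘L (WithLp.sndL 2 ℝ (Euc N) (WithLp 2 (Euc N × ℝ)))

/-- The filter state `η` of `(q, v, η)`. -/
noncomputable def auxL (N : ℕ) : State N →L[ℝ] ℝ :=
  (WithLp.sndL 2 ℝ (Euc N) ℝ) ∘L (WithLp.sndL 2 ℝ (Euc N) (WithLp 2 (Euc N × ℝ)))

theorem mkState_eta (x : State N) : mkState x.fst x.snd.fst x.snd.snd = x := rfl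

theorem contDiff_pos {n : WithTop ℕ∞} : ContDiff ℝ n fun x : State N => x.fst := (posL N).contDiff

theorem contDiff_vel {n : WithTop ℕ∞} : ContDiff ℝ n fun x : State N => x.snd.fst :=
  (velL N).contDiff

theorem contDiff_aux {n : WithTop ℕ∞} : ContDiff ℝ n fun x : State N => x.snd.snd :=
  (auxL N).contDiff

theorem contDiffOn_mkState {E : Type*} [NormedAddCommGroup E] [NormedSpace ℝ E] {s : Set E}
    {q v : E → Euc N} {η : E → ℝ} {n : WithTop ℕ∞} (hq : ContDiffOn ℝ n q s)
    (hv : ContDiffOn ℝ n v s) (hη : ContDiffOn ℝ n η s) :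
    ContDiffOn ℝ n (fun x => mkState (q x) (v x) (η x)) s :=
  (mkStateL N).contDiff.comp_contDiffOn (hq.prodMk (hv.prodMk hη))

theorem mem_tangentConeAt_of_hasDerivAt {F : Type*} [NormedAddCommGroup F] [NormedSpace ℝ F]
    {M : Set F} {γ : ℝ → F} {w : F} (hγ : HasDerivAt γ w 0) (hM : ∀ᶠ s in 𝓝 0, γ s ∈ M) :
    w ∈ tangentConeAt ℝ M (γ 0) := by
  have h1 : (1 : ℝ) ∈ tangentConeAt ℝ {s | γ s ∈ M} 0 := by
    rw [tangentConeAt_of_mem_nhds hM]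
    trivial
  have h2 := (hγ.hasFDerivAt.hasFDerivWithinAt (s := {s | γ s ∈ M})).mapsTo_tangent_cone h1
  simp only [ContinuousLinearMap.toSpanSingleton_apply, one_smul] at h2
  exact tangentConeAt_mono (image_subset_iff.2 fun s hs => hs) h2

/-- The base point is retracted to `Q`, and the velocity is then projected orthogonally to the
tangent space at the retracted point. -/
theorem IsLocalRetract.tangentBundleProd (hQ : IsLocalRetract Q) :
    IsLocalRetract (tangentBundleProd Q) := by
  rintro x ⟨hx, -⟩
  obtain ⟨O, r, hO, hqO, hr, hrQ, hid⟩ := hQ x.fst hx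
  have hE := fun a => isSmoothVectorField_extend hQ (EuclideanSpace.single a (1 : ℝ))
  refine ⟨{y | y.fst ∈ O}, fun y => mkState (r y.fst) (extend Q y.snd.fst (r y.fst)) y.snd.snd,
    hO.preimage (posL N).continuous, hqO, ?_, fun y hy => ?_, fun y hy => ?_⟩
  · have hrc : ContDiffOn ℝ ∞ (fun y : State N => r y.fst) {y | y.fst ∈ O} :=
      hr.comp contDiff_pos.contDiffOn fun y hy => hy
    refine contDiffOn_mkState hrc ?_ contDiff_aux.contDiffOn
    simp only [extend_eq_sum Q (WithLp.fst (WithLp.snd _))]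
    refine ContDiffOn.sum fun a _ => ContDiffOn.fun_smul ?_ ?_
    · exact ((EuclideanSpace.proj (𝕜 := ℝ) a).contDiff.comp contDiff_vel).contDiffOn
    · exact (hE a).1.comp hrc fun y hy => (hrQ hy).1
  · exact ⟨⟨(hrQ hy).1, extend_mem _ _ _⟩, (hrQ hy).2⟩
  · have h1 : r y.fst = y.fst := hid _ ⟨hy.1.1, hy.2⟩
    dsimp only
    rw [h1, extend_of_mem hy.1.2, mkState_eta]

/-- Tangent vectors of `TQ × ℝ`. -/
theorem mkState_mem_tangentConeAt (hQ : IsLocalRetract Q) {x : State N}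
    (hx : x ∈ tangentBundleProd Q) {w a : Euc N} (c : ℝ) (hw : w ∈ tangentSpaceAt Q x.fst)
    (ha : extend Q a x.fst + dirDeriv Q (extend Q x.snd.fst) x.fst w = a) :
    mkState w a c ∈ tangentConeAt ℝ (tangentBundleProd Q) x := by
  obtain ⟨O, r, hO, hqO, hr, hrQ, hid⟩ := hQ x.fst hx.1
  have hE := fun a => isSmoothVectorField_extend hQ (EuclideanSpace.single a (1 : ℝ))
  have hline : ∀ v w : Euc N, HasDerivAt (fun s : ℝ => v + s • w) w 0 := fun v w => by
    simpa using ((hasDerivAt_id (0 : ℝ)).smul_const w).const_add v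
  have hq0 : x.fst + (0 : ℝ) • w = x.fst := by simp
  have hcomp : ∀ {G : Type} [NormedAddCommGroup G] [NormedSpace ℝ G] {f : Euc N → G},
      ContDiffOn ℝ ∞ f O → HasDerivAt (fun s : ℝ => f (x.fst + s • w)) (fderiv ℝ f x.fst w) 0 := by
    intro G _ _ f hf
    have h1 : HasFDerivAt f (fderiv ℝ f x.fst) (x.fst + (0 : ℝ) • w) := by
      rw [hq0]
      exact ((hf.contDiffAt (hO.mem_nhds hqO)).differentiableAt (by simp)).hasFDerivAt
    exact h1.comp_hasDerivAt (0 : ℝ) (hline x.fst w)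
  have hd1 := hcomp hr
  rw [fderiv_retraction_apply_of_mem_tangentSpaceAt hO hr hid ⟨hx.1, hqO⟩ hw] at hd1
  -- The line through `x` with direction `(w, a, c)` is retracted to `TQ × ℝ`. The velocity
  -- component of the retracted curve has as derivative the projection of `a` plus the variation of
  -- the projections along `w`, and `ha` says that this is `a`.
  have hd2 : HasDerivAt (fun s : ℝ => extend Q (x.snd.fst + s • a) (r (x.fst + s • w))) a 0 := by
    have h1 : ∀ b : Fin N, HasDerivAt (fun s : ℝ => (x.snd.fst + s • a) b •
        extend Q (EuclideanSpace.single b 1) (r (x.fst + s • w)))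
        (x.snd.fst b • dirDeriv Q (extend Q (EuclideanSpace.single b 1)) x.fst w +
          a b • extend Q (EuclideanSpace.single b 1) x.fst) 0 := by
      intro b
      have hb1 : HasDerivAt (fun s : ℝ => (x.snd.fst + s • a) b) (a b) 0 :=
        (EuclideanSpace.proj (𝕜 := ℝ) b).hasFDerivAt.comp_hasDerivAt (0 : ℝ) (hline x.snd.fst a)
      have hb2 := hcomp (f := fun p => extend Q (EuclideanSpace.single b 1) (r p))
        ((hE b).1.comp hr fun p hp => (hrQ hp).1)
      rw [← dirDeriv_eq_fderiv_comp (hE b).1 hO hr hrQ hid ⟨hx.1, hqO⟩ hw] at hb2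
      have := hb1.fun_smul hb2
      simpa [hid x.fst ⟨hx.1, hqO⟩] using this
    have h2 := HasDerivAt.fun_sum fun b (_ : b ∈ Finset.univ) => h1 b
    rw [Finset.sum_add_distrib, ← dirDeriv_extend_eq_sum hQ _ hx.1 hw, ← extend_eq_sum, add_comm,
      ha] at h2
    simpa only [← extend_eq_sum] using h2
  have hd3 : HasDerivAt (fun s : ℝ => x.snd.snd + s * c) c 0 := by
    simpa using ((hasDerivAt_id (0 : ℝ)).mul_const c).const_add x.snd.snd
  have hγ := (mkStateL N).hasFDerivAt.comp_hasDerivAt (0 : ℝ) (hd1.prodMk (hd2.prodMk hd3))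
  have hev : ∀ᶠ s : ℝ in 𝓝 0, x.fst + s • w ∈ O := by
    refine (hline x.fst w).continuousAt.eventually_mem ?_
    rw [hq0]
    exact hO.mem_nhds hqO
  have key := mem_tangentConeAt_of_hasDerivAt (M := tangentBundleProd Q) hγ
    (hev.mono fun s hs => ⟨(hrQ hs).1, extend_mem _ _ _⟩)
  have h0 : mkState (r (x.fst + (0 : ℝ) • w))
      (extend Q (x.snd.fst + (0 : ℝ) • a) (r (x.fst + (0 : ℝ) • w))) (x.snd.snd + 0 * c) = x := by
    rw [hq0, hid _ ⟨hx.1, hqO⟩, zero_smul, add_zero, extend_of_mem hx.2, zero_mul, add_zero,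
      mkState_eta]
  rw [← h0]
  exact key

/-- Over the closed set `q ∈ Q`, tangency of `v` means that the continuous function `extend Q v q -
v` vanishes. -/
theorem isClosed_tangentBundleProd (hQ : IsLocalRetract Q) (hcl : IsClosed Q) :
    IsClosed (tangentBundleProd Q) := by
  have hE := fun a => isSmoothVectorField_extend hQ (EuclideanSpace.single a (1 : ℝ))
  have h1 : IsClosed {x : State N | x.fst ∈ Q} := hcl.preimage (posL N).continuous
  have h2 : ContinuousOn (fun x : State N => extend Q x.snd.fst x.fst - x.snd.fst)
      {x : State N | x.fst ∈ Q} := by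
    refine ContinuousOn.sub ?_ (velL N).continuous.continuousOn
    simp only [extend_eq_sum Q (WithLp.fst (WithLp.snd _))]
    refine continuousOn_finsetSum _ fun a _ => ContinuousOn.fun_smul ?_ ?_
    · exact ((EuclideanSpace.proj (𝕜 := ℝ) a).continuous.comp (velL N).continuous).continuousOn
    · exact (hE a).1.continuousOn.comp (posL N).continuous.continuousOn fun x hx => hx
  have h3 := h2.preimage_isClosed_of_isClosed h1 (isClosed_singleton (x := 0))
  convert h3 using 1
  ext x
  exact and_congr_right fun _ => by
    rw [mem_tangentSpaceAt_iff, mem_preimage, mem_singleton_iff, sub_eq_zero]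

end TangentBundle

/-! ### Integration by parts for merely measurable dithers. -/

section ProductRule

variable {G : Type*} [NormedAddCommGroup G] [NormedSpace ℝ G]

theorem absolutelyContinuousOnInterval_primitive {g : ℝ → G} {a b B : ℝ} (hab : a ≤ b)
    (hg : IntervalIntegrable g volume a b) (hB : ∀ t ∈ Icc a b, ‖g t‖ ≤ B) :
    AbsolutelyContinuousOnInterval (fun t => ∫ s in a..t, g s) a b := by
  have hB0 : 0 ≤ B := (norm_nonneg _).trans (hB a ⟨le_rfl, hab⟩)
  have hi : ∀ t ∈ Icc a b, IntervalIntegrable g volume a t := fun t ht =>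
    hg.mono_set (uIcc_subset_uIcc left_mem_uIcc (by rw [uIcc_of_le hab]; exact ht))
  refine LipschitzOnWith.absolutelyContinuousOnInterval (K := ⟨B, hB0⟩)
    (LipschitzOnWith.of_dist_le_mul fun s hs t ht => ?_)
  rw [uIcc_of_le hab] at hs ht
  rw [dist_eq_norm, intervalIntegral.integral_interval_sub_left (hi s hs) (hi t ht), Real.dist_eq]
  refine intervalIntegral.norm_integral_le_of_norm_le_const fun σ hσ => hB σ ?_
  have := uIoc_subset_uIcc hσ
  rw [mem_uIcc] at this
  rcases this with h | h
  · exact ⟨ht.1.trans h.1, h.2.trans hs.2⟩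
  · exact ⟨hs.1.trans h.1, h.2.trans ht.2⟩

/-- The product rule in integral form, for a primitive `W` of a bounded function `w` and a primitive
`K` of a continuous function `k`. -/
theorem integral_smul_add_smul_eq_sub [CompleteSpace G] {w W : ℝ → ℝ} {k K : ℝ → G} {a b B : ℝ} (hab : a ≤ b)
    (hw : IntervalIntegrable w volume a b) (hwB : ∀ t, |w t| ≤ B) (hk : ContinuousOn k (Icc a b))
    (hW : ∀ t ∈ Icc a b, W t = W a + ∫ s in a..t, w s)
    (hK : ∀ t ∈ Icc a b, K t = K a + ∫ s in a..t, k s) :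
    IntervalIntegrable (fun s => w s • K s + W s • k s) volume a b ∧
      ∫ s in a..b, (w s • K s + W s • k s) = W b • K b - W a • K a := by
  have hu : uIcc a b = Icc a b := uIcc_of_le hab
  have hki : IntervalIntegrable k volume a b := (hk.mono hu.subset).intervalIntegrable
  have hWc : ContinuousOn W (Icc a b) :=
    (continuousOn_const.add (hu ▸ intervalIntegral.continuousOn_primitive_interval' hw
      left_mem_uIcc)).congr hW
  have hKc : ContinuousOn K (Icc a b) :=
    (continuousOn_const.add (hu ▸ intervalIntegral.continuousOn_primitive_interval' hki
      left_mem_uIcc)).congr hK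
  have hgi : IntervalIntegrable (fun s => w s • K s + W s • k s) volume a b :=
    (hw.smul_continuousOn (hKc.mono hu.subset)).add
      ((hWc.smul hk).mono hu.subset).intervalIntegrable
  refine ⟨hgi, ?_⟩
  obtain ⟨B₁, hB₁⟩ := isCompact_Icc.exists_bound_of_continuousOn hKc
  obtain ⟨B₂, hB₂⟩ := isCompact_Icc.exists_bound_of_continuousOn (hWc.smul hk)
  obtain ⟨B₃, hB₃⟩ := isCompact_Icc.exists_bound_of_continuousOn hk
  have hB0 : 0 ≤ B := (abs_nonneg _).trans (hwB a)
  have acW := (absolutelyContinuousOnInterval_primitive hab hw fun t _ => hwB t).add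
    ((LipschitzWith.const (W a)).lipschitzOnWith.absolutelyContinuousOnInterval (a := a) (b := b))
  have acK := (absolutelyContinuousOnInterval_primitive hab hki hB₃).add
    ((LipschitzWith.const (K a)).lipschitzOnWith.absolutelyContinuousOnInterval (a := a) (b := b))
  have acG := absolutelyContinuousOnInterval_primitive (B := B * B₁ + B₂) hab hgi fun t ht =>
    (norm_add_le _ _).trans (add_le_add (by
      rw [norm_smul]
      exact mul_le_mul (hwB t) (hB₁ t ht) (norm_nonneg _) hB0) (hB₂ t ht))
  -- Since `w` is only integrable, `W` is differentiable only almost everywhere. The difference of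
  -- `W • K` and the primitive of the claimed derivative is absolutely continuous with derivative
  -- zero almost everywhere, hence constant.
  obtain ⟨c, hc⟩ := ((acW.smul acK).sub acG).const_of_ae_hasDerivAt_zero (by
    filter_upwards [hw.ae_hasDerivAt_integral, hki.ae_hasDerivAt_integral,
      hgi.ae_hasDerivAt_integral] with x h1 h2 h3 hx
    have hx' := hx
    rw [hu] at hx'
    have e1 := (h1 hx a left_mem_uIcc).add (hasDerivAt_const x (W a))
    have e2 := (h2 hx a left_mem_uIcc).add (hasDerivAt_const x (K a))
    have e3 := (e1.smul e2).sub (h3 hx a left_mem_uIcc)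
    have hW' := hW x hx'
    have hK' := hK x hx'
    rw [add_comm] at hW' hK'
    convert e3 using 1
    simp only [Pi.add_apply, add_zero, ← hW', ← hK']
    abel)
  have ha := hc a left_mem_uIcc
  have hb := hc b right_mem_uIcc
  have hWb := hW b ⟨hab, le_rfl⟩
  have hKb := hK b ⟨hab, le_rfl⟩
  rw [add_comm] at hWb hKb
  simp only [Pi.sub_apply, Pi.smul_apply', Pi.add_apply, intervalIntegral.integral_same, zero_add,
    sub_zero] at ha hb
  rw [← hWb, ← hKb, ← ha] at hb
  rw [← hb]
  abel

end ProductRule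

/-! ### Antiderivatives of the dither and their means. -/

section Dither

variable {n : ℕ} {T : ℝ} {u : ℝ → Fin n → ℝ}

/-- The zero-mean antiderivative of a dither signal. -/
noncomputable def ditherPrimitive (T : ℝ) (u : ℝ → Fin n → ℝ) (τ : ℝ) : Fin n → ℝ :=
  fun i => zeroMeanAntideriv T (fun s => u s i) τ

namespace IsDither

theorem intervalIntegrable (hu : IsDither T u) (i : Fin n) (a b : ℝ) :
    IntervalIntegrable (fun s => u s i) volume a b := by
  obtain ⟨B, hB⟩ := hu.bounded
  refine (intervalIntegrable_const (c := B)).mono_fun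
    ((measurable_pi_apply i).comp hu.measurable).aestronglyMeasurable
    (Eventually.of_forall fun s => ?_)
  rw [Real.norm_eq_abs]
  exact (hB s i).trans (le_abs_self B)

theorem ditherPrimitive_eq_add (hu : IsDither T u) (i : Fin n) (a b : ℝ) :
    ditherPrimitive T u b i = ditherPrimitive T u a i + ∫ s in a..b, u s i := by
  unfold ditherPrimitive zeroMeanAntideriv
  rw [← intervalIntegral.integral_add_adjacent_intervals (hu.intervalIntegrable i 0 a)
    (hu.intervalIntegrable i a b)]
  ring

theorem continuous_ditherPrimitive (hu : IsDither T u) : Continuous (ditherPrimitive T u) :=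
  continuous_pi fun i => (intervalIntegral.continuous_primitive
    (fun a b => hu.intervalIntegrable i a b) 0).sub continuous_const

theorem periodic_ditherPrimitive (hu : IsDither T u) :
    Function.Periodic (ditherPrimitive T u) T := by
  intro τ
  funext i
  have h1 : Function.Periodic (fun s => u s i) T := fun s => congrFun (hu.periodic s) i
  rw [hu.ditherPrimitive_eq_add i τ, h1.intervalIntegral_add_eq τ 0, zero_add, hu.zero_mean,
    add_zero]

theorem integral_ditherPrimitive (hu : IsDither T u) (i : Fin n) :
    ∫ τ in (0 : ℝ)..T, ditherPrimitive T u τ i = 0 := by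
  have hT := hu.period_pos
  have hc : Continuous fun τ => ∫ s in (0 : ℝ)..τ, u s i :=
    intervalIntegral.continuous_primitive (fun a b => hu.intervalIntegrable i a b) 0
  unfold ditherPrimitive zeroMeanAntideriv
  rw [intervalIntegral.integral_sub (hc.intervalIntegrable _ _) intervalIntegrable_const,
    intervalIntegral.integral_const, smul_eq_mul, sub_zero, ← mul_assoc,
    mul_one_div_cancel hT.ne', one_mul, sub_self]

/-- The mean of a quadratic polynomial in the antiderivatives of a dither signal. -/
theorem average_quadratic (hu : IsDither T u) {G : Type*} [NormedAddCommGroup G] [NormedSpace ℝ G]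
    [CompleteSpace G] (A₀ : G) (A₁ : Fin n → G) (A₂ : Fin n → Fin n → G) :
    (1 / T) • ∫ τ in (0 : ℝ)..T, (A₀ + ∑ i, ditherPrimitive T u τ i • A₁ i +
      ∑ i, ∑ j, (ditherPrimitive T u τ i * ditherPrimitive T u τ j) • A₂ i j) =
      A₀ + ∑ i, A₂ i i := by
  have hT := hu.period_pos
  have hc : ∀ i, Continuous fun τ => ditherPrimitive T u τ i := fun i =>
    (continuous_apply i).comp hu.continuous_ditherPrimitive
  have h1 : ∀ i, Continuous fun τ => ditherPrimitive T u τ i • A₁ i := fun i =>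
    (hc i).smul continuous_const
  have h2 : ∀ i j, Continuous fun τ =>
      (ditherPrimitive T u τ i * ditherPrimitive T u τ j) • A₂ i j := fun i j =>
    ((hc i).mul (hc j)).smul continuous_const
  have h1s : Continuous fun τ => ∑ i, ditherPrimitive T u τ i • A₁ i :=
    continuous_finsetSum _ fun i _ => h1 i
  have h2s : ∀ i, Continuous fun τ =>
      ∑ j, (ditherPrimitive T u τ i * ditherPrimitive T u τ j) • A₂ i j := fun i =>
    continuous_finsetSum _ fun j _ => h2 i j
  have h2ss : Continuous fun τ =>
      ∑ i, ∑ j, (ditherPrimitive T u τ i * ditherPrimitive T u τ j) • A₂ i j :=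
    continuous_finsetSum _ fun i _ => h2s i
  have h01 : Continuous fun τ => A₀ + ∑ i, ditherPrimitive T u τ i • A₁ i :=
    continuous_const.add h1s
  rw [intervalIntegral.integral_add (h01.intervalIntegrable _ _)
    (h2ss.intervalIntegrable _ _), intervalIntegral.integral_add intervalIntegrable_const
    (h1s.intervalIntegrable _ _), intervalIntegral.integral_const,
    intervalIntegral.integral_finsetSum fun i _ => (h1 i).intervalIntegrable _ _,
    intervalIntegral.integral_finsetSum fun i _ => (h2s i).intervalIntegrable _ _]
  -- The linear terms vanish because the antiderivatives have zero mean; orthonormality will leave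
  -- only the diagonal of the quadratic terms.
  simp only [intervalIntegral.integral_finsetSum fun j _ => (h2 _ j).intervalIntegrable _ _,
    intervalIntegral.integral_smul_const, hu.integral_ditherPrimitive, zero_smul,
    Finset.sum_const_zero, add_zero, sub_zero, smul_add, smul_smul, Finset.smul_sum,
    one_div_mul_cancel hT.ne', one_smul]
  congr 1
  refine Finset.sum_congr rfl fun i _ => ?_
  have h3 : ∀ j, 1 / T * ∫ τ in (0 : ℝ)..T, ditherPrimitive T u τ i * ditherPrimitive T u τ j =
      if i = j then 1 else 0 := fun j => hu.orthonormal i j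
  simp only [h3, ite_smul, one_smul, zero_smul, Finset.sum_ite_eq, Finset.mem_univ, if_true]

end IsDither

end Dither

/-! ### The transformed system: smoothness, tangency and mean value. -/

section System

variable {N n : ℕ} {Q : Set (Euc N)}

/-- The data of an extremum seeking system: all functions are smooth. -/
structure IsSmoothSystem (Q : Set (Euc N)) (Y₀ : Euc N → Euc N) (Y : Fin n → Euc N → Euc N)
    (R : Euc N → Euc N →ₗ[ℝ] Euc N) (ψ : Euc N → ℝ) (α : ℝ → ℝ) : Prop where
  isLocalRetract : IsLocalRetract Q
  drift : IsSmoothVectorField Q Y₀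
  control : ∀ i, IsSmoothVectorField Q (Y i)
  damping : IsSmoothBundleMap Q R
  output : ContDiffOn ℝ ∞ ψ Q
  gain : ContDiff ℝ ∞ α

/-- The velocity shift `∑ U_i λ_i α(ψ - η) Y_i`. -/
noncomputable def ditherShift (Y : Fin n → Euc N → Euc N) (ψ : Euc N → ℝ) (α : ℝ → ℝ)
    (lam : Fin n → ℝ) (U : Fin n → ℝ) (q : Euc N) (η : ℝ) : Euc N :=
  ∑ i, (U i * lam i * α (ψ q - η)) • Y i q

/-- The derivative of `α(ψ(q) - η) X(q)` along a curve with `q̇ = w` and `η̇ = -h η + h ψ(q)`. -/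
noncomputable def gainDeriv (Q : Set (Euc N)) (X : Euc N → Euc N) (ψ : Euc N → ℝ) (α : ℝ → ℝ)
    (h : ℝ) (q w : Euc N) (η : ℝ) : Euc N :=
  (deriv α (ψ q - η) * (dirDeriv Q ψ q w - (-h * η + h * ψ q))) • X q +
    α (ψ q - η) • dirDeriv Q X q w

/-- The part of the acceleration of the closed-loop system which does not oscillate. -/
noncomputable def slowForce (C : AffineConnection Q) (Y₀ : Euc N → Euc N)
    (Y : Fin n → Euc N → Euc N) (R : Euc N → Euc N →ₗ[ℝ] Euc N) (ψ : Euc N → ℝ) (α : ℝ → ℝ)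
    (lam mu : Fin n → ℝ) (q w : Euc N) (η : ℝ) : Euc N :=
  C.spray q w + (Y₀ q - R q w + ∑ i, (mu i * lam i ^ 2 * α (ψ q - η) ^ 2) • Y i q)

/-- The closed-loop system in the variables given by `shiftVelocity`, as a function of the value `U`
of the antiderivative of the dither and of the state. -/
noncomputable def transformedField (C : AffineConnection Q) (Y₀ : Euc N → Euc N)
    (Y : Fin n → Euc N → Euc N) (R : Euc N → Euc N →ₗ[ℝ] Euc N) (ψ : Euc N → ℝ) (α : ℝ → ℝ)
    (lam mu : Fin n → ℝ) (h : ℝ) (p : (Fin n → ℝ) × State N) : State N :=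
  let q := p.2.fst
  let η := p.2.snd.snd
  let w := p.2.snd.fst + ditherShift Y ψ α lam p.1 q η
  mkState w (slowForce C Y₀ Y R ψ α lam mu q w η -
    ∑ i, (p.1 i * lam i) • gainDeriv Q (Y i) ψ α h q w η) (-h * η + h * ψ q)

variable {C : AffineConnection Q} {Y₀ : Euc N → Euc N} {Y : Fin n → Euc N → Euc N}
  {R : Euc N → Euc N →ₗ[ℝ] Euc N} {ψ : Euc N → ℝ} {α : ℝ → ℝ} {lam mu : Fin n → ℝ} {h T : ℝ}
  {u : ℝ → Fin n → ℝ}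

theorem IsSmoothSystem.ditherShift_mem (hs : IsSmoothSystem Q Y₀ Y R ψ α) (U : Fin n → ℝ)
    {q : Euc N} (hq : q ∈ Q) (η : ℝ) : ditherShift Y ψ α lam U q η ∈ tangentSpaceAt Q q :=
  Submodule.sum_mem _ fun i _ => Submodule.smul_mem _ _ ((hs.control i).2 q hq)

namespace IsSmoothSystem

section Smoothness

variable {E : Type*} [NormedAddCommGroup E] [NormedSpace ℝ E] {s : Set E} {q w : E → Euc N}
  {η : E → ℝ} {U : E → Fin n → ℝ}

theorem contDiffOn_gain (hs : IsSmoothSystem Q Y₀ Y R ψ α) (hq : ContDiffOn ℝ ∞ q s)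
    (hqQ : MapsTo q s Q) (hη : ContDiffOn ℝ ∞ η s) {β : ℝ → ℝ} (hβ : ContDiff ℝ ∞ β) :
    ContDiffOn ℝ ∞ (fun x => β (ψ (q x) - η x)) s :=
  hβ.comp_contDiffOn ((hs.output.comp hq hqQ).sub hη)

theorem contDiffOn_ditherShift (hs : IsSmoothSystem Q Y₀ Y R ψ α) (hq : ContDiffOn ℝ ∞ q s)
    (hqQ : MapsTo q s Q) (hη : ContDiffOn ℝ ∞ η s) (hU : ContDiffOn ℝ ∞ U s) :
    ContDiffOn ℝ ∞ (fun x => ditherShift Y ψ α lam (U x) (q x) (η x)) s := by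
  refine ContDiffOn.sum fun i _ => ContDiffOn.fun_smul (ContDiffOn.mul ?_ ?_) ?_
  · exact (contDiffOn_pi.1 hU i).mul contDiffOn_const
  · exact hs.contDiffOn_gain hq hqQ hη hs.gain
  · exact (hs.control i).1.comp hq hqQ

theorem contDiffOn_gainDeriv (hs : IsSmoothSystem Q Y₀ Y R ψ α) (i : Fin n)
    (hq : ContDiffOn ℝ ∞ q s) (hqQ : MapsTo q s Q) (hw : ContDiffOn ℝ ∞ w s)
    (hwT : ∀ x ∈ s, w x ∈ tangentSpaceAt Q (q x)) (hη : ContDiffOn ℝ ∞ η s) :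
    ContDiffOn ℝ ∞ (fun x => gainDeriv Q (Y i) ψ α h (q x) (w x) (η x)) s := by
  have hm : MapsTo (fun x => (q x, w x)) s {p | p.1 ∈ Q ∧ p.2 ∈ tangentSpaceAt Q p.1} :=
    fun x hx => ⟨hqQ hx, hwT x hx⟩
  have hψ := hs.output.comp hq hqQ
  refine ContDiffOn.add (ContDiffOn.fun_smul (ContDiffOn.mul ?_ (ContDiffOn.sub ?_ ?_)) ?_)
    (ContDiffOn.fun_smul ?_ ?_)
  · exact hs.contDiffOn_gain hq hqQ hη (contDiff_infty_iff_deriv.1 hs.gain).2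
  · exact (contDiffOn_dirDeriv hs.isLocalRetract hs.output).comp (hq.prodMk hw) hm
  · exact (contDiffOn_const.mul hη).add (contDiffOn_const.mul hψ)
  · exact (hs.control i).1.comp hq hqQ
  · exact hs.contDiffOn_gain hq hqQ hη hs.gain
  · exact (contDiffOn_dirDeriv hs.isLocalRetract (hs.control i).1).comp (hq.prodMk hw) hm

theorem contDiffOn_slowForce (hs : IsSmoothSystem Q Y₀ Y R ψ α)
    (hq : ContDiffOn ℝ ∞ q s) (hqQ : MapsTo q s Q) (hw : ContDiffOn ℝ ∞ w s)
    (hwT : ∀ x ∈ s, w x ∈ tangentSpaceAt Q (q x)) (hη : ContDiffOn ℝ ∞ η s) :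
    ContDiffOn ℝ ∞ (fun x => slowForce C Y₀ Y R ψ α lam mu (q x) (w x) (η x)) s := by
  have hm : MapsTo (fun x => (q x, w x)) s {p | p.1 ∈ Q ∧ p.2 ∈ tangentSpaceAt Q p.1} :=
    fun x hx => ⟨hqQ hx, hwT x hx⟩
  have h1 := (AffineConnection.contDiffOn_spray (C := C) hs.isLocalRetract).comp
    (hq.prodMk hw) hm
  simp only [Function.comp_def] at h1
  have h2 : ContDiffOn ℝ ∞ (fun x => Y₀ (q x)) s := hs.drift.1.comp hq hqQ
  have h3 : ContDiffOn ℝ ∞ (fun x => R (q x) (w x)) s := hs.damping.2.comp (hq.prodMk hw) hm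
  have h4 : ContDiffOn ℝ ∞
      (fun x => ∑ i, (mu i * lam i ^ 2 * α (ψ (q x) - η x) ^ 2) • Y i (q x)) s :=
    ContDiffOn.sum fun i _ => ContDiffOn.fun_smul
      (contDiffOn_const.mul ((hs.contDiffOn_gain hq hqQ hη hs.gain).pow 2))
      ((hs.control i).1.comp hq hqQ)
  exact h1.add ((h2.sub h3).add h4)

end Smoothness

theorem contDiffOn_transformedField (hs : IsSmoothSystem Q Y₀ Y R ψ α) :
    ContDiffOn ℝ ∞ (transformedField C Y₀ Y R ψ α lam mu h) (univ ×ˢ tangentBundleProd Q) := by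
  have hq : ContDiffOn ℝ ∞ (fun p : (Fin n → ℝ) × State N => p.2.fst)
      (univ ×ˢ tangentBundleProd Q) := (contDiff_pos.comp contDiff_snd).contDiffOn
  have hv : ContDiffOn ℝ ∞ (fun p : (Fin n → ℝ) × State N => p.2.snd.fst)
      (univ ×ˢ tangentBundleProd Q) := (contDiff_vel.comp contDiff_snd).contDiffOn
  have hη : ContDiffOn ℝ ∞ (fun p : (Fin n → ℝ) × State N => p.2.snd.snd)
      (univ ×ˢ tangentBundleProd Q) := (contDiff_aux.comp contDiff_snd).contDiffOn
  have hU : ContDiffOn ℝ ∞ (fun p : (Fin n → ℝ) × State N => p.1)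
      (univ ×ˢ tangentBundleProd Q) := contDiff_fst.contDiffOn
  have hqQ : MapsTo (fun p : (Fin n → ℝ) × State N => p.2.fst)
      (univ ×ˢ tangentBundleProd Q) Q := fun p hp => hp.2.1
  have hw := hv.add (hs.contDiffOn_ditherShift (lam := lam) hq hqQ hη hU)
  have hwT : ∀ p ∈ (univ ×ˢ tangentBundleProd Q : Set ((Fin n → ℝ) × State N)),
      p.2.snd.fst + ditherShift Y ψ α lam p.1 p.2.fst p.2.snd.snd ∈ tangentSpaceAt Q p.2.fst :=
    fun p hp => Submodule.add_mem _ hp.2.2 (hs.ditherShift_mem p.1 hp.2.1 _)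
  refine contDiffOn_mkState hw ((hs.contDiffOn_slowForce hq hqQ hw hwT hη).sub
    (ContDiffOn.sum fun i _ => ContDiffOn.fun_smul ((contDiffOn_pi.1 hU i).mul contDiffOn_const)
      (hs.contDiffOn_gainDeriv i hq hqQ hw hwT hη)))
    ((contDiffOn_const.mul hη).add (contDiffOn_const.mul (hs.output.comp hq hqQ)))

/-- Let `II` map a vector to the derivative along `w` of its projections. The slow force has normal
part `II w`, and the derivative of the velocity shift has normal part `II` of the shift. Their
difference is `II` of the shifted velocity `w - ditherShift`, which is exactly what
`mkState_mem_tangentConeAt` requires. -/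
theorem transformedField_mem_tangentConeAt (hs : IsSmoothSystem Q Y₀ Y R ψ α) (U : Fin n → ℝ)
    {x : State N} (hx : x ∈ tangentBundleProd Q) :
    transformedField C Y₀ Y R ψ α lam mu h (U, x) ∈ tangentConeAt ℝ (tangentBundleProd Q) x := by
  have hQ := hs.isLocalRetract
  set q := x.fst with hq
  set η := x.snd.snd with hη
  set w := x.snd.fst + ditherShift Y ψ α lam U q η with hw
  have hqQ : q ∈ Q := hx.1
  have hwT : w ∈ tangentSpaceAt Q q :=
    Submodule.add_mem _ hx.2 (hs.ditherShift_mem U hx.1 _)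
  refine mkState_mem_tangentConeAt hQ hx _ hwT ?_
  change extend Q (slowForce C Y₀ Y R ψ α lam mu q w η -
    ∑ i, (U i * lam i) • gainDeriv Q (Y i) ψ α h q w η) q + dirDeriv Q (extend Q x.snd.fst) q w = _
  -- the linear maps `P` (tangential projection) and `II` (derivative of the projections)
  set P : Euc N →L[ℝ] Euc N := (tangentSpaceAt Q q).starProjection with hP
  have hPe : ∀ v, extend Q v q = P v := fun v => rfl
  obtain ⟨II, hII⟩ : ∃ II : Euc N →ₗ[ℝ] Euc N, ∀ v, dirDeriv Q (extend Q v) q w = II v := by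
    refine ⟨∑ a, ((EuclideanSpace.proj (𝕜 := ℝ) a : Euc N →L[ℝ] ℝ) : Euc N →ₗ[ℝ] ℝ).smulRight
      (dirDeriv Q (extend Q (EuclideanSpace.single a 1)) q w), fun v => ?_⟩
    rw [dirDeriv_extend_eq_sum hQ v hqQ hwT]
    simp [LinearMap.sum_apply]
  have hPT : ∀ v ∈ tangentSpaceAt Q q, P v = v := fun v hv => extend_of_mem hv
  have hspray : C.spray q w = P (C.spray q w) + II w := by
    rw [← hPe, ← hII, AffineConnection.extend_spray_add hQ hqQ hwT]
  have hforce : P (Y₀ q - R q w + ∑ i, (mu i * lam i ^ 2 * α (ψ q - η) ^ 2) • Y i q) =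
      Y₀ q - R q w + ∑ i, (mu i * lam i ^ 2 * α (ψ q - η) ^ 2) • Y i q :=
    hPT _ (Submodule.add_mem _ (Submodule.sub_mem _ (hs.drift.2 q hqQ)
      (hs.damping.1 q hqQ w hwT)) (Submodule.sum_mem _ fun i _ =>
        Submodule.smul_mem _ _ ((hs.control i).2 q hqQ)))
  have hgain : ∀ i, gainDeriv Q (Y i) ψ α h q w η =
      P (gainDeriv Q (Y i) ψ α h q w η) + α (ψ q - η) • II (Y i q) := by
    intro i
    have h1 := (hs.control i).dirDeriv_eq_add hQ hqQ hwT
    rw [hPe, hII] at h1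
    unfold gainDeriv
    rw [map_add, map_smul, map_smul, hPT _ ((hs.control i).2 q hqQ), add_assoc, ← smul_add, ← h1]
  have hIIw : II w = II x.snd.fst +
      ∑ i, (U i * lam i) • α (ψ q - η) • II (Y i q) := by
    rw [hw, map_add, ditherShift, map_sum]
    simp only [map_smul, mul_smul]
  have hsum : ∑ i, (U i * lam i) • gainDeriv Q (Y i) ψ α h q w η =
      P (∑ i, (U i * lam i) • gainDeriv Q (Y i) ψ α h q w η) +
        ∑ i, (U i * lam i) • α (ψ q - η) • II (Y i q) := by
    rw [map_sum, ← Finset.sum_add_distrib]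
    refine Finset.sum_congr rfl fun i _ => ?_
    rw [map_smul, ← smul_add, ← hgain]
  have hslow : slowForce C Y₀ Y R ψ α lam mu q w η =
      P (slowForce C Y₀ Y R ψ α lam mu q w η) + II w := by
    unfold slowForce
    rw [P.map_add (C.spray q w), hforce, add_right_comm, ← hspray]
  rw [hPe, hII, map_sub]
  calc _ = (P (slowForce C Y₀ Y R ψ α lam mu q w η) + II w) -
        (P (∑ i, (U i * lam i) • gainDeriv Q (Y i) ψ α h q w η) +
          ∑ i, (U i * lam i) • α (ψ q - η) • II (Y i q)) := by rw [hIIw]; abel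
    _ = _ := by rw [← hslow, ← hsum]

theorem isOscillatingField (hs : IsSmoothSystem Q Y₀ Y R ψ α) (hu : IsDither T u) :
    IsOscillatingField (tangentBundleProd Q) (transformedField C Y₀ Y R ψ α lam mu h)
      (ditherPrimitive T u) T where
  isLocalRetract := hs.isLocalRetract.tangentBundleProd
  contDiffOn := hs.contDiffOn_transformedField.of_le (by simp)
  tangent U _ hx := hs.transformedField_mem_tangentConeAt U hx
  continuous := hu.continuous_ditherPrimitive
  period_pos := hu.period_pos
  periodic := hu.periodic_ditherPrimitive

/-- The averaged system is the mean of the transformed system. -/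
theorem averagedSystem_eq (hs : IsSmoothSystem Q Y₀ Y R ψ α) (hu : IsDither T u) (t : ℝ)
    {x : State N} (hx : x ∈ tangentBundleProd Q) :
    averagedSystem C Y₀ Y R ψ α lam mu h t x = (1 / T) • ∫ τ in (0 : ℝ)..T,
      transformedField C Y₀ Y R ψ α lam mu h (ditherPrimitive T u τ, x) := by
  have hQ := hs.isLocalRetract
  set q := x.fst with hq
  set v := x.snd.fst with hv
  set η := x.snd.snd with hη
  have hqQ : q ∈ Q := hx.1
  set B := C.sprayBilin q with hB
  set a₀ := α (ψ q - η) with ha₀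
  set a₁ := deriv α (ψ q - η) with ha₁
  set κ := -h * η + h * ψ q with hκ
  set c : Fin n → Euc N := fun i => (lam i * a₀) • Y i q with hc
  set F := Y₀ q - R q v + ∑ i, (mu i * lam i ^ 2 * a₀ ^ 2) • Y i q with hF
  set e : Fin n → Fin n → Euc N := fun i j =>
    (a₁ * dirDeriv Q ψ q (c j)) • Y i q + a₀ • dirDeriv Q (Y i) q (c j) with he
  set g : Fin n → Euc N := fun i => gainDeriv Q (Y i) ψ α h q v η with hg
  have hshift : ∀ U : Fin n → ℝ, ditherShift Y ψ α lam U q η = ∑ i, U i • c i := fun U => by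
    simp only [ditherShift, hc, smul_smul, mul_assoc, ha₀]
  -- Expansion in powers of `U` at the velocity `v + ∑ U i • c i`: the spray contributes up to
  -- second order through `B`; the damping is linear and `gainDeriv` affine in the velocity, the
  -- latter being multiplied by one more factor `U i`.
  have hexp : ∀ U : Fin n → ℝ, transformedField C Y₀ Y R ψ α lam mu h (U, x) =
      mkStateL N (v, B v v + F, κ) +
      ∑ i, U i • mkStateL N (c i, B (c i) v + B v (c i) - R q (c i) - lam i • g i, 0) +
      ∑ i, ∑ j, (U i * U j) • mkStateL N (0, B (c i) (c j) - lam i • e i j, 0) := by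
    intro U
    have hwT : v + ditherShift Y ψ α lam U q η ∈ tangentSpaceAt Q q :=
      Submodule.add_mem _ hx.2 (hs.ditherShift_mem U hqQ _)
    have h1 : C.spray q (v + ditherShift Y ψ α lam U q η) = B v v +
        (∑ i, U i • B (c i) v + ∑ i, U i • B v (c i)) + ∑ i, ∑ j, (U i * U j) • B (c i) (c j) := by
      rw [AffineConnection.spray_eq_sprayBilin hQ hqQ hwT, hshift, ← hB]
      simp only [map_add, map_sum, map_smul, LinearMap.add_apply, LinearMap.sum_apply,
        LinearMap.smul_apply, Finset.smul_sum, Finset.sum_add_distrib, smul_smul, smul_add]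
      rw [Finset.sum_comm (f := fun i j => (U i * U j) • B (c j) (c i))]
      simp only [fun i j => mul_comm (U j) (U i)]
      abel
    have h2 : R q (v + ditherShift Y ψ α lam U q η) = R q v + ∑ i, U i • R q (c i) := by
      rw [hshift, map_add, map_sum]
      simp only [map_smul]
    have h3 : ∀ i, gainDeriv Q (Y i) ψ α h q (v + ditherShift Y ψ α lam U q η) η =
        g i + ∑ j, U j • e i j := by
      intro i
      simp only [hg, he, gainDeriv, dirDeriv, hshift, map_add, map_sum, map_smul, smul_add,
        Finset.sum_add_distrib, Finset.smul_sum, ← ha₀, ← ha₁, ← hκ, smul_eq_mul]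
      have h4 : (a₁ * (fderivWithin ℝ ψ Q q v + ∑ j, U j * fderivWithin ℝ ψ Q q (c j) - κ)) • Y i q =
          (a₁ * (fderivWithin ℝ ψ Q q v - κ)) • Y i q +
            ∑ j, U j • (a₁ * fderivWithin ℝ ψ Q q (c j)) • Y i q := by
        simp only [smul_smul, ← Finset.sum_smul, ← add_smul]
        congr 1
        rw [add_sub_right_comm, mul_add, Finset.mul_sum]
        congr 1
        exact Finset.sum_congr rfl fun j _ => by ring
      rw [h4]
      simp only [smul_comm a₀]
      abel
    have h4 : slowForce C Y₀ Y R ψ α lam mu q (v + ditherShift Y ψ α lam U q η) η -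
        ∑ i, (U i * lam i) • gainDeriv Q (Y i) ψ α h q (v + ditherShift Y ψ α lam U q η) η =
        B v v + F + ∑ i, U i • (B (c i) v + B v (c i) - R q (c i) - lam i • g i) +
          ∑ i, ∑ j, (U i * U j) • (B (c i) (c j) - lam i • e i j) := by
      unfold slowForce
      rw [h1, h2, hF]
      simp only [h3, smul_add, smul_sub, Finset.sum_add_distrib, Finset.sum_sub_distrib,
        Finset.smul_sum, smul_smul, mul_right_comm _ (lam _) (U _), ← ha₀]
      abel
    have h5 : transformedField C Y₀ Y R ψ α lam mu h (U, x) =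
        mkStateL N (v + ∑ i, U i • c i,
          B v v + F + ∑ i, U i • (B (c i) v + B v (c i) - R q (c i) - lam i • g i) +
          ∑ i, ∑ j, (U i * U j) • (B (c i) (c j) - lam i • e i j), κ) := by
      rw [← h4, ← hshift]
      rfl
    rw [h5]
    simp only [← map_smul, ← map_sum, ← map_add]
    congr 1
    refine Prod.ext ?_ (Prod.ext ?_ ?_) <;>
      simp [Prod.fst_sum, Prod.snd_sum]
  simp only [hexp]
  rw [hu.average_quadratic, ← map_sum, ← map_add]
  -- The ordinary derivative of `Y i` along itself comes from the spray and from `e i i` with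
  -- opposite signs and cancels; the covariant derivative and the derivative of the gain remain.
  have hdiag : ∀ i, B (c i) (c i) - lam i • e i i =
      -((lam i ^ 2 * a₀ ^ 2) • C.nabla (Y i) (Y i) q) -
        (a₀ * a₁ * (lam i ^ 2 * dirDeriv Q ψ q (Y i q))) • Y i q := by
    intro i
    have h1 : B (Y i q) (Y i q) = dirDeriv Q (Y i) q (Y i q) - C.nabla (Y i) (Y i) q :=
      AffineConnection.sprayBilin_vectorField hQ (hs.control i) hqQ
    simp only [he, hc, dirDeriv, map_smul, LinearMap.smul_apply, smul_eq_mul] at h1 ⊢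
    rw [h1]
    module
  change mkState v _ κ = mkStateL N _
  rw [← mkStateL_apply]
  congr 1
  refine Prod.ext ?_ (Prod.ext ?_ ?_)
  · simp [Prod.fst_sum]
  · simp only [Prod.snd_add, Prod.fst_add, Prod.snd_sum, Prod.fst_sum, hdiag]
    rw [AffineConnection.spray_eq_sprayBilin hQ hqQ hx.2, ← hB, hF]
    simp only [AffineConnection.symProd, Finset.smul_sum, smul_smul, smul_add,
      Finset.sum_sub_distrib, Finset.sum_neg_distrib, Finset.sum_add_distrib]
    have h2 : ∑ i, (1 / 2 * a₀ ^ 2 * lam i ^ 2) • C.nabla (Y i) (Y i) q +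
        ∑ i, (1 / 2 * a₀ ^ 2 * lam i ^ 2) • C.nabla (Y i) (Y i) q =
        ∑ i, (lam i ^ 2 * a₀ ^ 2) • C.nabla (Y i) (Y i) q := by
      rw [← Finset.sum_add_distrib]
      exact Finset.sum_congr rfl fun i _ => by rw [← add_smul]; congr 1; ring
    have h3 : ∑ i, (a₀ ^ 2 * (lam i ^ 2 * mu i)) • Y i q =
        ∑ i, (mu i * lam i ^ 2 * a₀ ^ 2) • Y i q :=
      Finset.sum_congr rfl fun i _ => by congr 1; ring
    rw [h2, h3]
    abel
  · simp [Prod.snd_sum]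

end IsSmoothSystem

end System

/-! ### Equivalence of the closed-loop and the transformed system. -/

section ChangeOfVariables

variable {N n : ℕ} {Q : Set (Euc N)} {C : AffineConnection Q} {Y₀ : Euc N → Euc N}
  {Y : Fin n → Euc N → Euc N} {R : Euc N → Euc N →ₗ[ℝ] Euc N} {ψ : Euc N → ℝ} {α : ℝ → ℝ}
  {lam mu : Fin n → ℝ} {h T : ℝ} {u : ℝ → Fin n → ℝ} {om : ℝ}

/-- The inverse of `shiftVelocity`. -/
noncomputable def unshiftVelocity (Y : Fin n → Euc N → Euc N) (ψ : Euc N → ℝ) (α : ℝ → ℝ)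
    (T : ℝ) (u : ℝ → Fin n → ℝ) (lam : Fin n → ℝ) (om t : ℝ) (y : State N) : State N :=
  mkState y.fst
    (y.snd.fst + ditherShift Y ψ α lam (ditherPrimitive T u (om * t)) y.fst y.snd.snd) y.snd.snd

theorem shiftVelocity_unshiftVelocity (t : ℝ) (y : State N) :
    shiftVelocity Y ψ α T u lam om t (unshiftVelocity Y ψ α T u lam om t y) = y := by
  change mkState y.fst ((y.snd.fst +
    ditherShift Y ψ α lam (ditherPrimitive T u (om * t)) y.fst y.snd.snd) -
    ditherShift Y ψ α lam (ditherPrimitive T u (om * t)) y.fst y.snd.snd) y.snd.snd = y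
  rw [add_sub_cancel_right, mkState_eta]

theorem unshiftVelocity_shiftVelocity (t : ℝ) (x : State N) :
    unshiftVelocity Y ψ α T u lam om t (shiftVelocity Y ψ α T u lam om t x) = x := by
  change mkState x.fst ((x.snd.fst -
    ditherShift Y ψ α lam (ditherPrimitive T u (om * t)) x.fst x.snd.snd) +
    ditherShift Y ψ α lam (ditherPrimitive T u (om * t)) x.fst x.snd.snd) x.snd.snd = x
  rw [sub_add_cancel, mkState_eta]

theorem IsSolutionOn.apply_eq_add_integral {G : Type*} [NormedAddCommGroup G] [NormedSpace ℝ G]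
    [CompleteSpace G] {M : Set (State N)} {f : ℝ → State N → State N} {t₀ t : ℝ} {I : Set ℝ}
    {x : ℝ → State N} (hx : IsSolutionOn M f t₀ I x) (ht : t ∈ I) (L : State N →L[ℝ] G) :
    L (x t) = L (x t₀) + ∫ s in t₀..t, L (f s (x s)) := by
  obtain ⟨-, h1, h2⟩ := hx t ht
  rw [L.intervalIntegral_comp_comm h1, ← map_add, ← h2]

namespace IsSmoothSystem

theorem mapsTo_shiftVelocity (hs : IsSmoothSystem Q Y₀ Y R ψ α) (t : ℝ) :
    MapsTo (shiftVelocity Y ψ α T u lam om t) (tangentBundleProd Q) (tangentBundleProd Q) :=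
  fun _ hx => ⟨hx.1, Submodule.sub_mem _ hx.2 (hs.ditherShift_mem _ hx.1 _)⟩

theorem mapsTo_unshiftVelocity (hs : IsSmoothSystem Q Y₀ Y R ψ α) (t : ℝ) :
    MapsTo (unshiftVelocity Y ψ α T u lam om t) (tangentBundleProd Q) (tangentBundleProd Q) :=
  fun _ hx => ⟨hx.1, Submodule.add_mem _ hx.2 (hs.ditherShift_mem _ hx.1 _)⟩

/-- `gainDeriv` is the derivative of `α(ψ(q) - η) X(q)` along curves. -/
theorem hasDerivAt_gain (hs : IsSmoothSystem Q Y₀ Y R ψ α) (i : Fin n) {q : ℝ → Euc N} {η : ℝ → ℝ}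
    {w : Euc N} {t : ℝ} (hqQ : ∀ᶠ s in 𝓝 t, q s ∈ Q) (hq : HasDerivAt q w t)
    (hη : HasDerivAt η (-h * η t + h * ψ (q t)) t) :
    HasDerivAt (fun s => α (ψ (q s) - η s) • Y i (q s)) (gainDeriv Q (Y i) ψ α h (q t) w (η t)) t := by
  have hcomp : ∀ {G : Type} [NormedAddCommGroup G] [NormedSpace ℝ G] {f : Euc N → G},
      ContDiffOn ℝ ∞ f Q → HasDerivAt (fun s => f (q s)) (dirDeriv Q f (q t) w) t := by
    intro G _ _ f hf
    have h1 := (hasFDerivWithinAt_of_contDiffOn hf hqQ.self_of_nhds).comp_hasDerivWithinAt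
      (s := q ⁻¹' Q) t hq.hasDerivWithinAt fun s hs => hs
    exact h1.hasDerivAt hqQ
  have hα := (hs.gain.differentiable (by simp) (ψ (q t) - η t)).hasDerivAt
  have h1 := (hα.comp t ((hcomp hs.output).sub hη)).smul (hcomp (hs.control i).1)
  rw [add_comm] at h1
  exact h1

/-- The fundamental theorem of calculus for `α(ψ(q) - η) X(q)`. -/
theorem gain_eq_add_integral (hs : IsSmoothSystem Q Y₀ Y R ψ α) (i : Fin n) {x : ℝ → State N}
    {t₀ t₁ : ℝ} (hx : ContinuousOn x (Icc t₀ t₁))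
    (hxM : ∀ t ∈ Icc t₀ t₁, x t ∈ tangentBundleProd Q)
    (hq : ∀ t ∈ Icc t₀ t₁, (x t).fst = (x t₀).fst + ∫ s in t₀..t, (x s).snd.fst)
    (hη : ∀ t ∈ Icc t₀ t₁, (x t).snd.snd = (x t₀).snd.snd +
      ∫ s in t₀..t, (-h * (x s).snd.snd + h * ψ (x s).fst)) :
    ContinuousOn (fun s => gainDeriv Q (Y i) ψ α h (x s).fst (x s).snd.fst (x s).snd.snd)
      (Icc t₀ t₁) ∧
    ∀ t ∈ Icc t₀ t₁, α (ψ (x t).fst - (x t).snd.snd) • Y i (x t).fst =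
      α (ψ (x t₀).fst - (x t₀).snd.snd) • Y i (x t₀).fst +
        ∫ s in t₀..t, gainDeriv Q (Y i) ψ α h (x s).fst (x s).snd.fst (x s).snd.snd := by
  have hqc : ContinuousOn (fun s => (x s).fst) (Icc t₀ t₁) :=
    (posL N).continuous.comp_continuousOn hx
  have hvc : ContinuousOn (fun s => (x s).snd.fst) (Icc t₀ t₁) :=
    (velL N).continuous.comp_continuousOn hx
  have hηc : ContinuousOn (fun s => (x s).snd.snd) (Icc t₀ t₁) :=
    (auxL N).continuous.comp_continuousOn hx
  have hqQ : MapsTo (fun s => (x s).fst) (Icc t₀ t₁) Q := fun s hs => (hxM s hs).1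
  have hψc : ContinuousOn (fun s => ψ (x s).fst) (Icc t₀ t₁) :=
    hs.output.continuousOn.comp hqc hqQ
  have hgc : ContinuousOn
      (fun s => gainDeriv Q (Y i) ψ α h (x s).fst (x s).snd.fst (x s).snd.snd) (Icc t₀ t₁) := by
    have h1 := hs.contDiffOn_gainDeriv (h := h) i (s := tangentBundleProd Q)
      contDiff_pos.contDiffOn (fun x hx => hx.1) contDiff_vel.contDiffOn (fun x hx => hx.2)
      contDiff_aux.contDiffOn
    exact h1.continuousOn.comp hx hxM
  refine ⟨hgc, fun t ht => ?_⟩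
  have hKc : ContinuousOn (fun s => α (ψ (x s).fst - (x s).snd.snd) • Y i (x s).fst) (Icc t₀ t₁) :=
    (hs.gain.continuous.comp_continuousOn (hψc.sub hηc)).smul
      ((hs.control i).1.continuousOn.comp hqc hqQ)
  have hsub : Icc t₀ t ⊆ Icc t₀ t₁ := Icc_subset_Icc le_rfl ht.2
  have hprim : ∀ {G : Type} [NormedAddCommGroup G] [NormedSpace ℝ G] [CompleteSpace G]
      {K k : ℝ → G}, ContinuousOn k (Icc t₀ t₁) →
      (∀ t ∈ Icc t₀ t₁, K t = K t₀ + ∫ s in t₀..t, k s) →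
      ∀ t ∈ Ioo t₀ t₁, HasDerivAt K (k t) t := by
    intro G _ _ _ K k hk hK t ht
    have h1 : HasDerivAt (fun τ => ∫ s in t₀..τ, k s) (k t) t := by
      refine intervalIntegral.integral_hasDerivAt_right ?_
        ((hk.mono Ioo_subset_Icc_self).stronglyMeasurableAtFilter isOpen_Ioo t ht)
        (hk.continuousAt (Icc_mem_nhds ht.1 ht.2))
      refine (hk.mono ?_).intervalIntegrable
      rw [uIcc_of_le ht.1.le]
      exact Icc_subset_Icc le_rfl ht.2.le
    refine (h1.const_add (K t₀)).congr_of_eventuallyEq ?_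
    filter_upwards [Icc_mem_nhds ht.1 ht.2] with s hs using hK s hs
  have hd : ∀ s ∈ Ioo t₀ t, HasDerivAt
      (fun s => α (ψ (x s).fst - (x s).snd.snd) • Y i (x s).fst)
      (gainDeriv Q (Y i) ψ α h (x s).fst (x s).snd.fst (x s).snd.snd) s := by
    intro s hst
    have hs' : s ∈ Ioo t₀ t₁ := ⟨hst.1, hst.2.trans_le ht.2⟩
    refine hs.hasDerivAt_gain i (q := fun s => (x s).fst) (η := fun s => (x s).snd.snd) ?_
      (hprim hvc hq s hs') (hprim ((continuousOn_const.mul hηc).add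
        (continuousOn_const.mul hψc)) hη s hs')
    filter_upwards [Icc_mem_nhds hs'.1 hs'.2] with τ hτ using hqQ hτ
  rw [intervalIntegral.integral_eq_sub_of_hasDerivAt_of_le ht.1 (hKc.mono hsub) hd
    ((hgc.mono (by rw [uIcc_of_le ht.1]; exact hsub)).intervalIntegrable), add_sub_cancel]

/-- The right-hand side is the formal time derivative of the velocity shift: `om * u (om * t)` is
the derivative of the antiderivative at `om * t`, and `gainDeriv` that of its coefficient. -/
theorem closedLoop_sub_transformedField (om t : ℝ) (x : State N) :
    closedLoop C Y₀ Y R ψ α u lam mu h om t x - transformedField C Y₀ Y R ψ α lam mu h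
      (ditherPrimitive T u (om * t), shiftVelocity Y ψ α T u lam om t x) =
    mkStateL N (0, ∑ i, ((om * u (om * t) i) • (lam i • α (ψ x.fst - x.snd.snd) • Y i x.fst) +
      ditherPrimitive T u (om * t) i •
        (lam i • gainDeriv Q (Y i) ψ α h x.fst x.snd.fst x.snd.snd)), 0) := by
  set q := x.fst with hq
  set v := x.snd.fst with hv
  set η := x.snd.snd with hη
  set U := ditherPrimitive T u (om * t) with hU
  have h1 : transformedField C Y₀ Y R ψ α lam mu h (U, shiftVelocity Y ψ α T u lam om t x) =
      mkStateL N (v, slowForce C Y₀ Y R ψ α lam mu q v η -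
        ∑ i, (U i * lam i) • gainDeriv Q (Y i) ψ α h q v η, -h * η + h * ψ q) := by
    have h2 : (v - ditherShift Y ψ α lam U q η) + ditherShift Y ψ α lam U q η = v :=
      sub_add_cancel _ _
    rw [← h2]
    rfl
  have h3 : closedLoop C Y₀ Y R ψ α u lam mu h om t x =
      mkStateL N (v, slowForce C Y₀ Y R ψ α lam mu q v η +
        ∑ i, (om * u (om * t) i * lam i * α (ψ q - η)) • Y i q, -h * η + h * ψ q) := by
    rw [mkStateL_apply, slowForce, add_assoc]
    rfl
  rw [h1, h3, ← map_sub]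
  congr 1
  refine Prod.ext (sub_self _) (Prod.ext ?_ (sub_self _))
  simp only [Prod.snd_sub, Prod.fst_sub, Finset.sum_add_distrib, smul_smul, mul_assoc]
  abel

theorem sub_shiftVelocity (t : ℝ) (x : State N) : x - shiftVelocity Y ψ α T u lam om t x =
    mkStateL N (0, ∑ i, ditherPrimitive T u (om * t) i •
      (lam i • α (ψ x.fst - x.snd.snd) • Y i x.fst), 0) := by
  have h1 : x = mkStateL N (x.fst, x.snd.fst, x.snd.snd) := rfl
  have h2 : shiftVelocity Y ψ α T u lam om t x = mkStateL N (x.fst, x.snd.fst - ∑ i,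
    (ditherPrimitive T u (om * t) i * lam i * α (ψ x.fst - x.snd.snd)) • Y i x.fst, x.snd.snd) := rfl
  rw [h2]
  nth_rw 1 [h1]
  rw [← map_sub]
  congr 1
  refine Prod.ext (sub_self _) (Prod.ext ?_ (sub_self _))
  simp only [Prod.snd_sub, Prod.fst_sub, sub_sub_cancel, smul_smul, mul_assoc]

/-- Only the equations for `q` and `η` are assumed, and these do not contain the dither. Hence the
identity applies both to solutions of the closed loop and to transformed solutions carried back,
where the velocity equation is still to be proved. -/
theorem integral_closedLoop_sub (hs : IsSmoothSystem Q Y₀ Y R ψ α) (hu : IsDither T u)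
    {x : ℝ → State N} {t₀ t₁ : ℝ} (hx : ContinuousOn x (Icc t₀ t₁))
    (hxM : ∀ t ∈ Icc t₀ t₁, x t ∈ tangentBundleProd Q)
    (hq : ∀ t ∈ Icc t₀ t₁, (x t).fst = (x t₀).fst + ∫ s in t₀..t, (x s).snd.fst)
    (hη : ∀ t ∈ Icc t₀ t₁, (x t).snd.snd = (x t₀).snd.snd +
      ∫ s in t₀..t, (-h * (x s).snd.snd + h * ψ (x s).fst)) {t : ℝ} (ht : t ∈ Icc t₀ t₁) :
    IntervalIntegrable (fun s => closedLoop C Y₀ Y R ψ α u lam mu h om s (x s) -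
      transformedField C Y₀ Y R ψ α lam mu h
        (ditherPrimitive T u (om * s), shiftVelocity Y ψ α T u lam om s (x s))) volume t₀ t ∧
    ∫ s in t₀..t, (closedLoop C Y₀ Y R ψ α u lam mu h om s (x s) -
      transformedField C Y₀ Y R ψ α lam mu h
        (ditherPrimitive T u (om * s), shiftVelocity Y ψ α T u lam om s (x s))) =
      (x t - shiftVelocity Y ψ α T u lam om t (x t)) -
        (x t₀ - shiftVelocity Y ψ α T u lam om t₀ (x t₀)) := by
  obtain ⟨B, hB⟩ := hu.bounded
  have hsub : Icc t₀ t ⊆ Icc t₀ t₁ := Icc_subset_Icc le_rfl ht.2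
  have key : ∀ i, IntervalIntegrable (fun s =>
      (om * u (om * s) i) • (lam i • α (ψ (x s).fst - (x s).snd.snd) • Y i (x s).fst) +
      ditherPrimitive T u (om * s) i •
        (lam i • gainDeriv Q (Y i) ψ α h (x s).fst (x s).snd.fst (x s).snd.snd)) volume t₀ t ∧
      ∫ s in t₀..t,
      ((om * u (om * s) i) • (lam i • α (ψ (x s).fst - (x s).snd.snd) • Y i (x s).fst) +
      ditherPrimitive T u (om * s) i •
        (lam i • gainDeriv Q (Y i) ψ α h (x s).fst (x s).snd.fst (x s).snd.snd)) =
      ditherPrimitive T u (om * t) i • (lam i • α (ψ (x t).fst - (x t).snd.snd) • Y i (x t).fst) -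
      ditherPrimitive T u (om * t₀) i •
        (lam i • α (ψ (x t₀).fst - (x t₀).snd.snd) • Y i (x t₀).fst) := by
    intro i
    obtain ⟨hc, hK⟩ := hs.gain_eq_add_integral i hx hxM hq hη
    have hwB : ∀ s, |om * u (om * s) i| ≤ |om| * B := fun s => by
      rw [abs_mul]
      exact mul_le_mul_of_nonneg_left (hB _ _) (abs_nonneg _)
    have hw : IntervalIntegrable (fun s => om * u (om * s) i) volume t₀ t := by
      refine (intervalIntegrable_const (c := |om| * B)).mono_fun ?_
        (Eventually.of_forall fun s => (hwB s).trans (le_abs_self _))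
      exact (((measurable_pi_apply i).comp (hu.measurable.comp
        (measurable_const_mul om))).const_mul om).aestronglyMeasurable
    refine integral_smul_add_smul_eq_sub (w := fun s => om * u (om * s) i)
      (W := fun s => ditherPrimitive T u (om * s) i)
      (k := fun s => lam i • gainDeriv Q (Y i) ψ α h (x s).fst (x s).snd.fst (x s).snd.snd)
      (K := fun s => lam i • α (ψ (x s).fst - (x s).snd.snd) • Y i (x s).fst)
      ht.1 hw hwB (continuousOn_const.fun_smul (hc.mono hsub)) (fun s _ => ?_) fun s hst => ?_
    · rw [hu.ditherPrimitive_eq_add i (om * t₀) (om * s),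
        ← intervalIntegral.smul_integral_comp_mul_left, intervalIntegral.integral_const_mul,
        smul_eq_mul]
    · rw [hK s (hsub hst), smul_add, intervalIntegral.integral_smul]
  have hint : IntervalIntegrable (fun s => ∑ i,
      ((om * u (om * s) i) • (lam i • α (ψ (x s).fst - (x s).snd.snd) • Y i (x s).fst) +
      ditherPrimitive T u (om * s) i •
        (lam i • gainDeriv Q (Y i) ψ α h (x s).fst (x s).snd.fst (x s).snd.snd))) volume t₀ t := by
    simpa only [Finset.sum_apply, Finset.sum_fn] using
      IntervalIntegrable.sum Finset.univ fun i _ => (key i).1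
  set E : Euc N →L[ℝ] State N := (mkStateL N).comp ((ContinuousLinearMap.inr ℝ (Euc N) (Euc N × ℝ)).comp
    (ContinuousLinearMap.inl ℝ (Euc N) ℝ)) with hE
  have hE' : ∀ a : Euc N, mkStateL N (0, a, 0) = E a := fun a => rfl
  simp only [closedLoop_sub_transformedField, sub_shiftVelocity, hE']
  refine ⟨⟨E.integrable_comp hint.1, E.integrable_comp hint.2⟩, ?_⟩
  rw [E.intervalIntegral_comp_comm hint, intervalIntegral.integral_finsetSum fun i _ => (key i).1,
    ← map_sub, ← Finset.sum_sub_distrib]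
  exact congrArg E (Finset.sum_congr rfl fun i _ => (key i).2)

theorem continuousOn_unshiftVelocity (hs : IsSmoothSystem Q Y₀ Y R ψ α) (hu : IsDither T u)
    {x : ℝ → State N} {I : Set ℝ} (hx : ContinuousOn x I) (hxM : ∀ t ∈ I, x t ∈ tangentBundleProd Q) :
    ContinuousOn (fun t => unshiftVelocity Y ψ α T u lam om t (x t)) I := by
  have hq : ContDiffOn ℝ ∞ (fun p : (Fin n → ℝ) × State N => p.2.fst)
      (univ ×ˢ tangentBundleProd Q) := (contDiff_pos.comp contDiff_snd).contDiffOn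
  have hv : ContDiffOn ℝ ∞ (fun p : (Fin n → ℝ) × State N => p.2.snd.fst)
      (univ ×ˢ tangentBundleProd Q) := (contDiff_vel.comp contDiff_snd).contDiffOn
  have hη : ContDiffOn ℝ ∞ (fun p : (Fin n → ℝ) × State N => p.2.snd.snd)
      (univ ×ˢ tangentBundleProd Q) := (contDiff_aux.comp contDiff_snd).contDiffOn
  have h1 := contDiffOn_mkState hq (hv.add (hs.contDiffOn_ditherShift (lam := lam) hq
    (fun p hp => hp.2.1) hη contDiff_fst.contDiffOn)) hη
  have h2 : ContinuousOn (fun t => (ditherPrimitive T u (om * t), x t)) I :=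
    (hu.continuous_ditherPrimitive.comp (continuous_const.mul continuous_id)).continuousOn.prodMk hx
  exact h1.continuousOn.comp h2 fun t ht => ⟨mem_univ _, hxM t ht⟩

theorem isSolutionOn_shiftVelocity (hs : IsSmoothSystem Q Y₀ Y R ψ α) (hu : IsDither T u)
    {x : ℝ → State N} {t₀ t₁ : ℝ} (hx : IsSolutionOn (tangentBundleProd Q)
      (closedLoop C Y₀ Y R ψ α u lam mu h om) t₀ (Icc t₀ t₁) x) :
    IsSolutionOn (tangentBundleProd Q)
      (fun t y => transformedField C Y₀ Y R ψ α lam mu h (ditherPrimitive T u (om * t), y))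
      t₀ (Icc t₀ t₁) fun t => shiftVelocity Y ψ α T u lam om t (x t) := by
  intro t ht
  obtain ⟨hxM, h1, h2⟩ := hx t ht
  obtain ⟨h3, h4⟩ := hs.integral_closedLoop_sub (C := C) (lam := lam) (mu := mu) (om := om) (h := h)
    hu hx.continuousOn (fun t ht => (hx t ht).1)
    (fun t ht => IsSolutionOn.apply_eq_add_integral hx ht (posL N))
    (fun t ht => IsSolutionOn.apply_eq_add_integral hx ht (auxL N)) ht
  refine ⟨hs.mapsTo_shiftVelocity t hxM, ?_, ?_⟩
  · simpa only [sub_sub_cancel] using h1.sub h3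
  · have h5 := intervalIntegral.integral_sub h1 h3
    simp only [sub_sub_cancel] at h5
    rw [h5, h4, eq_sub_of_add_eq' h2.symm]
    abel

theorem isSolutionOn_unshiftVelocity (hs : IsSmoothSystem Q Y₀ Y R ψ α) (hu : IsDither T u)
    {y : ℝ → State N} {t₀ t₁ : ℝ} (hy : IsSolutionOn (tangentBundleProd Q)
      (fun t y => transformedField C Y₀ Y R ψ α lam mu h (ditherPrimitive T u (om * t), y))
      t₀ (Icc t₀ t₁) y) :
    IsSolutionOn (tangentBundleProd Q) (closedLoop C Y₀ Y R ψ α u lam mu h om) t₀ (Icc t₀ t₁)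
      fun t => unshiftVelocity Y ψ α T u lam om t (y t) := by
  intro t ht
  obtain ⟨hyM, h1, h2⟩ := hy t ht
  obtain ⟨h3, h4⟩ := hs.integral_closedLoop_sub (C := C) (lam := lam) (mu := mu) (om := om) (h := h)
    hu (x := fun t => unshiftVelocity Y ψ α T u lam om t (y t))
    (hs.continuousOn_unshiftVelocity hu hy.continuousOn fun t ht => (hy t ht).1)
    (fun t ht => hs.mapsTo_unshiftVelocity t (hy t ht).1)
    (fun t ht => IsSolutionOn.apply_eq_add_integral hy ht (posL N))
    (fun t ht => IsSolutionOn.apply_eq_add_integral hy ht (auxL N)) ht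
  simp only [shiftVelocity_unshiftVelocity] at h3 h4
  refine ⟨hs.mapsTo_unshiftVelocity t hyM, ?_, ?_⟩
  · simpa only [sub_add_cancel] using h3.add h1
  · have h5 := intervalIntegral.integral_add h3 h1
    simp only [sub_add_cancel] at h5
    rw [h5, h4, eq_sub_of_add_eq' h2.symm]
    abel

/-- Existence is transported by `unshiftVelocity`; uniqueness needs the opposite direction, since
competing closed-loop solutions are compared after `shiftVelocity`. -/
theorem maximalSolutionSatisfies_closedLoop (hs : IsSmoothSystem Q Y₀ Y R ψ α) (hu : IsDither T u)
    {t₀ : ℝ} {y₀ : State N} (hy₀ : y₀ ∈ tangentBundleProd Q) {P : ℝ → State N → Prop}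
    (hy : MaximalSolutionSatisfies (tangentBundleProd Q)
      (fun t y => transformedField C Y₀ Y R ψ α lam mu h (ditherPrimitive T u (om * t), y)) t₀
      (Function.invFunOn (fun y => y) (tangentBundleProd Q) y₀) P) :
    MaximalSolutionSatisfies (tangentBundleProd Q) (closedLoop C Y₀ Y R ψ α u lam mu h om) t₀
      (Function.invFunOn (shiftVelocity Y ψ α T u lam om t₀) (tangentBundleProd Q) y₀)
      (fun t x => P t (shiftVelocity Y ψ α T u lam om t x)) := by
  rw [invFunOn_self_apply hy₀] at hy
  -- The abstract inverse is the explicit one because the shift is injective.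
  have h0 : Function.invFunOn (shiftVelocity Y ψ α T u lam om t₀) (tangentBundleProd Q) y₀ =
      unshiftVelocity Y ψ α T u lam om t₀ y₀ := by
    have h1 := Function.invFunOn_eq (f := shiftVelocity Y ψ α T u lam om t₀)
      ⟨_, hs.mapsTo_unshiftVelocity t₀ hy₀, shiftVelocity_unshiftVelocity t₀ y₀⟩
    rw [← unshiftVelocity_shiftVelocity t₀ (Function.invFunOn _ _ _), h1]
  rw [h0]
  obtain ⟨y, hy, hyt, huniq, hP⟩ := hy
  refine ⟨fun t => unshiftVelocity Y ψ α T u lam om t (y t), IsSolutionOn.Ici_of_forall fun t₁ =>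
    hs.isSolutionOn_unshiftVelocity hu (hy.mono Icc_subset_Ici_self), by simp only [hyt],
    fun t₁ z hz hzt t ht => ?_, fun t ht => ?_⟩
  · have h1 := huniq t₁ _ (hs.isSolutionOn_shiftVelocity hu hz)
      (by rw [hzt, shiftVelocity_unshiftVelocity]) ht
    simp only at h1 ⊢
    rw [← h1, unshiftVelocity_shiftVelocity]
  · simp only [shiftVelocity_unshiftVelocity]
    exact hP t ht

theorem practicallyUniformlyAsymptoticallyStable_closedLoop (hs : IsSmoothSystem Q Y₀ Y R ψ α)
    (hu : IsDither T u) {K S : Set (State N)} (hS : S ⊆ tangentBundleProd Q)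
    (hstab : PracticallyUniformlyAsymptoticallyStable (tangentBundleProd Q)
      (fun om t y => transformedField C Y₀ Y R ψ α lam mu h (ditherPrimitive T u (om * t), y))
      (fun _ _ y => y) K S) :
    PracticallyUniformlyAsymptoticallyStable (tangentBundleProd Q)
      (closedLoop C Y₀ Y R ψ α u lam mu h) (shiftVelocity Y ψ α T u lam) K S := by
  constructor
  · intro ε hε
    obtain ⟨om₀, hom₀, δ, hδ, h⟩ := hstab.1 ε hε
    exact ⟨om₀, hom₀, δ, hδ, fun om hom t₀ y₀ hy₀ hyK =>
      hs.maximalSolutionSatisfies_closedLoop hu hy₀ (h om hom t₀ y₀ hy₀ hyK)⟩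
  · intro r hr ε hε
    obtain ⟨om₀, hom₀, Δ, hΔ, ρ, hρ, h⟩ := hstab.2 r hr ε hε
    exact ⟨om₀, hom₀, Δ, hΔ, ρ, hρ, fun om hom t₀ y₀ hy₀ hyK =>
      hs.maximalSolutionSatisfies_closedLoop hu (hS hy₀) (h om hom t₀ y₀ hy₀ hyK)⟩

end IsSmoothSystem

end ChangeOfVariables

/-! ### Relative compactness of motions for closed `Q`, and the conclusion. -/

section Compactness

variable {F : Type*} [NormedAddCommGroup F] [InnerProductSpace ℝ F]

theorem MaximalSolutionSatisfies.imp {M : Set F} {f : ℝ → F → F} {t₀ : ℝ} {x₀ : F}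
    {P P' : ℝ → F → Prop} (h : MaximalSolutionSatisfies M f t₀ x₀ P)
    (hP : ∀ t x, x ∈ M → P t x → P' t x) : MaximalSolutionSatisfies M f t₀ x₀ P' := by
  obtain ⟨x, hx, h0, huniq, hPx⟩ := h
  exact ⟨x, hx, h0, huniq, fun t ht => hP t _ (hx t ht).1 (hPx t ht)⟩

/-- On a closed set, boundedness of the motions amounts to relative compactness. -/
theorem UniformlyAsymptoticallyStable.motionsRelativelyCompact [FiniteDimensional ℝ F] {M : Set F}
    {g : ℝ → F → F} {K S : Set F} (hM : IsClosed M) (hK : IsCompact K) (hK_ne : K.Nonempty)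
    (hS : S ⊆ M) (h : UniformlyAsymptoticallyStable M g K S) : MotionsRelativelyCompact M g K S := by
  intro r hr
  obtain ⟨om₀, _, _, _, ρ, _, h⟩ := h.2 r hr 1 one_pos
  refine ⟨M ∩ Metric.cthickening ρ K, inter_subset_left,
    hK.cthickening.inter_left hM, fun t₀ x₀ hx₀ hr => ?_⟩
  have h1 := h om₀ le_rfl t₀ x₀ hx₀ hr
  rw [invFunOn_self_apply (hS hx₀)] at h1
  exact h1.imp fun t x hx hP => ⟨hx, mem_cthickening_of_infDist_le hK_ne hP.1⟩

end Compactness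

end ExtremumSeeking

theorem mainTheorem3 {N n : ℕ} (Q : Set (Euc N)) (hQ : IsEmbeddedSubmanifold Q)
    (C : AffineConnection Q)
    (Y₀ : Euc N → Euc N) (hY₀ : IsSmoothVectorField Q Y₀)
    (Y : Fin n → Euc N → Euc N) (hY : ∀ i, IsSmoothVectorField Q (Y i))
    (R : Euc N → Euc N →ₗ[ℝ] Euc N) (hR : IsSmoothBundleMap Q R)
    (ψ : Euc N → ℝ) (hψ : ContDiffOn ℝ ∞ ψ Q)
    (α : ℝ → ℝ) (hα : ContDiff ℝ ∞ α) (hα_pos : ∀ z, 0 < α z * deriv α z)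
    (hα_mono : StrictMono (fun z => α z * deriv α z))
    (T : ℝ) (u : ℝ → Fin n → ℝ) (hu : IsDither T u)
    (lam mu : Fin n → ℝ) (h : ℝ) (hh : 0 < h)
    (K : Set (State N)) (hK_ne : K.Nonempty) (hK : IsCompact K) (hKM : K ⊆ tangentBundleProd Q)
    (S : Set (State N)) (hS : IsNeighborhoodIn (tangentBundleProd Q) K S)
    (hcl : IsClosed Q ∨ MotionsRelativelyCompact (tangentBundleProd Q)
      (averagedSystem C Y₀ Y R ψ α lam mu h) K S)
    (havg : UniformlyAsymptoticallyStable (tangentBundleProd Q)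
      (averagedSystem C Y₀ Y R ψ α lam mu h) K S) :
    PracticallyUniformlyAsymptoticallyStable (tangentBundleProd Q)
      (closedLoop C Y₀ Y R ψ α u lam mu h) (shiftVelocity Y ψ α T u lam) K S := by
  have hs : IsSmoothSystem Q Y₀ Y R ψ α := ⟨hQ.isLocalRetract, hY₀, hY, hR, hψ, hα⟩
  refine hs.practicallyUniformlyAsymptoticallyStable_closedLoop hu hS.1 ?_
  refine (hs.isOscillatingField hu).practicallyUniformlyAsymptoticallyStable
    -- The averaged system is autonomous, so any value, here `0`, may fill its time argument.
    (g := averagedSystem C Y₀ Y R ψ α lam mu h 0) (fun x hx => hs.averagedSystem_eq hu 0 hx)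
    hK_ne hK hKM hS ?_ havg
  rcases hcl with hcl | hcl
  · exact UniformlyAsymptoticallyStable.motionsRelativelyCompact
      (isClosed_tangentBundleProd hs.isLocalRetract hcl) hK hK_ne hS.1 havg
  · exact hcl
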